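/- Let $P=\{x\in\mathbb R^n:\ \ell_a(x)=\langle x,\nu_a\rangle-\lambda_a\ge 0,\ a=1,\dots,d\}$ be an integral Delzant polytope for the lattice $\Lambda^*=\mathbb Z^n$, with associated polarized toric manifold $(X,L)$, and let $u$ be a symplectic potential on $P$: a strictly convex function on $P$, smooth in the interior, such that $u-\frac12\sum_a\ell_a\log\ell_a$ is smooth up to the boundary of $P$ and such that the restriction of $u$ to every face of $P$ (including $P$ itself) has positive definite Hessian in the relative interior of that face. Let $H_{ij}=\partial_i\partial_ju$ and $(G^{ij})=H^{-1}$, let $g=H_{ij}\,dx_idx_j+G^{ij}\,d\theta_id\theta_j$ and $\omega=dx_j\wedge d\theta_j$ be the associated toric Kähler metric and form on $X$ (given here on $\mathrm{Int}(P)\times T^n$, $T^n=(\mathbb R/2\pi\mathbb Z)^n$), and let $s$ be the scalar curvature of $g$ in the Kähler normalization, i.e. one half of the Riemannian scalar curvature. Then $G^{ij}$ and $s$ extend to smooth functions on $P$. Give $L$ the Hermitian metric of curvature $-i\omega$ for which, over $\mathrm{Int}(P)\times T^n$, an equivariant holomorphic frame has squared length $e^{-2\psi}$, $\psi(x)=\langle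 x,du(x)\rangle-u(x)$. For an integer $k\ge1$ and $\alpha\in P$ with $k\alpha\in\mathbb Z^n$ let $e_{\alpha,k}$ be the holomorphic section of $L^k$ that in this frame is a multiple of $\exp\big(k\sum_j\alpha_j(\partial_ju+i\theta_j)\big)$, scaled to have $L^2$-norm $1$ with respect to $\omega^n/n!$. For arbitrary $\alpha\in P$ define the pointwise squared length $|e_{\alpha,k}|^2$ by the same formula. For a smooth $T^n$-invariant function on $X$, identified with $f\in C^\infty(P)$, put $\langle|e_{\alpha,k}|^2,f\rangle=\int_X|e_{\alpha,k}|^2f\,\omega^n/n!$. Then for all integers $k\ge1$ and all $\alpha\in P$ (in particular for all $\alpha \in P$ with $k\alpha\in\mathbb Z^n$, and also for $\alpha\in\partial P$) and all $f\in C^\infty(P)$, $$\langle |e_{\alpha,k}|^2,f\rangle=f(\alpha)+\frac1{2k}\Big(s(\alpha)f(\alpha)+\frac12\,\partial_i\partial_j(G^{ij}f)(\alpha)\Big)+\frac1{k^2}\langle R_k(\alpha),f\rangle$$ (summation over repeated indices), where $R_k(\alpha)$ is a linear functional on $C^\infty(P)$ such that - there is a constant $C$, depending only on $P$ and $u$,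 with $|\langle R_k(\alpha),f\rangle|\le C\|f\|_{C^4(P)}$ for all $k\ge1$, $\alpha\in P$ and $f\in C^\infty(P)$; - for every $k\ge1$ and every $f\in C^\infty(P)$ the function $\alpha\mapsto\langle R_k(\alpha),f\rangle$ is smooth on $P$ (up to the boundary). -/

import Mathlib

open Set MeasureTheory Topology
open scoped ContDiff

noncomputable section

namespace Toric

/-! ### Integral Delzant polytopes -/

/-- An integral Delzant polytope in `ℝⁿ = 𝔱*` with coweight lattice `ℤⁿ`, presented by its facets:
`P = {x | ℓ_a(x) = ⟨x, ν_a⟩ - λ_a ≥ 0 for all a}` with `ν_a ∈ ℤⁿ` and `λ_a ∈ ℤ`. -/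
structure DelzantPolytope (n : ℕ) where
  /-- number of facets -/
  d : ℕ
  /-- the inward conormals `ν_a` -/
  normal : Fin d → Fin n → ℤ
  /-- the constants `λ_a` -/
  offset : Fin d → ℤ
  bounded : Bornology.IsBounded
    {x : EuclideanSpace ℝ (Fin n) | ∀ a, 0 ≤ ∑ i, x i * (normal a i : ℝ) - (offset a : ℝ)}
  fullDim : (interior
    {x : EuclideanSpace ℝ (Fin n) | ∀ a, 0 ≤ ∑ i, x i * (normal a i : ℝ) - (offset a : ℝ)}).Nonempty
  /-- every `ℓ_a` vanishes somewhere on `P`, so no half-space is superfluous -/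
  facet : ∀ a, ∃ x ∈
    {x : EuclideanSpace ℝ (Fin n) | ∀ b, 0 ≤ ∑ i, x i * (normal b i : ℝ) - (offset b : ℝ)},
    ∑ i, x i * (normal a i : ℝ) - (offset a : ℝ) = 0
  /-- At each vertex `v` exactly `n` facets meet, and the `n` edges at `v`, which run in the
  directions `e_j` determined by `⟨ν_i, e_j⟩ = δ_{ij}` (`ν_1, …, ν_n` the conormals of the facets
  through `v`), are spanned by a basis `e_1, …, e_n` of the lattice. -/
  delzant : ∀ v ∈ Set.extremePoints ℝ
    {x : EuclideanSpace ℝ (Fin n) | ∀ a, 0 ≤ ∑ i, x i * (normal a i : ℝ) - (offset a : ℝ)},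
    ∃ (e : Module.Basis (Fin n) ℤ (Fin n → ℤ))
      (σ : Fin n ≃ {a : Fin d // ∑ i, v i * (normal a i : ℝ) - (offset a : ℝ) = 0}),
      ∀ i j, ∑ m, normal (σ i).1 m * e j m = if i = j then 1 else 0

variable {n : ℕ}

/-- The defining functions `ℓ_a(x) = ⟨x, ν_a⟩ - λ_a` of the facets. -/
def DelzantPolytope.ell (D : DelzantPolytope n) (a : Fin D.d) (x : EuclideanSpace ℝ (Fin n)) : ℝ :=
  ∑ i, x i * (D.normal a i : ℝ) - (D.offset a : ℝ)

/-- The polytope as a subset of `ℝⁿ`. -/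
def DelzantPolytope.carrier (D : DelzantPolytope n) : Set (EuclideanSpace ℝ (Fin n)) :=
  {x | ∀ a, 0 ≤ D.ell a x}

/-! ### Symplectic potentials -/

/-- The Guillemin potential `u₀ = ½ ∑ ℓ_a log ℓ_a` (here `0 log 0 = 0`). -/
def guillemin (D : DelzantPolytope n) (x : EuclideanSpace ℝ (Fin n)) : ℝ :=
  (1 / 2) * ∑ a, D.ell a x * Real.log (D.ell a x)

/-- `u` is a symplectic potential on `P`: strictly convex, smooth in the interior, with `u - u₀`
smooth up to the boundary, and such that the restriction of `u` to each face `F` (including `P`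
itself) has positive definite Hessian in the relative interior of `F`.  The vectors tangent to the
face containing `x` in its relative interior are those annihilated by all the `ν_a` with
`ℓ_a(x) = 0`. -/
structure IsSymplecticPotential (D : DelzantPolytope n) (u : EuclideanSpace ℝ (Fin n) → ℝ) :
    Prop where
  strictConvex : StrictConvexOn ℝ D.carrier u
  smooth_interior : ContDiffOn ℝ ∞ u (interior D.carrier)
  smooth_sub : ContDiffOn ℝ ∞ (fun x => u x - guillemin D x) D.carrier
  hess_pos : ∀ x ∈ D.carrier, ∀ v : EuclideanSpace ℝ (Fin n), v ≠ 0 →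
    (∀ a, D.ell a x = 0 → ∑ i, v i * (D.normal a i : ℝ) = 0) →
    0 < iteratedDeriv 2 (fun t : ℝ => u (x + t • v)) 0

/-! ### Partial derivatives, the matrices `H` and `G` -/

/-- The partial derivative `∂_i F`. -/
def pd {ι : Type} [Fintype ι] [DecidableEq ι] (i : ι) (F : EuclideanSpace ℝ ι → ℝ)
    (x : EuclideanSpace ℝ ι) : ℝ :=
  fderiv ℝ F x (EuclideanSpace.single i 1)

/-- The partial derivative `∂_i F` of a function on a closed set `P` with dense interior
(one-sided at the boundary). -/
def pdWithin (P : Set (EuclideanSpace ℝ (Fin n))) (i : Fin n) (F : EuclideanSpace ℝ (Fin n) → ℝ)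
    (x : EuclideanSpace ℝ (Fin n)) : ℝ :=
  fderivWithin ℝ F P x (EuclideanSpace.single i 1)

/-- `H_{ij} = ∂_i ∂_j u`. -/
def hess (u : EuclideanSpace ℝ (Fin n) → ℝ) (x : EuclideanSpace ℝ (Fin n)) :
    Matrix (Fin n) (Fin n) ℝ :=
  Matrix.of fun i j => pd i (pd j u) x

/-- `G^{ij}`, the entries of `H⁻¹`, extended by continuity from the interior of `P` to `P`. -/
def invHess (D : DelzantPolytope n) (u : EuclideanSpace ℝ (Fin n) → ℝ) (i j : Fin n) :
    EuclideanSpace ℝ (Fin n) → ℝ :=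
  extendFrom (interior D.carrier) (fun x => (hess u x)⁻¹ i j)

/-! ### Scalar curvature -/

section curvature

variable {ι : Type} [Fintype ι] [DecidableEq ι]

/-- Christoffel symbols `Γ^l_{ij}` of the metric with coefficient matrix `g`. -/
def christoffel (g : EuclideanSpace ℝ ι → Matrix ι ι ℝ) (l i j : ι) (z : EuclideanSpace ℝ ι) : ℝ :=
  (1 / 2) * ∑ m, (g z)⁻¹ l m *
    (pd i (fun y => g y j m) z + pd j (fun y => g y i m) z - pd m (fun y => g y i j) z)

/-- Ricci curvature `R_{ij}` of the metric with coefficient matrix `g`. -/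
def ricci (g : EuclideanSpace ℝ ι → Matrix ι ι ℝ) (i j : ι) (z : EuclideanSpace ℝ ι) : ℝ :=
  ∑ l, (pd l (christoffel g l i j) z - pd j (christoffel g l i l) z) +
    ∑ l, ∑ m, (christoffel g l l m z * christoffel g m i j z -
      christoffel g l j m z * christoffel g m i l z)

/-- Riemannian scalar curvature `g^{ij} R_{ij}`. -/
def riemannScalar (g : EuclideanSpace ℝ ι → Matrix ι ι ℝ) (z : EuclideanSpace ℝ ι) : ℝ :=
  ∑ i, ∑ j, (g z)⁻¹ i j * ricci g i j z

end curvature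

/-- The toric Kähler metric `g = H_{ij} dx_i dx_j + G^{ij} dθ_i dθ_j` in the coordinates
`(x, θ)` on `Int(P) × Tⁿ`; `Sum.inl` indexes the `x_i` and `Sum.inr` the `θ_i`. -/
def toricMetric (u : EuclideanSpace ℝ (Fin n) → ℝ) (z : EuclideanSpace ℝ (Fin n ⊕ Fin n)) :
    Matrix (Fin n ⊕ Fin n) (Fin n ⊕ Fin n) ℝ :=
  Matrix.fromBlocks (hess u (WithLp.toLp 2 fun i => z (Sum.inl i))) 0 0
    (hess u (WithLp.toLp 2 fun i => z (Sum.inl i)))⁻¹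

/-- The scalar curvature `s` as a function on `P`, in the normalization usual in Kähler geometry:
the trace of the Ricci form with respect to `ω`, which is one half of the Riemannian scalar
curvature.  It does not depend on `θ`, and is extended by continuity from the interior of `P`. -/
def scalarCurvature (D : DelzantPolytope n) (u : EuclideanSpace ℝ (Fin n) → ℝ) :
    EuclideanSpace ℝ (Fin n) → ℝ :=
  extendFrom (interior D.carrier) (fun x =>
    (1 / 2) * riemannScalar (toricMetric u) (WithLp.toLp 2 (Sum.elim (fun i => x i) (fun _ => 0))))

/-! ### Holomorphic sections and their mass densities

On the dense open orbit `X° = Int(P) × Tⁿ` the functions `w_j = ∂_j u(x) + √-1 θ_j` are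
(logarithmic) holomorphic coordinates. There `L` is trivialized by an equivariant holomorphic frame
of squared length `exp(-2 ψ)`, `ψ` the Legendre transform of `u`; the curvature of this Hermitian
metric is `-√-1 ω` with `ω = dx_j ∧ dθ_j`. -/

/-- The Legendre transform `ψ = ⟨x, du(x)⟩ - u(x)` of `u`, as a function of `x`. -/
def legendre (u : EuclideanSpace ℝ (Fin n) → ℝ) (x : EuclideanSpace ℝ (Fin n)) : ℝ :=
  ∑ j, x j * pd j u x - u x

/-- The equivariant holomorphic section `exp(k ⟨α, w⟩)` of `L^k` over `X°` with weight `α`, in the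
above frame. For `α ∈ Λ*_k`, i.e. `k α ∈ ℤⁿ`, it is `2π`-periodic in each `θ_j`, and it extends to `X`
if moreover `α ∈ P`. For other `α` it is multivalued, but its pointwise length is well defined. -/
def monomialSection (u : EuclideanSpace ℝ (Fin n) → ℝ) (k : ℕ) (α : EuclideanSpace ℝ (Fin n))
    (p : EuclideanSpace ℝ (Fin n) × (Fin n → ℝ)) : ℂ :=
  Complex.exp ((k : ℂ) * ∑ j, (α j : ℂ) * ((pd j u p.1 : ℂ) + Complex.I * (p.2 j : ℂ)))

/-- The squared pointwise length of a section of `L^k` over `X°` (given in the above frame) with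
respect to the Hermitian metric. -/
def normSqSection (u : EuclideanSpace ℝ (Fin n) → ℝ) (k : ℕ)
    (t : EuclideanSpace ℝ (Fin n) × (Fin n → ℝ) → ℂ)
    (p : EuclideanSpace ℝ (Fin n) × (Fin n → ℝ)) : ℝ :=
  ‖t p‖ ^ 2 * Real.exp (-(2 * (k : ℝ) * legendre u p.1))

/-- `Int(P) × (0, 2π]ⁿ`, a fundamental domain for `X° = Int(P) × Tⁿ`. It carries the Liouville
measure `ωⁿ/n! = dx dθ`, and its complement in `X` is a null set. -/
def openOrbit (D : DelzantPolytope n) : Set (EuclideanSpace ℝ (Fin n) × (Fin n → ℝ)) :=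
  interior D.carrier ×ˢ Set.pi univ (fun _ => Ioc 0 (2 * Real.pi))

/-- The section `e_{α,k}` of `L^k`: the equivariant section of weight `α`, divided by its
`L²`-norm. -/
def unitSection (D : DelzantPolytope n) (u : EuclideanSpace ℝ (Fin n) → ℝ) (k : ℕ)
    (α : EuclideanSpace ℝ (Fin n)) (p : EuclideanSpace ℝ (Fin n) × (Fin n → ℝ)) : ℂ :=
  monomialSection u k α p /
    (Real.sqrt (∫ q in openOrbit D, normSqSection u k (monomialSection u k α) q) : ℂ)

/-- The mass density `|e_{α,k}|²`. -/
def massDensity (D : DelzantPolytope n) (u : EuclideanSpace ℝ (Fin n) → ℝ) (k : ℕ)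
    (α : EuclideanSpace ℝ (Fin n)) (p : EuclideanSpace ℝ (Fin n) × (Fin n → ℝ)) : ℝ :=
  normSqSection u k (unitSection D u k α) p

/-- The pairing `⟨|e_{α,k}|², f⟩ = ∫_X |e_{α,k}|² f ωⁿ/n!` with a `Tⁿ`-invariant function,
regarded as a function `f` on `P`. -/
def pairing (D : DelzantPolytope n) (u : EuclideanSpace ℝ (Fin n) → ℝ) (k : ℕ)
    (α : EuclideanSpace ℝ (Fin n)) (f : EuclideanSpace ℝ (Fin n) → ℝ) : ℝ :=
  ∫ p in openOrbit D, massDensity D u k α p * f p.1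

/-! ### Test functions -/

/-- `C^∞(P)`: functions smooth up to the boundary of `P`, i.e. the smooth `Tⁿ`-invariant functions
on `X`. (Values outside `P` are irrelevant.) -/
def smoothFunctions (D : DelzantPolytope n) : Submodule ℝ (EuclideanSpace ℝ (Fin n) → ℝ) where
  carrier := {f | ContDiffOn ℝ ∞ f D.carrier}
  add_mem' := fun hf hg => ContDiffOn.add hf hg
  zero_mem' := contDiffOn_const (c := (0 : ℝ))
  smul_mem' := fun c _ hf => ContDiffOn.smul (f := fun _ => c) contDiffOn_const hf

/-- The `C^r` norm on `P`. -/
def cNorm (D : DelzantPolytope n) (r : ℕ) (f : EuclideanSpace ℝ (Fin n) → ℝ) : ℝ :=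
  ∑ m ∈ Finset.range (r + 1), ⨆ x : D.carrier, ‖iteratedFDerivWithin ℝ m f D.carrier x‖

end Toric

end

/-!
Integrating out the torus, the pairing with `|e_{α,k}|²` becomes the expectation `E[f]` of `f` under
the probability density on `P` proportional to `ρ = exp(2k(⟨α, du⟩ - ψ))` (`pairing_eq`). Two facts
about the symplectic potential govern this density.

* The inverse Hessian `G` is smooth up to the boundary (`contDiffOn_invHess`). Near a point of `P`,
  multiplication by a smooth matrix built from vectors dual to the conormals of the facets through
  the point removes the poles `½ ν_a ⊗ ν_a / ℓ_a` of `H`, and the product is invertible because `u`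
  has positive definite Hessian along the faces (`exists_local_inverse`). By Abreu's formula
  `s = -½ ∂_i ∂_j G^{ij}` (`scalarCurvature_eq`) the scalar curvature is smooth as well.
* Since `∂_j ρ = 2k H_{jl} (α_l - x_l) ρ`, one has `G^{ij} ∂_j ρ = 2k (α_i - x_i) ρ`. For `α` in the
  interior `ρ` vanishes at the boundary, so that integration by parts gives the exact identity
  `E[(x_i - α_i) g] = (2k)⁻¹ E[∂_j (G^{ij} g)]` for every smooth `g`, with no boundary term
  (`integral_weight_coord_sub_mul`, `pairing_coord_sub_mul`).

Iterating this identity, the moments of `x - α` of order one and two are `O(k⁻¹)` and those of order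
three and four are `O(k⁻²)`, uniformly in `α`; the first two moments are
`(2k)⁻¹ ∂_j G^{ij}(α) + O(k⁻²)` and `(2k)⁻¹ G^{ij}(α) + O(k⁻²)` (`unifO_momentOne_sub`,
`unifO_momentTwo_sub`). Taking the expectation of the third order Taylor polynomial of `f` at `α`,
with a remainder bounded by the fourth derivatives, yields the expansion with an error
`O(k⁻² ‖f‖_{C⁴})` (`abs_expansionError_le`), and Abreu's formula identifies the coefficient of
`(2k)⁻¹` (`subleading_eq`).

The dependence on `α` is through quotients of Laplace transforms, which converge in a neighbourhood
of `P` and are therefore smooth up to the boundary (`contDiffOn_pairing`). This gives the smoothness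
of the remainder, and extends the estimate from the interior to all of `P` by continuity
(`exists_bound_expansionError`).
-/

namespace Toric

variable {n : ℕ}

/-! ### Geometry of the polytope -/

/-- The linear part `⟨·, ν_a⟩` of the defining function `ℓ_a`. -/
noncomputable def DelzantPolytope.conormal (D : DelzantPolytope n) (a : Fin D.d) :
    EuclideanSpace ℝ (Fin n) →L[ℝ] ℝ :=
  ∑ i, (D.normal a i : ℝ) • EuclideanSpace.proj i

lemma conormal_apply (D : DelzantPolytope n) (a : Fin D.d) (w : EuclideanSpace ℝ (Fin n)) :
    D.conormal a w = ∑ i, w i * (D.normal a i : ℝ) := by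
  simp [DelzantPolytope.conormal, mul_comm]

lemma conormal_single (D : DelzantPolytope n) (a : Fin D.d) (i : Fin n) :
    D.conormal a (EuclideanSpace.single i 1) = (D.normal a i : ℝ) := by
  simp [conormal_apply, PiLp.single_apply]

lemma ell_eq (D : DelzantPolytope n) (a : Fin D.d) (x : EuclideanSpace ℝ (Fin n)) :
    D.ell a x = D.conormal a x - D.offset a := by
  rw [conormal_apply]; rfl

lemma ell_add (D : DelzantPolytope n) (a : Fin D.d) (x w : EuclideanSpace ℝ (Fin n)) :
    D.ell a (x + w) = D.ell a x + D.conormal a w := by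
  simp only [ell_eq, map_add]; ring

lemma ell_combo (D : DelzantPolytope n) (a : Fin D.d) (x y : EuclideanSpace ℝ (Fin n)) {s t : ℝ}
    (hst : s + t = 1) : D.ell a (s • x + t • y) = s * D.ell a x + t * D.ell a y := by
  simp only [ell_eq, map_add, map_smul, smul_eq_mul]
  linear_combination (D.offset a : ℝ) * hst

lemma hasFDerivAt_ell (D : DelzantPolytope n) (a : Fin D.d) (x : EuclideanSpace ℝ (Fin n)) :
    HasFDerivAt (D.ell a) (D.conormal a) x := by
  have : D.ell a = fun x => D.conormal a x - D.offset a := funext (ell_eq D a)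
  rw [this]
  exact (D.conormal a).hasFDerivAt.sub_const _

lemma contDiff_ell (D : DelzantPolytope n) (a : Fin D.d) {r : WithTop ℕ∞} :
    ContDiff ℝ r (D.ell a) := by
  have : D.ell a = fun x => D.conormal a x - D.offset a := funext (ell_eq D a)
  rw [this]
  exact (D.conormal a).contDiff.sub contDiff_const

lemma continuous_ell (D : DelzantPolytope n) (a : Fin D.d) : Continuous (D.ell a) :=
  (contDiff_ell D a (r := 0)).continuous

lemma isClosed_carrier (D : DelzantPolytope n) : IsClosed D.carrier := by
  have : D.carrier = ⋂ a, {x | 0 ≤ D.ell a x} := by ext; simp [DelzantPolytope.carrier]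
  rw [this]
  exact isClosed_iInter fun a => isClosed_le continuous_const (continuous_ell D a)

lemma isCompact_carrier (D : DelzantPolytope n) : IsCompact D.carrier :=
  Metric.isCompact_of_isClosed_isBounded (isClosed_carrier D) D.bounded

lemma convex_carrier (D : DelzantPolytope n) : Convex ℝ D.carrier := by
  intro x hx y hy s t hs ht hst a
  rw [ell_combo D a x y hst]
  exact add_nonneg (mul_nonneg hs (hx a)) (mul_nonneg ht (hy a))

lemma interior_nonempty (D : DelzantPolytope n) : (interior D.carrier).Nonempty := D.fullDim

lemma uniqueDiffOn_carrier (D : DelzantPolytope n) : UniqueDiffOn ℝ D.carrier :=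
  uniqueDiffOn_convex (convex_carrier D) (interior_nonempty D)

lemma closure_interior_carrier (D : DelzantPolytope n) :
    closure (interior D.carrier) = D.carrier := by
  rw [(convex_carrier D).closure_interior_eq_closure_of_nonempty_interior (interior_nonempty D),
    (isClosed_carrier D).closure_eq]

/-- At every point `x` of a Delzant polytope the conormals of the facets through `x` admit dual
vectors.  The face whose relative interior contains `x` has a vertex, and the Delzant condition at
that vertex provides the dual basis. -/
lemma exists_dual (D : DelzantPolytope n) {x : EuclideanSpace ℝ (Fin n)} (hx : x ∈ D.carrier) :
    ∃ e : Fin D.d → EuclideanSpace ℝ (Fin n), ∀ a b, D.ell a x = 0 → D.ell b x = 0 →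
      D.conormal a (e b) = if a = b then 1 else 0 := by
  classical
  set F : Set (EuclideanSpace ℝ (Fin n)) :=
    {y | y ∈ D.carrier ∧ ∀ a, D.ell a x = 0 → D.ell a y = 0} with hF
  have hFc : IsClosed F := by
    have : F = D.carrier ∩ ⋂ a, ⋂ (_ : D.ell a x = 0), {y | D.ell a y = 0} := by
      ext; simp [hF]
    rw [this]
    exact (isClosed_carrier D).inter (isClosed_iInter fun a => isClosed_iInter fun _ =>
      isClosed_eq (continuous_ell D a) continuous_const)
  have hFk : IsCompact F := (isCompact_carrier D).of_isClosed_subset hFc fun y hy => hy.1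
  obtain ⟨v, hv⟩ := hFk.extremePoints_nonempty ⟨x, hx, fun a ha => ha⟩
  have hvP : v ∈ D.carrier.extremePoints ℝ := by
    rw [mem_extremePoints] at hv ⊢
    obtain ⟨⟨hvD, hvF⟩, hext⟩ := hv
    refine ⟨hvD, fun y hy z hz hyz => ?_⟩
    have key : ∀ a, D.ell a x = 0 → D.ell a y = 0 ∧ D.ell a z = 0 := by
      intro a ha
      obtain ⟨s, t, hs, ht, hst, rfl⟩ := hyz
      have h0 := hvF a ha
      rw [ell_combo D a y z hst] at h0
      have h1 := mul_nonneg hs.le (hy a)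
      have h2 := mul_nonneg ht.le (hz a)
      constructor
      · exact (mul_eq_zero.1 (le_antisymm (by linarith) h1)).resolve_left hs.ne'
      · exact (mul_eq_zero.1 (le_antisymm (by linarith) h2)).resolve_left ht.ne'
    exact hext y ⟨hy, fun a ha => (key a ha).1⟩ z ⟨hz, fun a ha => (key a ha).2⟩ hyz
  have hvF : ∀ a, D.ell a x = 0 → D.ell a v = 0 := (extremePoints_subset hv).2
  obtain ⟨e, σ, h⟩ : ∃ (e : Module.Basis (Fin n) ℤ (Fin n → ℤ))
      (σ : Fin n ≃ {a : Fin D.d // D.ell a v = 0}),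
      ∀ i j, ∑ m, D.normal (σ i).1 m * e j m = if i = j then 1 else 0 := D.delzant v hvP
  refine ⟨fun b => if hb : D.ell b v = 0 then
    WithLp.toLp 2 (fun m => (e (σ.symm ⟨b, hb⟩) m : ℝ)) else 0, fun a b ha hb => ?_⟩
  have ha' := hvF a ha
  have hb' := hvF b hb
  simp only [dif_pos hb']
  rw [conormal_apply]
  have := h (σ.symm ⟨a, ha'⟩) (σ.symm ⟨b, hb'⟩)
  rw [Equiv.apply_symm_apply] at this
  have h2 : ∑ m, ((e (σ.symm ⟨b, hb'⟩) m : ℝ)) * (D.normal a m : ℝ) =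
      ((∑ m, D.normal a m * e (σ.symm ⟨b, hb'⟩) m : ℤ) : ℝ) := by
    push_cast
    exact Finset.sum_congr rfl fun m _ => mul_comm _ _
  simp only
  rw [h2, this]
  simp

lemma conormal_ne_zero (D : DelzantPolytope n) (a : Fin D.d) : D.conormal a ≠ 0 := by
  obtain ⟨x, hx, hxa⟩ := D.facet a
  obtain ⟨e, he⟩ := exists_dual D hx
  intro h
  have := he a a hxa hxa
  simp [h] at this

lemma mem_interior_carrier (D : DelzantPolytope n) {x : EuclideanSpace ℝ (Fin n)} :
    x ∈ interior D.carrier ↔ ∀ a, 0 < D.ell a x := by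
  constructor
  · intro hx a
    have hxP := interior_subset hx
    refine lt_of_le_of_ne (hxP a) fun h0 => ?_
    obtain ⟨e, he⟩ := exists_dual D hxP
    have hc : Filter.Tendsto (fun t : ℝ => x + (-t) • e a) (𝓝[>] 0) (𝓝 x) := by
      have : ContinuousAt (fun t : ℝ => x + (-t) • e a) 0 := by fun_prop
      have h := this.tendsto
      simp only [neg_zero, zero_smul, add_zero] at h
      exact h.mono_left nhdsWithin_le_nhds
    obtain ⟨t, ht1, ht2⟩ := ((hc.eventually (mem_interior_iff_mem_nhds.1 hx)).and
      self_mem_nhdsWithin).exists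
    have h1 : 0 ≤ D.ell a (x + (-t) • e a) := ht1 a
    rw [ell_add, map_smul, he a a h0.symm h0.symm, ← h0] at h1
    simp at h1
    exact absurd ht2 (not_lt.2 h1)
  · intro h
    have ho : IsOpen {x | ∀ a, 0 < D.ell a x} := by
      have : {x | ∀ a, 0 < D.ell a x} = ⋂ a, {x | 0 < D.ell a x} := by ext; simp
      rw [this]
      exact isOpen_iInter_of_finite fun a => isOpen_lt continuous_const (continuous_ell D a)
    exact mem_interior.2 ⟨_, fun y hy a => (hy a).le, ho, h⟩

/-! ### One-sided partial derivatives on the polytope -/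

lemma fderivWithin_apply_eq_sum (P : Set (EuclideanSpace ℝ (Fin n)))
    (f : EuclideanSpace ℝ (Fin n) → ℝ) (x w : EuclideanSpace ℝ (Fin n)) :
    fderivWithin ℝ f P x w = ∑ i, w i * pdWithin P i f x := by
  have hw : w = ∑ i, w i • EuclideanSpace.single i (1 : ℝ) := by
    ext j
    simp [Pi.single_apply]
  conv_lhs => rw [hw]
  simp [pdWithin, map_sum]

lemma pdWithin_eq_pd {P : Set (EuclideanSpace ℝ (Fin n))} {x : EuclideanSpace ℝ (Fin n)}
    (hx : x ∈ interior P) (i : Fin n) (f : EuclideanSpace ℝ (Fin n) → ℝ) :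
    pdWithin P i f x = pd i f x := by
  rw [pdWithin, fderivWithin_of_mem_nhds (mem_interior_iff_mem_nhds.1 hx), pd]

lemma pd_congr {ι : Type} [Fintype ι] [DecidableEq ι] {f g : EuclideanSpace ℝ ι → ℝ}
    {x : EuclideanSpace ℝ ι} (h : f =ᶠ[𝓝 x] g) (i : ι) : pd i f x = pd i g x := by
  rw [pd, pd, h.fderiv_eq]

lemma pdWithin_congr {P : Set (EuclideanSpace ℝ (Fin n))} {f g : EuclideanSpace ℝ (Fin n) → ℝ}
    (h : EqOn f g P) {x : EuclideanSpace ℝ (Fin n)} (hx : x ∈ P) (i : Fin n) :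
    pdWithin P i f x = pdWithin P i g x := by
  rw [pdWithin, pdWithin, fderivWithin_congr h (h hx)]

lemma contDiffOn_pdWithin (D : DelzantPolytope n) {f : EuclideanSpace ℝ (Fin n) → ℝ}
    (hf : ContDiffOn ℝ ∞ f D.carrier) (i : Fin n) :
    ContDiffOn ℝ ∞ (pdWithin D.carrier i f) D.carrier :=
  (hf.fderivWithin (uniqueDiffOn_carrier D) (m := ∞) (by simp)).clm_apply contDiffOn_const

lemma differentiableWithinAt_of_contDiffOn {P : Set (EuclideanSpace ℝ (Fin n))}
    {f : EuclideanSpace ℝ (Fin n) → ℝ}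
    (hf : ContDiffOn ℝ ∞ f P) {x : EuclideanSpace ℝ (Fin n)} (hx : x ∈ P) :
    DifferentiableWithinAt ℝ f P x := hf.differentiableOn (by simp) x hx

lemma contDiffOn_pd {ι : Type} [Fintype ι] [DecidableEq ι] {O : Set (EuclideanSpace ℝ ι)}
    (hO : IsOpen O) {f : EuclideanSpace ℝ ι → ℝ}
    (hf : ContDiffOn ℝ ∞ f O) (i : ι) : ContDiffOn ℝ ∞ (pd i f) O :=
  (hf.fderiv_of_isOpen hO (m := ∞) (by simp)).clm_apply contDiffOn_const

lemma pdWithin_add (D : DelzantPolytope n) {f g : EuclideanSpace ℝ (Fin n) → ℝ}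
    (hf : ContDiffOn ℝ ∞ f D.carrier) (hg : ContDiffOn ℝ ∞ g D.carrier)
    {x : EuclideanSpace ℝ (Fin n)} (hx : x ∈ D.carrier) (i : Fin n) :
    pdWithin D.carrier i (fun y => f y + g y) x =
    pdWithin D.carrier i f x + pdWithin D.carrier i g x := by
  rw [pdWithin, fderivWithin_fun_add (uniqueDiffOn_carrier D x hx)
    (differentiableWithinAt_of_contDiffOn hf hx)
    (differentiableWithinAt_of_contDiffOn hg hx)]
  rfl

lemma pdWithin_mul (D : DelzantPolytope n) {f g : EuclideanSpace ℝ (Fin n) → ℝ}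
    (hf : ContDiffOn ℝ ∞ f D.carrier) (hg : ContDiffOn ℝ ∞ g D.carrier)
    {x : EuclideanSpace ℝ (Fin n)} (hx : x ∈ D.carrier) (i : Fin n) :
    pdWithin D.carrier i (fun y => f y * g y) x =
    f x * pdWithin D.carrier i g x + pdWithin D.carrier i f x * g x := by
  rw [pdWithin, fderivWithin_fun_mul (uniqueDiffOn_carrier D x hx)
    (differentiableWithinAt_of_contDiffOn hf hx)
    (differentiableWithinAt_of_contDiffOn hg hx)]
  simp [pdWithin]
  ring

lemma pdWithin_const_mul (D : DelzantPolytope n) {f : EuclideanSpace ℝ (Fin n) → ℝ} (c : ℝ)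
    (hf : ContDiffOn ℝ ∞ f D.carrier)
    {x : EuclideanSpace ℝ (Fin n)} (hx : x ∈ D.carrier) (i : Fin n) :
    pdWithin D.carrier i (fun y => c * f y) x = c * pdWithin D.carrier i f x := by
  rw [pdWithin, fderivWithin_const_mul (uniqueDiffOn_carrier D x hx)
    (differentiableWithinAt_of_contDiffOn hf hx)]
  rfl

lemma exists_bound_of_contDiffOn (D : DelzantPolytope n) {f : EuclideanSpace ℝ (Fin n) → ℝ}
    (hf : ContDiffOn ℝ ∞ f D.carrier) : ∃ C, 0 ≤ C ∧ ∀ x ∈ D.carrier, |f x| ≤ C := by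
  obtain ⟨C, hC⟩ := (isCompact_carrier D).exists_bound_of_continuousOn hf.continuousOn
  exact ⟨max C 0, le_max_right _ _, fun x hx => (hC x hx).trans (le_max_left _ _)⟩

/-! ### Derivatives of the symplectic potential -/

/-- The difference `v = u - u₀` of a symplectic potential and the Guillemin potential, which is
smooth up to the boundary. -/
noncomputable def smoothPart (D : DelzantPolytope n) (u : EuclideanSpace ℝ (Fin n) → ℝ) :
    EuclideanSpace ℝ (Fin n) → ℝ :=
  fun x => u x - guillemin D x

lemma contDiffOn_smoothPart {D : DelzantPolytope n} {u : EuclideanSpace ℝ (Fin n) → ℝ}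
    (hu : IsSymplecticPotential D u) : ContDiffOn ℝ ∞ (smoothPart D u) D.carrier := hu.smooth_sub

lemma pdWithin_pdWithin_eq_pd {P : Set (EuclideanSpace ℝ (Fin n))}
    {x : EuclideanSpace ℝ (Fin n)} (hx : x ∈ interior P) (i j : Fin n)
    (f : EuclideanSpace ℝ (Fin n) → ℝ) :
    pdWithin P i (pdWithin P j f) x = pd i (pd j f) x := by
  rw [pdWithin_eq_pd hx]
  refine pd_congr ?_ i
  filter_upwards [isOpen_interior.mem_nhds hx] with y hy
  exact pdWithin_eq_pd hy j f

lemma hasDerivWithinAt_comp_line (D : DelzantPolytope n) {f : EuclideanSpace ℝ (Fin n) → ℝ}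
    (hf : ContDiffOn ℝ ∞ f D.carrier) {x w : EuclideanSpace ℝ (Fin n)} {s : Set ℝ}
    (hs : ∀ t ∈ s, x + t • w ∈ D.carrier) {t : ℝ} (ht : t ∈ s) :
    HasDerivWithinAt (fun t => f (x + t • w))
      (∑ i, w i * pdWithin D.carrier i f (x + t • w)) s t := by
  have h1 : HasDerivWithinAt (fun t : ℝ => x + t • w) w s t := by
    simpa using ((hasDerivAt_id t).smul_const w).const_add x |>.hasDerivWithinAt
  have h2 := (differentiableWithinAt_of_contDiffOn hf (hs t ht)).hasFDerivWithinAt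
  rw [← fderivWithin_apply_eq_sum]
  exact h2.comp_hasDerivWithinAt t h1 hs

lemma hasDerivAt_comp_line (D : DelzantPolytope n) {f : EuclideanSpace ℝ (Fin n) → ℝ}
    (hf : ContDiffOn ℝ ∞ f D.carrier) {x w : EuclideanSpace ℝ (Fin n)} {t : ℝ}
    (h : ∀ᶠ s in 𝓝 t, x + s • w ∈ D.carrier) :
    HasDerivAt (fun t => f (x + t • w))
      (∑ i, w i * pdWithin D.carrier i f (x + t • w)) t :=
  (hasDerivWithinAt_comp_line D hf (s := {s | x + s • w ∈ D.carrier}) (fun _ h => h)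
    h.self_of_nhds).hasDerivAt h

lemma hasFDerivAt_mul_log_ell (D : DelzantPolytope n) (a : Fin D.d)
    {x : EuclideanSpace ℝ (Fin n)} (hx : D.ell a x ≠ 0) :
    HasFDerivAt (fun y => D.ell a y * Real.log (D.ell a y))
      ((Real.log (D.ell a x) + 1) • D.conormal a) x := by
  have h := (Real.hasDerivAt_mul_log hx).comp_hasFDerivAt x (hasFDerivAt_ell D a x)
  exact h

lemma pd_eq_of_hasFDerivAt {ι : Type} [Fintype ι] [DecidableEq ι] {f : EuclideanSpace ℝ ι → ℝ}
    {f' : EuclideanSpace ℝ ι →L[ℝ] ℝ} {x : EuclideanSpace ℝ ι} (h : HasFDerivAt f f' x) (i : ι) :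
    pd i f x = f' (EuclideanSpace.single i 1) := by
  rw [pd, h.fderiv]

lemma pd_potential {D : DelzantPolytope n} {u : EuclideanSpace ℝ (Fin n) → ℝ}
    (hu : IsSymplecticPotential D u) {x : EuclideanSpace ℝ (Fin n)} (hx : x ∈ interior D.carrier)
    (j : Fin n) :
    pd j u x = (1 / 2) * ∑ a, (D.normal a j : ℝ) * (Real.log (D.ell a x) + 1) +
      pdWithin D.carrier j (smoothPart D u) x := by
  have hpos := (mem_interior_carrier D).1 hx
  have hv : HasFDerivAt (smoothPart D u) (fderiv ℝ (smoothPart D u) x) x :=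
    ((contDiffOn_smoothPart hu).contDiffAt
      (mem_interior_iff_mem_nhds.1 hx)).differentiableAt (by simp) |>.hasFDerivAt
  have hg : HasFDerivAt (guillemin D)
      ((1 / 2 : ℝ) • ∑ a, (Real.log (D.ell a x) + 1) • D.conormal a) x := by
    refine HasFDerivAt.const_mul ?_ (1 / 2 : ℝ)
    exact HasFDerivAt.fun_sum fun a _ => hasFDerivAt_mul_log_ell D a (hpos a).ne'
  have h := hg.add hv
  have e : (guillemin D + smoothPart D u) = u := by
    ext y; simp [smoothPart]
  rw [e] at h
  rw [pd_eq_of_hasFDerivAt h, pdWithin_eq_pd hx, pd]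
  simp [conormal_single, mul_comm]

lemma hess_potential {D : DelzantPolytope n} {u : EuclideanSpace ℝ (Fin n) → ℝ}
    (hu : IsSymplecticPotential D u) {x : EuclideanSpace ℝ (Fin n)} (hx : x ∈ interior D.carrier)
    (i j : Fin n) :
    hess u x i j =
      (1 / 2) * ∑ a, (D.normal a i : ℝ) * (D.normal a j : ℝ) * (D.ell a x)⁻¹ +
      pdWithin D.carrier i (pdWithin D.carrier j (smoothPart D u)) x := by
  have hpos := (mem_interior_carrier D).1 hx
  have hv : HasFDerivAt (pdWithin D.carrier j (smoothPart D u))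
      (fderiv ℝ (pdWithin D.carrier j (smoothPart D u)) x) x :=
    ((contDiffOn_pdWithin D (contDiffOn_smoothPart hu) j).contDiffAt
      (mem_interior_iff_mem_nhds.1 hx)).differentiableAt (by simp) |>.hasFDerivAt
  have hl : ∀ a, HasFDerivAt (fun y => (D.normal a j : ℝ) * (Real.log (D.ell a y) + 1))
      ((D.normal a j : ℝ) • (D.ell a x)⁻¹ • D.conormal a) x := fun a =>
    (((hasFDerivAt_ell D a x).log (hpos a).ne').add_const 1).const_mul _
  have hg := (HasFDerivAt.fun_sum (u := Finset.univ) fun a _ => hl a).const_mul (1 / 2 : ℝ)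
  have h := hg.add hv
  have hE : pd j u =ᶠ[𝓝 x] (fun y => (1 / 2 : ℝ) * ∑ a, (D.normal a j : ℝ) *
      (Real.log (D.ell a y) + 1)) + pdWithin D.carrier j (smoothPart D u) := by
    filter_upwards [isOpen_interior.mem_nhds hx] with y hy
    exact pd_potential hu hy j
  rw [hess, Matrix.of_apply, pd_congr hE, pd_eq_of_hasFDerivAt h, pdWithin_eq_pd hx, pd]
  simp [conormal_single]
  ring_nf
  congr 1
  exact funext fun a => by ring

lemma contDiffOn_potential {D : DelzantPolytope n} {u : EuclideanSpace ℝ (Fin n) → ℝ}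
    (hu : IsSymplecticPotential D u) (i j : Fin n) :
    ContDiffOn ℝ ∞ (fun x => hess u x i j) (interior D.carrier) :=
  contDiffOn_pd isOpen_interior (contDiffOn_pd isOpen_interior hu.smooth_interior j) i

lemma pd_comm {ι : Type} [Fintype ι] [DecidableEq ι] {f : EuclideanSpace ℝ ι → ℝ}
    {x : EuclideanSpace ℝ ι} (hf : ContDiffAt ℝ ∞ f x) (i j : ι) :
    pd i (pd j f) x = pd j (pd i f) x := by
  have hd : DifferentiableAt ℝ (fderiv ℝ f) x :=
    (hf.fderiv_right (m := 1) (by norm_cast)).differentiableAt (by simp)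
  have key : ∀ i j, pd i (pd j f) x =
      fderiv ℝ (fderiv ℝ f) x (EuclideanSpace.single i 1) (EuclideanSpace.single j 1) := by
    intro i j
    have h := hd.hasFDerivAt.clm_apply (hasFDerivAt_const (EuclideanSpace.single j (1 : ℝ)) x)
    exact (pd_eq_of_hasFDerivAt h i).trans (by simp)
  rw [key, key]
  exact (hf.isSymmSndFDerivAt (by simp; norm_cast)).eq _ _

lemma hess_symm {D : DelzantPolytope n} {u : EuclideanSpace ℝ (Fin n) → ℝ}
    (hu : IsSymplecticPotential D u) {x : EuclideanSpace ℝ (Fin n)} (hx : x ∈ interior D.carrier)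
    (i j : Fin n) : hess u x i j = hess u x j i :=
  pd_comm (hu.smooth_interior.contDiffAt (isOpen_interior.mem_nhds hx)) i j

/-- The part of the Hessian of the potential that stays regular where only the facets in `A` are
approached. -/
noncomputable def regularHess (D : DelzantPolytope n) (u : EuclideanSpace ℝ (Fin n) → ℝ)
    (A : Finset (Fin D.d)) (x : EuclideanSpace ℝ (Fin n)) : Matrix (Fin n) (Fin n) ℝ :=
  Matrix.of fun i j =>
    (1 / 2) * ∑ a ∈ Aᶜ, (D.normal a i : ℝ) * (D.normal a j : ℝ) * (D.ell a x)⁻¹ +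
      pdWithin D.carrier i (pdWithin D.carrier j (smoothPart D u)) x

/-- The restriction of the potential to a face has Hessian given by the regular part. -/
lemma iteratedDeriv_potential_face {D : DelzantPolytope n} {u : EuclideanSpace ℝ (Fin n) → ℝ}
    (hu : IsSymplecticPotential D u) {x : EuclideanSpace ℝ (Fin n)} (hx : x ∈ D.carrier)
    {A : Finset (Fin D.d)} (hA : ∀ a, a ∈ A ↔ D.ell a x = 0) {w : EuclideanSpace ℝ (Fin n)}
    (hw : ∀ a, D.ell a x = 0 → D.conormal a w = 0) :
    iteratedDeriv 2 (fun t : ℝ => u (x + t • w)) 0 =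
      ∑ i, ∑ j, w i * w j * regularHess D u A x i j := by
  have hline : ∀ a (t : ℝ), D.ell a (x + t • w) = D.ell a x + t * D.conormal a w := by
    intro a t; rw [ell_add, map_smul, smul_eq_mul]
  have hcont : ∀ a, Continuous fun t : ℝ => D.ell a (x + t • w) := fun a =>
    (continuous_ell D a).comp (by fun_prop)
  have hposA : ∀ a ∈ Aᶜ, 0 < D.ell a x := fun a ha =>
    lt_of_le_of_ne (hx a) fun h => (Finset.mem_compl.1 ha) ((hA a).2 h.symm)
  have hev : ∀ᶠ t : ℝ in 𝓝 0, ∀ a ∈ Aᶜ, 0 < D.ell a (x + t • w) := by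
    rw [Finset.eventually_all]
    intro a ha
    have : 0 < D.ell a (x + (0 : ℝ) • w) := by simpa using hposA a ha
    exact (hcont a).continuousAt.eventually (lt_mem_nhds this)
  have hz : ∀ a ∈ A, ∀ t : ℝ, D.ell a (x + t • w) = 0 := fun a ha t => by
    rw [hline, (hA a).1 ha, hw a ((hA a).1 ha)]; simp
  have hP : ∀ t : ℝ, (∀ a ∈ Aᶜ, 0 < D.ell a (x + t • w)) → x + t • w ∈ D.carrier := by
    intro t ht a
    by_cases ha : a ∈ A
    · exact (hz a ha t).ge
    · exact (ht a (Finset.mem_compl.2 ha)).le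
  have hell : ∀ a (t : ℝ), HasDerivAt (fun t : ℝ => D.ell a (x + t • w)) (D.conormal a w) t := by
    intro a t
    simp only [hline]
    simpa using ((hasDerivAt_id t).mul_const (D.conormal a w)).const_add (D.ell a x)
  have hu_eq : ∀ t : ℝ, u (x + t • w) = (1 / 2) * ∑ a ∈ Aᶜ, D.ell a (x + t • w) *
      Real.log (D.ell a (x + t • w)) + smoothPart D u (x + t • w) := by
    intro t
    have : guillemin D (x + t • w) = (1 / 2) * ∑ a ∈ Aᶜ, D.ell a (x + t • w) *
      Real.log (D.ell a (x + t • w)) := by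
      rw [guillemin, ← Finset.sum_add_sum_compl A, Finset.sum_eq_zero, zero_add]
      intro a ha; rw [hz a ha]; simp
    rw [← this, smoothPart]; ring
  have h1 : ∀ᶠ t : ℝ in 𝓝 0, deriv (fun t : ℝ => u (x + t • w)) t =
      (1 / 2) * ∑ a ∈ Aᶜ, (Real.log (D.ell a (x + t • w)) + 1) * D.conormal a w +
      ∑ i, w i * pdWithin D.carrier i (smoothPart D u) (x + t • w) := by
    filter_upwards [hev.eventually_nhds] with t ht
    simp only [hu_eq]
    refine HasDerivAt.deriv (HasDerivAt.add (HasDerivAt.const_mul _ ?_) ?_)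
    · refine HasDerivAt.fun_sum fun a ha => ?_
      exact (Real.hasDerivAt_mul_log (ht.self_of_nhds a ha).ne').comp t (hell a t)
    · exact hasDerivAt_comp_line D (contDiffOn_smoothPart hu) (ht.mono hP)
  rw [iteratedDeriv_succ, iteratedDeriv_one, Filter.EventuallyEq.deriv_eq h1]
  have h2 : HasDerivAt (fun t : ℝ => (1 / 2) * ∑ a ∈ Aᶜ,
        (Real.log (D.ell a (x + t • w)) + 1) * D.conormal a w +
      ∑ i, w i * pdWithin D.carrier i (smoothPart D u) (x + t • w))
      ((1 / 2) * ∑ a ∈ Aᶜ, (D.conormal a w / D.ell a (x + (0 : ℝ) • w)) * D.conormal a w +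
      ∑ i, w i * ∑ j, w j * pdWithin D.carrier j (pdWithin D.carrier i (smoothPart D u))
        (x + (0 : ℝ) • w)) 0 := by
    refine HasDerivAt.add (HasDerivAt.const_mul _ ?_) ?_
    · refine HasDerivAt.fun_sum fun a ha => ?_
      exact ((((hell a 0).log (hev.self_of_nhds a ha).ne').add_const 1).mul_const _)
    · refine HasDerivAt.fun_sum fun i _ => HasDerivAt.const_mul _ ?_
      exact hasDerivAt_comp_line D (contDiffOn_pdWithin D (contDiffOn_smoothPart hu) i)
        (hev.mono hP)
  rw [h2.deriv]
  simp only [zero_smul, add_zero, regularHess, Matrix.of_apply, mul_add, Finset.sum_add_distrib]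
  congr 1
  · have : ∀ a, D.conormal a w / D.ell a x * D.conormal a w =
        ∑ i, ∑ j, w i * w j * ((D.normal a i : ℝ) * (D.normal a j : ℝ) * (D.ell a x)⁻¹) := by
      intro a
      rw [div_mul_eq_mul_div, div_eq_mul_inv, conormal_apply, Finset.sum_mul_sum, Finset.sum_mul]
      refine Finset.sum_congr rfl fun i _ => ?_
      rw [Finset.sum_mul]
      exact Finset.sum_congr rfl fun j _ => by ring
    simp only [this]
    rw [Finset.sum_comm, Finset.mul_sum]
    refine Finset.sum_congr rfl fun i _ => ?_
    rw [Finset.sum_comm, Finset.mul_sum]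
    refine Finset.sum_congr rfl fun j _ => ?_
    rw [← Finset.mul_sum]; ring
  · rw [Finset.sum_comm]
    simp only [Finset.mul_sum]
    exact Finset.sum_congr rfl fun i _ => Finset.sum_congr rfl fun j _ => by ring

/-! ### The inverse Hessian up to the boundary -/

lemma contDiffOn_matrix_det {E : Type*} [NormedAddCommGroup E] [NormedSpace ℝ E] {s : Set E}
    {M : E → Matrix (Fin n) (Fin n) ℝ} (h : ∀ i j, ContDiffOn ℝ ∞ (fun x => M x i j) s) :
    ContDiffOn ℝ ∞ (fun x => (M x).det) s := by
  simp only [Matrix.det_apply']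
  exact ContDiffOn.sum fun σ _ => contDiffOn_const.mul (contDiffOn_prod fun i _ => h _ _)

lemma contDiffOn_matrix_inv {E : Type*} [NormedAddCommGroup E] [NormedSpace ℝ E] {s : Set E}
    {M : E → Matrix (Fin n) (Fin n) ℝ} (h : ∀ i j, ContDiffOn ℝ ∞ (fun x => M x i j) s)
    (hdet : ∀ x ∈ s, (M x).det ≠ 0) (i j : Fin n) :
    ContDiffOn ℝ ∞ (fun x => (M x)⁻¹ i j) s := by
  simp only [Matrix.inv_def, Ring.inverse_eq_inv', Matrix.smul_apply, smul_eq_mul,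
    Matrix.adjugate_apply]
  refine ((contDiffOn_matrix_det h).inv hdet).mul (contDiffOn_matrix_det fun k l => ?_)
  by_cases hk : k = j
  · subst hk
    simp only [Matrix.updateRow_self]
    exact contDiffOn_const
  · simp only [Matrix.updateRow_ne hk]
    exact h k l

open Matrix in
/-- Near a point `x₀` of the polytope the inverse of the Hessian `H` extends smoothly to the
boundary.  If `A` is the set of facets through `x₀` and `e_a` are vectors dual to the `ν_a`, for
`a ∈ A`, then `T = 1 + ∑_A (2 ℓ_a - 1) ν_a ⊗ e_a` clears the poles of `H`, the product `T H` is
smooth, and it is invertible at `x₀` because the Hessian of `u` along the face is positive. -/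
lemma exists_local_inverse {D : DelzantPolytope n} {u : EuclideanSpace ℝ (Fin n) → ℝ}
    (hu : IsSymplecticPotential D u) {x₀ : EuclideanSpace ℝ (Fin n)} (hx₀ : x₀ ∈ D.carrier) :
    ∃ (W : Set (EuclideanSpace ℝ (Fin n)))
      (F : EuclideanSpace ℝ (Fin n) → Matrix (Fin n) (Fin n) ℝ),
      IsOpen W ∧ x₀ ∈ W ∧ (∀ i j, ContDiffOn ℝ ∞ (fun x => F x i j) (D.carrier ∩ W)) ∧
      ∀ x ∈ interior D.carrier ∩ W, F x * hess u x = 1 := by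
  classical
  obtain ⟨e, he⟩ := exists_dual D hx₀
  set A : Finset (Fin D.d) := Finset.univ.filter fun a => D.ell a x₀ = 0 with hAdef
  have hA : ∀ a, a ∈ A ↔ D.ell a x₀ = 0 := by intro a; simp [hAdef]
  let N : Fin D.d → Fin n → ℝ := fun a i => (D.normal a i : ℝ)
  have hNe : ∀ a ∈ A, ∀ b ∈ A, (e a : Fin n → ℝ) ⬝ᵥ N b = if b = a then 1 else 0 := by
    intro a ha b hb
    rw [← he b a ((hA b).1 hb) ((hA a).1 ha), conormal_apply]; rfl
  let T : EuclideanSpace ℝ (Fin n) → Matrix (Fin n) (Fin n) ℝ := fun x =>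
    1 + ∑ a ∈ A, (2 * D.ell a x - 1) • vecMulVec (N a) (e a)
  let S := regularHess D u A
  let M : EuclideanSpace ℝ (Fin n) → Matrix (Fin n) (Fin n) ℝ := fun x =>
    ∑ a ∈ A, vecMulVec (N a) (N a) + T x * S x
  have hTv : ∀ x (z : Fin n → ℝ), T x *ᵥ z =
      z + ∑ a ∈ A, ((2 * D.ell a x - 1) * ((e a : Fin n → ℝ) ⬝ᵥ z)) • N a := by
    intro x z
    simp only [T, add_mulVec, one_mulVec, sum_mulVec, smul_mulVec, vecMulVec_mulVec,
      op_smul_eq_smul]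
    congr 1
    refine Finset.sum_congr rfl fun a _ => ?_
    rw [mul_smul]
  have hTN : ∀ x, ∀ b ∈ A, T x *ᵥ N b = (2 * D.ell b x) • N b := by
    intro x b hb
    rw [hTv, Finset.sum_eq_single_of_mem b hb]
    · rw [hNe b hb b hb, if_pos rfl]
      module
    · intro a ha hab
      rw [hNe a ha b hb, if_neg (Ne.symm hab)]
      simp
  -- smoothness
  set W₀ : Set (EuclideanSpace ℝ (Fin n)) := {x | ∀ a ∈ Aᶜ, 0 < D.ell a x} with hW₀
  have hW₀o : IsOpen W₀ := by
    have : W₀ = ⋂ a ∈ Aᶜ, {x | 0 < D.ell a x} := by ext; simp [hW₀]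
    rw [this]
    exact isOpen_biInter_finset fun a _ => isOpen_lt continuous_const (continuous_ell D a)
  have hx₀W : x₀ ∈ W₀ := fun a ha =>
    lt_of_le_of_ne (hx₀ a) fun h => (Finset.mem_compl.1 ha) ((hA a).2 h.symm)
  have hSs : ∀ i j, ContDiffOn ℝ ∞ (fun x => S x i j) (D.carrier ∩ W₀) := by
    intro i j
    simp only [S, regularHess, of_apply]
    refine ContDiffOn.add (contDiffOn_const.mul (ContDiffOn.sum fun a ha => ?_)) ?_
    · exact contDiffOn_const.mul ((contDiff_ell D a).contDiffOn.inv fun x hx => (hx.2 a ha).ne')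
    · exact (contDiffOn_pdWithin D (contDiffOn_pdWithin D (contDiffOn_smoothPart hu) j) i).mono
        inter_subset_left
  have hTs : ∀ i j, ContDiff ℝ ∞ (fun x => T x i j) := by
    intro i j
    simp only [T, Matrix.add_apply, Matrix.sum_apply, Matrix.smul_apply, smul_eq_mul]
    exact contDiff_const.add (ContDiff.sum fun a _ =>
      ((contDiff_const.mul (contDiff_ell D a)).sub contDiff_const).mul contDiff_const)
  have hMs : ∀ i j, ContDiffOn ℝ ∞ (fun x => M x i j) (D.carrier ∩ W₀) := by
    intro i j
    simp only [M, Matrix.add_apply, Matrix.sum_apply, Matrix.mul_apply]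
    exact contDiffOn_const.add (ContDiffOn.sum fun k _ => (hTs i k).contDiffOn.mul (hSs k j))
  -- invertibility at the point `x₀`
  have hdet : (M x₀).det ≠ 0 := by
    intro h0
    obtain ⟨w, hw0, hw⟩ := Matrix.exists_mulVec_eq_zero_iff.2 h0
    set z := S x₀ *ᵥ w with hz
    have hMw : ∑ a ∈ A, (N a ⬝ᵥ w) • N a + T x₀ *ᵥ z = 0 := by
      rw [← hw]
      simp only [M, add_mulVec, sum_mulVec, vecMulVec_mulVec, ← mulVec_mulVec, op_smul_eq_smul, hz]
    have hTz : T x₀ *ᵥ z = z - ∑ a ∈ A, ((e a : Fin n → ℝ) ⬝ᵥ z) • N a := by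
      rw [hTv, sub_eq_add_neg, ← Finset.sum_neg_distrib]
      congr 1
      refine Finset.sum_congr rfl fun a ha => ?_
      rw [(hA a).1 ha]; module
    have htan : ∀ b ∈ A, N b ⬝ᵥ w = 0 := by
      intro b hb
      have h1 := congrArg (fun y => (e b : Fin n → ℝ) ⬝ᵥ y) hMw
      simp only [hTz, dotProduct_add, dotProduct_sub, dotProduct_sum, dotProduct_smul,
        dotProduct_zero, smul_eq_mul] at h1
      have h2 : ∀ c : Fin D.d → ℝ, ∑ a ∈ A, c a * ((e b : Fin n → ℝ) ⬝ᵥ N a) = c b := by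
        intro c
        rw [Finset.sum_congr rfl fun a ha => by rw [hNe b hb a ha]]
        simp [hb]
      rw [h2, h2] at h1
      simpa using h1
    have hTz0 : T x₀ *ᵥ z = 0 := by
      rw [Finset.sum_eq_zero fun a ha => by rw [htan a ha, zero_smul], zero_add] at hMw
      exact hMw
    have hwSw : w ⬝ᵥ z = 0 := by
      have h1 := congrArg (fun y => w ⬝ᵥ y) hTz0
      simp only [hTz, dotProduct_sub, dotProduct_sum, dotProduct_smul, dotProduct_zero,
        smul_eq_mul] at h1
      rw [Finset.sum_eq_zero fun a ha => by rw [dotProduct_comm w, htan a ha, mul_zero],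
        sub_zero] at h1
      exact h1
    have hcon : ∀ a, D.conormal a (WithLp.toLp 2 w) = w ⬝ᵥ N a := fun a => by
      rw [conormal_apply]; rfl
    have hpos := hu.hess_pos x₀ hx₀ (WithLp.toLp 2 w) (by simpa using hw0) fun a ha => by
      rw [← conormal_apply, hcon, dotProduct_comm]
      exact htan a ((hA a).2 ha)
    rw [iteratedDeriv_potential_face hu hx₀ hA fun a ha => by
      rw [hcon, dotProduct_comm]; exact htan a ((hA a).2 ha)] at hpos
    refine hpos.ne' (Eq.trans ?_ hwSw)
    simp only [hz, dotProduct, mulVec, Finset.mul_sum]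
    exact Finset.sum_congr rfl fun i _ => Finset.sum_congr rfl fun j _ => by
      simp only [S]; ring
  obtain ⟨V, hVo, hV⟩ := continuousOn_iff'.1 (contDiffOn_matrix_det hMs).continuousOn {0}ᶜ
    isOpen_compl_singleton
  have hVmem : ∀ x, x ∈ D.carrier ∩ W₀ → ((M x).det ≠ 0 ↔ x ∈ V) := by
    intro x hx
    have := Set.ext_iff.1 hV x
    simp only [mem_inter_iff, mem_preimage, mem_compl_iff, mem_singleton_iff] at this
    exact ⟨fun h => (this.1 ⟨h, hx⟩).1, fun h => (this.2 ⟨h, hx⟩).1⟩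
  have hdetV : ∀ x ∈ D.carrier ∩ (W₀ ∩ V), (M x).det ≠ 0 := fun x hx =>
    (hVmem x ⟨hx.1, hx.2.1⟩).2 hx.2.2
  refine ⟨W₀ ∩ V, fun x => (M x)⁻¹ * T x, hW₀o.inter hVo,
    ⟨hx₀W, (hVmem x₀ ⟨hx₀, hx₀W⟩).1 hdet⟩, fun i j => ?_, fun x hx => ?_⟩
  · simp only [Matrix.mul_apply]
    refine ContDiffOn.sum fun k _ => ContDiffOn.mul ?_ (hTs k j).contDiffOn
    exact contDiffOn_matrix_inv (fun i j => (hMs i j).mono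
      fun x hx => ⟨hx.1, hx.2.1⟩) hdetV i k
  · have hxpos := (mem_interior_carrier D).1 hx.1
    have hH : hess u x = ∑ a ∈ A, ((1 / 2) * (D.ell a x)⁻¹) • vecMulVec (N a) (N a) + S x := by
      ext i j
      rw [hess_potential hu hx.1, ← Finset.sum_add_sum_compl A]
      simp only [S, regularHess, Matrix.add_apply, Matrix.sum_apply, of_apply,
        Matrix.smul_apply, vecMulVec_apply, N, smul_eq_mul, mul_add, add_assoc]
      congr 1
      rw [Finset.mul_sum]
      exact Finset.sum_congr rfl fun a _ => by ring
    have hTH : T x * hess u x = M x := by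
      rw [hH, mul_add, Finset.mul_sum]
      congr 1
      refine Finset.sum_congr rfl fun a ha => ?_
      rw [Matrix.mul_smul, mul_vecMulVec, hTN x a ha]
      ext i j
      simp only [Matrix.smul_apply, vecMulVec_apply, Pi.smul_apply, smul_eq_mul]
      field_simp [(hxpos a).ne']
    rw [mul_assoc, hTH]
    exact Matrix.nonsing_inv_mul _ (isUnit_iff_ne_zero.2 (hdetV x ⟨interior_subset hx.1, hx.2⟩))

lemma isUnit_hess {D : DelzantPolytope n} {u : EuclideanSpace ℝ (Fin n) → ℝ}
    (hu : IsSymplecticPotential D u) {x : EuclideanSpace ℝ (Fin n)} (hx : x ∈ interior D.carrier) :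
    IsUnit (hess u x).det := by
  obtain ⟨W, F, -, hxW, -, hF⟩ := exists_local_inverse hu (interior_subset hx)
  exact Matrix.isUnit_det_of_left_inverse (hF x ⟨hx, hxW⟩)

/-- A continuous local extension to the polytope of a function on the interior agrees with
`extendFrom`. -/
lemma extendFrom_eqOn_of_local (D : DelzantPolytope n) {g F : EuclideanSpace ℝ (Fin n) → ℝ}
    {W : Set (EuclideanSpace ℝ (Fin n))} (hW : IsOpen W) (hF : ContinuousOn F (D.carrier ∩ W))
    (h : ∀ x ∈ interior D.carrier ∩ W, F x = g x) :
    EqOn (extendFrom (interior D.carrier) g) F (D.carrier ∩ W) := by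
  intro x hx
  refine extendFrom_eq (by rw [closure_interior_carrier]; exact hx.1) ?_
  have h1 : Filter.Tendsto F (𝓝[interior D.carrier ∩ W] x) (𝓝 (F x)) :=
    (hF x hx).mono_left (nhdsWithin_mono x (inter_subset_inter_left W interior_subset))
  rw [nhdsWithin_inter_of_mem' (mem_nhdsWithin_of_mem_nhds (hW.mem_nhds hx.2))] at h1
  refine h1.congr' ?_
  filter_upwards [self_mem_nhdsWithin, mem_nhdsWithin_of_mem_nhds (hW.mem_nhds hx.2)] with y hy hyW
  exact h y ⟨hy, hyW⟩

lemma contDiffOn_invHess {D : DelzantPolytope n} {u : EuclideanSpace ℝ (Fin n) → ℝ}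
    (hu : IsSymplecticPotential D u) (i j : Fin n) :
    ContDiffOn ℝ ∞ (invHess D u i j) D.carrier := by
  refine contDiffOn_of_locally_contDiffOn fun x₀ hx₀ => ?_
  obtain ⟨W, F, hW, hxW, hFs, hF⟩ := exists_local_inverse hu hx₀
  refine ⟨W, hW, hxW, (hFs i j).congr ?_⟩
  refine extendFrom_eqOn_of_local D hW (hFs i j).continuousOn fun x hx => ?_
  rw [Matrix.inv_eq_left_inv (hF x hx)]

lemma invHess_eq {D : DelzantPolytope n} {u : EuclideanSpace ℝ (Fin n) → ℝ}
    (hu : IsSymplecticPotential D u) {x : EuclideanSpace ℝ (Fin n)} (hx : x ∈ interior D.carrier)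
    (i j : Fin n) : invHess D u i j x = (hess u x)⁻¹ i j := by
  obtain ⟨W, F, hW, hxW, hFs, hF⟩ := exists_local_inverse hu (interior_subset hx)
  rw [Matrix.inv_eq_left_inv (hF x ⟨hx, hxW⟩)]
  refine extendFrom_eqOn_of_local D hW (hFs i j).continuousOn (fun x hx => ?_)
    ⟨interior_subset hx, hxW⟩
  rw [Matrix.inv_eq_left_inv (hF x hx)]

lemma invHess_symm {D : DelzantPolytope n} {u : EuclideanSpace ℝ (Fin n) → ℝ}
    (hu : IsSymplecticPotential D u) {x : EuclideanSpace ℝ (Fin n)} (hx : x ∈ D.carrier)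
    (i j : Fin n) : invHess D u i j x = invHess D u j i x := by
  have hcl : x ∈ closure (interior D.carrier) := by rwa [closure_interior_carrier]
  refine EqOn.of_subset_closure (s := interior D.carrier) (t := D.carrier) (fun y hy => ?_)
    (contDiffOn_invHess hu i j).continuousOn (contDiffOn_invHess hu j i).continuousOn
    interior_subset (closure_interior_carrier D).ge hx
  have hs : (hess u y).transpose = hess u y := by
    ext i j; exact hess_symm hu hy j i
  rw [invHess_eq hu hy, invHess_eq hu hy, ← Matrix.transpose_apply (hess u y)⁻¹,
    Matrix.transpose_nonsing_inv, hs]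

/-! ### Scalar curvature of a toric Kähler metric -/

/-- The projection `(x, θ) ↦ x`. -/
noncomputable def baseProj (n : ℕ) :
    EuclideanSpace ℝ (Fin n ⊕ Fin n) →L[ℝ] EuclideanSpace ℝ (Fin n) :=
  LinearMap.toContinuousLinearMap
    { toFun := fun z => WithLp.toLp 2 fun i => z (Sum.inl i)
      map_add' := fun _ _ => rfl
      map_smul' := fun _ _ => rfl }

lemma baseProj_apply (z : EuclideanSpace ℝ (Fin n ⊕ Fin n)) :
    baseProj n z = WithLp.toLp 2 fun i => z (Sum.inl i) := rfl

lemma baseProj_single_inl (i : Fin n) :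
    baseProj n (EuclideanSpace.single (Sum.inl i) 1) = EuclideanSpace.single i 1 := by
  ext j
  simp [baseProj_apply]

lemma baseProj_single_inr (i : Fin n) :
    baseProj n (EuclideanSpace.single (Sum.inr i) 1) = 0 := by
  ext j
  simp [baseProj_apply]

lemma pd_inl_comp_baseProj {F : EuclideanSpace ℝ (Fin n) → ℝ}
    {z : EuclideanSpace ℝ (Fin n ⊕ Fin n)} (hF : DifferentiableAt ℝ F (baseProj n z)) (i : Fin n) :
    pd (Sum.inl i) (fun y => F (baseProj n y)) z = pd i F (baseProj n z) := by
  have h := hF.hasFDerivAt.comp z (baseProj n).hasFDerivAt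
  refine (pd_eq_of_hasFDerivAt h _).trans ?_
  simp [baseProj_single_inl, pd]

lemma pd_inr_comp_baseProj {F : EuclideanSpace ℝ (Fin n) → ℝ}
    {z : EuclideanSpace ℝ (Fin n ⊕ Fin n)} (hF : DifferentiableAt ℝ F (baseProj n z)) (i : Fin n) :
    pd (Sum.inr i) (fun y => F (baseProj n y)) z = 0 := by
  have h := hF.hasFDerivAt.comp z (baseProj n).hasFDerivAt
  refine (pd_eq_of_hasFDerivAt h _).trans ?_
  simp [baseProj_single_inr]

lemma pd_const {ι : Type} [Fintype ι] [DecidableEq ι] (c : ℝ) (i : ι) (x : EuclideanSpace ℝ ι) :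
    pd i (fun _ => c) x = 0 := by
  simp [pd]

lemma pd_mul {ι : Type} [Fintype ι] [DecidableEq ι] {f g : EuclideanSpace ℝ ι → ℝ}
    {x : EuclideanSpace ℝ ι} (hf : DifferentiableAt ℝ f x) (hg : DifferentiableAt ℝ g x) (i : ι) :
    pd i (fun y => f y * g y) x = f x * pd i g x + pd i f x * g x := by
  rw [pd, fderiv_fun_mul hf hg]
  simp [pd]; ring

lemma pd_const_mul {ι : Type} [Fintype ι] [DecidableEq ι] {f : EuclideanSpace ℝ ι → ℝ}
    {x : EuclideanSpace ℝ ι} (hf : DifferentiableAt ℝ f x) (c : ℝ) (i : ι) :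
    pd i (fun y => c * f y) x = c * pd i f x := by
  rw [pd, fderiv_const_mul hf]
  simp [pd]

lemma pd_neg {ι : Type} [Fintype ι] [DecidableEq ι] {f : EuclideanSpace ℝ ι → ℝ}
    {x : EuclideanSpace ℝ ι} (i : ι) :
    pd i (fun y => - f y) x = - pd i f x := by
  rw [pd, fderiv_fun_neg]
  simp [pd]

lemma pd_sum {ι : Type} [Fintype ι] [DecidableEq ι] {κ : Type} (s : Finset κ)
    {f : κ → EuclideanSpace ℝ ι → ℝ} {x : EuclideanSpace ℝ ι}
    (hf : ∀ k ∈ s, DifferentiableAt ℝ (f k) x) (i : ι) :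
    pd i (fun y => ∑ k ∈ s, f k y) x = ∑ k ∈ s, pd i (f k) x := by
  rw [pd, fderiv_fun_sum hf]
  simp [pd]

/-- `H` is a Hessian matrix function (symmetric, with totally symmetric first derivatives) on the
open set `O`, and `G` is its inverse. -/
structure IsHessianPair (O : Set (EuclideanSpace ℝ (Fin n)))
    (H G : EuclideanSpace ℝ (Fin n) → Matrix (Fin n) (Fin n) ℝ) : Prop where
  isOpen : IsOpen O
  smooth : ∀ i j, ContDiffOn ℝ ∞ (fun x => H x i j) O
  smooth_inv : ∀ i j, ContDiffOn ℝ ∞ (fun x => G x i j) O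
  inv_mul : ∀ x ∈ O, G x * H x = 1
  symm : ∀ x ∈ O, ∀ i j, H x i j = H x j i
  codazzi : ∀ x ∈ O, ∀ m i j, pd m (fun y => H y i j) x = pd i (fun y => H y m j) x

namespace IsHessianPair

variable {O : Set (EuclideanSpace ℝ (Fin n))}
  {H G : EuclideanSpace ℝ (Fin n) → Matrix (Fin n) (Fin n) ℝ}
  {x : EuclideanSpace ℝ (Fin n)}

lemma mul_inv (h : IsHessianPair O H G) (hx : x ∈ O) : H x * G x = 1 :=
  mul_eq_one_comm.1 (h.inv_mul x hx)

lemma symm_inv (h : IsHessianPair O H G) (hx : x ∈ O) (i j : Fin n) : G x i j = G x j i := by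
  have hs : (H x).transpose = H x := by ext i j; exact h.symm x hx j i
  have : (G x).transpose = G x := by
    have h1 : (G x).transpose * H x = 1 := by
      conv_lhs => rw [← hs]
      rw [← Matrix.transpose_mul, h.mul_inv hx, Matrix.transpose_one]
    rw [← Matrix.inv_eq_left_inv h1, ← Matrix.inv_eq_left_inv (h.inv_mul x hx)]
  exact congrFun (congrFun this j) i

lemma diffAt (h : IsHessianPair O H G) (hx : x ∈ O) (i j : Fin n) :
    DifferentiableAt ℝ (fun y => H y i j) x :=
  ((h.smooth i j).contDiffAt (h.isOpen.mem_nhds hx)).differentiableAt (by simp)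

lemma diffAt_inv (h : IsHessianPair O H G) (hx : x ∈ O) (i j : Fin n) :
    DifferentiableAt ℝ (fun y => G y i j) x :=
  ((h.smooth_inv i j).contDiffAt (h.isOpen.mem_nhds hx)).differentiableAt (by simp)

end IsHessianPair

/-- Twice the Christoffel symbol `Γ^l_{ij}` of the Hessian metric `H`. -/
noncomputable def hessGamma (H G : EuclideanSpace ℝ (Fin n) → Matrix (Fin n) (Fin n) ℝ)
    (l i j : Fin n) (x : EuclideanSpace ℝ (Fin n)) : ℝ :=
  ∑ m, G x l m * pd m (fun y => H y i j) x

/-- The symbol `-G^{lm} ∂_m G^{ij}`, that is, twice the Christoffel symbol of the toric metric with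
upper index in the `x`-directions and lower indices in the `θ`-directions. -/
noncomputable def invGamma (G : EuclideanSpace ℝ (Fin n) → Matrix (Fin n) (Fin n) ℝ)
    (l i j : Fin n) (x : EuclideanSpace ℝ (Fin n)) : ℝ :=
  -∑ m, G x l m * pd m (fun y => G y i j) x

namespace IsHessianPair

variable {O : Set (EuclideanSpace ℝ (Fin n))}
  {H G : EuclideanSpace ℝ (Fin n) → Matrix (Fin n) (Fin n) ℝ}
  {x : EuclideanSpace ℝ (Fin n)}

lemma hessGamma_symm (h : IsHessianPair O H G) (hx : x ∈ O) (l i j : Fin n) :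
    hessGamma H G l i j x = hessGamma H G l j i x := by
  refine Finset.sum_congr rfl fun m _ => ?_
  congr 1
  refine pd_congr ?_ m
  filter_upwards [h.isOpen.mem_nhds hx] with y hy
  exact h.symm y hy i j

lemma contDiffOn_hessGamma (h : IsHessianPair O H G) (l i j : Fin n) :
    ContDiffOn ℝ ∞ (hessGamma H G l i j) O :=
  ContDiffOn.sum fun m _ => (h.smooth_inv l m).mul (contDiffOn_pd h.isOpen (h.smooth i j) m)

lemma contDiffOn_invGamma (h : IsHessianPair O H G) (l i j : Fin n) :
    ContDiffOn ℝ ∞ (invGamma G l i j) O :=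
  (ContDiffOn.sum fun m _ =>
    (h.smooth_inv l m).mul (contDiffOn_pd h.isOpen (h.smooth_inv i j) m)).neg

/-- The derivative of `G H = 1`. -/
lemma sum_pd_inv_mul (h : IsHessianPair O H G) (hx : x ∈ O) (l i j : Fin n) :
    ∑ m, pd i (fun y => G y l m) x * H x m j = -hessGamma H G l i j x := by
  have h1 : pd i (fun y => ∑ m, G y l m * H y m j) x = 0 := by
    rw [← pd_const ((1 : Matrix (Fin n) (Fin n) ℝ) l j) i x]
    refine pd_congr ?_ i
    filter_upwards [h.isOpen.mem_nhds hx] with y hy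
    rw [← h.inv_mul y hy, Matrix.mul_apply]
  rw [pd_sum _ fun m _ => (h.diffAt_inv hx l m).fun_mul (h.diffAt hx m j)] at h1
  simp only [pd_mul (h.diffAt_inv hx l _) (h.diffAt hx _ j), Finset.sum_add_distrib] at h1
  rw [hessGamma, eq_neg_iff_add_eq_zero, add_comm, ← h1]
  congr 1
  exact Finset.sum_congr rfl fun m _ => by rw [h.codazzi x hx m i j]

lemma pd_inv_eq (h : IsHessianPair O H G) (hx : x ∈ O) (l i j : Fin n) :
    pd i (fun y => G y l j) x = -∑ a, hessGamma H G l i a x * G x a j := by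
  have h1 : ∑ a, (∑ m, pd i (fun y => G y l m) x * H x m a) * G x a j =
      pd i (fun y => G y l j) x := by
    simp only [Finset.sum_mul]
    rw [Finset.sum_comm]
    have : ∀ m, ∑ a, pd i (fun y => G y l m) x * H x m a * G x a j =
        pd i (fun y => G y l m) x * (1 : Matrix (Fin n) (Fin n) ℝ) m j := by
      intro m
      rw [← h.mul_inv hx, Matrix.mul_apply, Finset.mul_sum]
      exact Finset.sum_congr rfl fun a _ => by ring
    simp [this, Matrix.one_apply]
  rw [← h1, ← Finset.sum_neg_distrib]
  exact Finset.sum_congr rfl fun a _ => by rw [h.sum_pd_inv_mul hx]; ring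

lemma pd_inv_symm (h : IsHessianPair O H G) (hx : x ∈ O) (l i j : Fin n) :
    pd i (fun y => G y l j) x = pd i (fun y => G y j l) x := by
  refine pd_congr ?_ i
  filter_upwards [h.isOpen.mem_nhds hx] with y hy
  exact h.symm_inv hy l j

lemma invGamma_symm_right (h : IsHessianPair O H G) (hx : x ∈ O) (l i j : Fin n) :
    invGamma G l i j x = invGamma G l j i x := by
  simp only [invGamma, h.pd_inv_symm hx i _ j]

lemma invGamma_symm_left (h : IsHessianPair O H G) (hx : x ∈ O) (l i j : Fin n) :
    invGamma G l i j x = invGamma G i l j x := by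
  have key : ∀ l i, invGamma G l i j x =
      ∑ m, ∑ a, G x l m * G x i a * hessGamma H G j m a x := by
    intro l i
    rw [invGamma, ← Finset.sum_neg_distrib]
    refine Finset.sum_congr rfl fun m _ => ?_
    rw [h.pd_inv_symm hx, h.pd_inv_eq hx, mul_neg, neg_neg, Finset.mul_sum]
    refine Finset.sum_congr rfl fun a _ => ?_
    rw [h.symm_inv hx a i]; ring
  rw [key, key, Finset.sum_comm]
  refine Finset.sum_congr rfl fun m _ => Finset.sum_congr rfl fun a _ => ?_
  rw [h.hessGamma_symm hx]; ring

lemma sum_inv_mul_hessGamma (h : IsHessianPair O H G) (hx : x ∈ O) (l : Fin n) :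
    ∑ i, ∑ j, G x i j * hessGamma H G l i j x = -∑ i, pd i (fun y => G y l i) x := by
  rw [← Finset.sum_neg_distrib]
  refine Finset.sum_congr rfl fun i _ => ?_
  rw [h.pd_inv_eq hx, neg_neg]
  exact Finset.sum_congr rfl fun j _ => by rw [h.symm_inv hx i j]; ring

lemma sum_mul_invGamma (h : IsHessianPair O H G) (hx : x ∈ O) (l : Fin n) :
    ∑ i, ∑ j, H x i j * invGamma G l i j x = -∑ i, pd i (fun y => G y l i) x := by
  have h1 : ∀ i j, H x i j * invGamma G l i j x =
      -∑ m, (H x j i * G x i m) * pd m (fun y => G y l j) x := by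
    intro i j
    rw [h.invGamma_symm_left hx, invGamma, mul_neg, Finset.mul_sum, h.symm x hx i j]
    congr 1
    exact Finset.sum_congr rfl fun m _ => by ring
  simp only [h1, Finset.sum_neg_distrib]
  congr 1
  rw [Finset.sum_comm]
  refine Finset.sum_congr rfl fun j _ => ?_
  rw [Finset.sum_comm]
  have h2 : ∀ m, ∑ i, (H x j i * G x i m) * pd m (fun y => G y l j) x =
      (1 : Matrix (Fin n) (Fin n) ℝ) j m * pd m (fun y => G y l j) x := by
    intro m
    rw [← h.mul_inv hx, Matrix.mul_apply, Finset.sum_mul]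
  simp [h2, Matrix.one_apply]

/-- The squared norm of the third derivatives, in the form in which it enters the curvature. -/
noncomputable def thirdNorm (H G : EuclideanSpace ℝ (Fin n) → Matrix (Fin n) (Fin n) ℝ)
    (x : EuclideanSpace ℝ (Fin n)) : ℝ :=
  ∑ i, ∑ j, ∑ l, ∑ m, G x i j * (hessGamma H G l j m x * hessGamma H G m i l x)

lemma sum_pd_inv_mul_hessGamma (h : IsHessianPair O H G) (hx : x ∈ O) :
    ∑ l, ∑ i, ∑ j, pd l (fun y => G y i j) x * hessGamma H G l i j x = -thirdNorm H G x := by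
  have : ∀ l i j, pd l (fun y => G y i j) x * hessGamma H G l i j x =
      -∑ a, G x i a * (hessGamma H G j a l x * hessGamma H G l i j x) := by
    intro l i j
    rw [h.pd_inv_symm hx, h.pd_inv_eq hx, neg_mul, Finset.sum_mul]
    congr 1
    refine Finset.sum_congr rfl fun a _ => ?_
    rw [h.symm_inv hx a i, h.hessGamma_symm hx j l a]; ring
  simp only [this, Finset.sum_neg_distrib, thirdNorm]
  congr 1
  rw [Finset.sum_comm]
  refine Finset.sum_congr rfl fun i _ => ?_
  -- the summation indices `l, j, a` become `m, l, j`
  calc ∑ m, ∑ l, ∑ j, G x i j * (hessGamma H G l j m x * hessGamma H G m i l x)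
      = ∑ m, ∑ j, ∑ l, G x i j * (hessGamma H G l j m x * hessGamma H G m i l x) :=
        Finset.sum_congr rfl fun m _ => Finset.sum_comm
    _ = ∑ j, ∑ m, ∑ l, G x i j * (hessGamma H G l j m x * hessGamma H G m i l x) :=
        Finset.sum_comm
    _ = _ := Finset.sum_congr rfl fun j _ => Finset.sum_comm

lemma sum_pd_mul_invGamma (h : IsHessianPair O H G) (hx : x ∈ O) :
    ∑ l, ∑ i, ∑ j, pd l (fun y => H y i j) x * invGamma G l i j x = thirdNorm H G x := by
  rw [← neg_neg (thirdNorm H G x), ← h.sum_pd_inv_mul_hessGamma hx]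
  have h1 : ∀ l i j, pd l (fun y => H y i j) x * invGamma G l i j x =
      -∑ m, G x m l * pd l (fun y => H y i j) x * pd m (fun y => G y i j) x := by
    intro l i j
    rw [invGamma, mul_neg, Finset.mul_sum]
    congr 1
    exact Finset.sum_congr rfl fun m _ => by rw [h.symm_inv hx l m]; ring
  have h2 : ∀ m i j, pd m (fun y => G y i j) x * hessGamma H G m i j x =
      ∑ l, G x m l * pd l (fun y => H y i j) x * pd m (fun y => G y i j) x := by
    intro m i j
    rw [hessGamma, Finset.mul_sum]
    exact Finset.sum_congr rfl fun l _ => by ring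
  simp only [h1, h2, Finset.sum_neg_distrib]
  congr 1
  calc ∑ l, ∑ i, ∑ j, ∑ m, G x m l * pd l (fun y => H y i j) x * pd m (fun y => G y i j) x
      = ∑ l, ∑ i, ∑ m, ∑ j, G x m l * pd l (fun y => H y i j) x * pd m (fun y => G y i j) x :=
        Finset.sum_congr rfl fun l _ => Finset.sum_congr rfl fun i _ => Finset.sum_comm
    _ = ∑ l, ∑ m, ∑ i, ∑ j, G x m l * pd l (fun y => H y i j) x * pd m (fun y => G y i j) x :=
        Finset.sum_congr rfl fun l _ => Finset.sum_comm
    _ = ∑ m, ∑ l, ∑ i, ∑ j, G x m l * pd l (fun y => H y i j) x * pd m (fun y => G y i j) x :=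
        Finset.sum_comm
    _ = ∑ m, ∑ i, ∑ l, ∑ j, G x m l * pd l (fun y => H y i j) x * pd m (fun y => G y i j) x :=
        Finset.sum_congr rfl fun m _ => Finset.sum_comm
    _ = _ := Finset.sum_congr rfl fun m _ => Finset.sum_congr rfl fun i _ => Finset.sum_comm

lemma sum_mul_invGamma_mul_hessGamma (h : IsHessianPair O H G) (hx : x ∈ O) :
    ∑ i, ∑ j, ∑ l, ∑ m, H x i j * (invGamma G l j m x * hessGamma H G i l m x) =
      thirdNorm H G x := by
  rw [← neg_neg (thirdNorm H G x), ← h.sum_pd_inv_mul_hessGamma hx]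
  have h1 : ∀ i l m, ∑ j, H x i j * (invGamma G l j m x * hessGamma H G i l m x) =
      -(pd i (fun y => G y l m) x * hessGamma H G i l m x) := by
    intro i l m
    have : ∑ j, H x i j * invGamma G l j m x = -pd i (fun y => G y l m) x := by
      have h3 : ∀ j, H x i j * invGamma G l j m x =
          -∑ a, (H x i j * G x j a) * pd a (fun y => G y l m) x := by
        intro j
        rw [h.invGamma_symm_left hx, invGamma, mul_neg, Finset.mul_sum]
        congr 1
        exact Finset.sum_congr rfl fun a _ => by ring
      have h4 : ∀ a, ∑ j, (H x i j * G x j a) * pd a (fun y => G y l m) x =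
          (1 : Matrix (Fin n) (Fin n) ℝ) i a * pd a (fun y => G y l m) x := by
        intro a
        rw [← h.mul_inv hx, Matrix.mul_apply, Finset.sum_mul]
      simp only [h3, Finset.sum_neg_distrib]
      rw [Finset.sum_comm]
      simp [h4, Matrix.one_apply]
    rw [← neg_mul, ← this, Finset.sum_mul]
    exact Finset.sum_congr rfl fun j _ => by ring
  simp only [← Finset.sum_neg_distrib]
  refine Finset.sum_congr rfl fun i _ => ?_
  rw [Finset.sum_comm]
  refine Finset.sum_congr rfl fun l _ => ?_
  rw [Finset.sum_comm]
  exact Finset.sum_congr rfl fun m _ => h1 i l m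

end IsHessianPair

/-- The metric `H_{ij} dx_i dx_j + G^{ij} dθ_i dθ_j`. -/
noncomputable def blockMetric (H G : EuclideanSpace ℝ (Fin n) → Matrix (Fin n) (Fin n) ℝ)
    (z : EuclideanSpace ℝ (Fin n ⊕ Fin n)) : Matrix (Fin n ⊕ Fin n) (Fin n ⊕ Fin n) ℝ :=
  Matrix.fromBlocks (H (baseProj n z)) 0 0 (G (baseProj n z))

namespace IsHessianPair

variable {O : Set (EuclideanSpace ℝ (Fin n))}
  {H G : EuclideanSpace ℝ (Fin n) → Matrix (Fin n) (Fin n) ℝ}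
  {z : EuclideanSpace ℝ (Fin n ⊕ Fin n)}

lemma blockMetric_inv (h : IsHessianPair O H G) (hz : baseProj n z ∈ O) :
    (blockMetric H G z)⁻¹ =
      Matrix.fromBlocks (G (baseProj n z)) 0 0 (H (baseProj n z)) := by
  refine Matrix.inv_eq_left_inv ?_
  rw [blockMetric, Matrix.fromBlocks_multiply]
  simp [h.inv_mul _ hz, h.mul_inv hz]

lemma christoffel_blockMetric_inl (h : IsHessianPair O H G) (hz : baseProj n z ∈ O) (l : Fin n)
    (a b : Fin n ⊕ Fin n) :
    christoffel (blockMetric H G) (Sum.inl l) a b z =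
      (1 / 2) * ∑ m, G (baseProj n z) l m * (pd a (fun y => blockMetric H G y b (Sum.inl m)) z +
        pd b (fun y => blockMetric H G y a (Sum.inl m)) z -
        pd (Sum.inl m) (fun y => blockMetric H G y a b) z) := by
  rw [christoffel, h.blockMetric_inv hz, Fintype.sum_sum_type]
  simp

lemma christoffel_blockMetric_inr (h : IsHessianPair O H G) (hz : baseProj n z ∈ O) (l : Fin n)
    (a b : Fin n ⊕ Fin n) :
    christoffel (blockMetric H G) (Sum.inr l) a b z =
      (1 / 2) * ∑ m, H (baseProj n z) l m * (pd a (fun y => blockMetric H G y b (Sum.inr m)) z +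
        pd b (fun y => blockMetric H G y a (Sum.inr m)) z -
        pd (Sum.inr m) (fun y => blockMetric H G y a b) z) := by
  rw [christoffel, h.blockMetric_inv hz, Fintype.sum_sum_type]
  simp

lemma pd_inl_blockMetric_inl (h : IsHessianPair O H G) (hz : baseProj n z ∈ O) (i j k : Fin n) :
    pd (Sum.inl k) (fun y => blockMetric H G y (Sum.inl i) (Sum.inl j)) z =
      pd k (fun y => H y i j) (baseProj n z) :=
  pd_inl_comp_baseProj (h.diffAt hz i j) k

lemma pd_inr_blockMetric_inl (h : IsHessianPair O H G) (hz : baseProj n z ∈ O) (i j k : Fin n) :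
    pd (Sum.inr k) (fun y => blockMetric H G y (Sum.inl i) (Sum.inl j)) z = 0 :=
  pd_inr_comp_baseProj (h.diffAt hz i j) k

lemma pd_inl_blockMetric_inr (h : IsHessianPair O H G) (hz : baseProj n z ∈ O) (i j k : Fin n) :
    pd (Sum.inl k) (fun y => blockMetric H G y (Sum.inr i) (Sum.inr j)) z =
      pd k (fun y => G y i j) (baseProj n z) :=
  pd_inl_comp_baseProj (h.diffAt_inv hz i j) k

lemma pd_inr_blockMetric_inr (h : IsHessianPair O H G) (hz : baseProj n z ∈ O) (i j k : Fin n) :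
    pd (Sum.inr k) (fun y => blockMetric H G y (Sum.inr i) (Sum.inr j)) z = 0 :=
  pd_inr_comp_baseProj (h.diffAt_inv hz i j) k

lemma pd_blockMetric_inl_inr (H G : EuclideanSpace ℝ (Fin n) → Matrix (Fin n) (Fin n) ℝ)
    (z : EuclideanSpace ℝ (Fin n ⊕ Fin n)) (i j : Fin n) (k : Fin n ⊕ Fin n) :
    pd k (fun y => blockMetric H G y (Sum.inl i) (Sum.inr j)) z = 0 := pd_const 0 k z

lemma pd_blockMetric_inr_inl (H G : EuclideanSpace ℝ (Fin n) → Matrix (Fin n) (Fin n) ℝ)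
    (z : EuclideanSpace ℝ (Fin n ⊕ Fin n)) (i j : Fin n) (k : Fin n ⊕ Fin n) :
    pd k (fun y => blockMetric H G y (Sum.inr i) (Sum.inl j)) z = 0 := pd_const 0 k z

lemma christoffel_inl_inl_inl (h : IsHessianPair O H G) (hz : baseProj n z ∈ O) (l i j : Fin n) :
    christoffel (blockMetric H G) (Sum.inl l) (Sum.inl i) (Sum.inl j) z =
      (1 / 2) * hessGamma H G l i j (baseProj n z) := by
  simp only [h.christoffel_blockMetric_inl hz, h.pd_inl_blockMetric_inl hz, hessGamma]
  congr 1
  refine Finset.sum_congr rfl fun m _ => ?_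
  congr 1
  have h1 : pd j (fun y => H y i m) (baseProj n z) = pd m (fun y => H y i j) (baseProj n z) := by
    rw [h.codazzi _ hz m i j, h.codazzi _ hz j i m]
    refine pd_congr ?_ i
    filter_upwards [h.isOpen.mem_nhds hz] with y hy
    exact h.symm y hy j m
  have h2 : pd i (fun y => H y j m) (baseProj n z) = pd m (fun y => H y i j) (baseProj n z) := by
    rw [h.codazzi _ hz m i j]
    refine pd_congr ?_ i
    filter_upwards [h.isOpen.mem_nhds hz] with y hy
    exact h.symm y hy j m
  rw [h1, h2]; ring

lemma christoffel_inr_inl_inl (h : IsHessianPair O H G) (hz : baseProj n z ∈ O) (l i j : Fin n) :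
    christoffel (blockMetric H G) (Sum.inr l) (Sum.inl i) (Sum.inl j) z = 0 := by
  simp [h.christoffel_blockMetric_inr hz, pd_blockMetric_inl_inr,
    h.pd_inr_blockMetric_inl hz]

lemma christoffel_inl_inl_inr (h : IsHessianPair O H G) (hz : baseProj n z ∈ O) (l i j : Fin n) :
    christoffel (blockMetric H G) (Sum.inl l) (Sum.inl i) (Sum.inr j) z = 0 := by
  simp [h.christoffel_blockMetric_inl hz, pd_blockMetric_inl_inr, pd_blockMetric_inr_inl,
    h.pd_inr_blockMetric_inl hz]

lemma christoffel_inl_inr_inl (h : IsHessianPair O H G) (hz : baseProj n z ∈ O) (l i j : Fin n) :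
    christoffel (blockMetric H G) (Sum.inl l) (Sum.inr i) (Sum.inl j) z = 0 := by
  simp [h.christoffel_blockMetric_inl hz, pd_blockMetric_inr_inl,
    h.pd_inr_blockMetric_inl hz]

lemma christoffel_inr_inr_inr (h : IsHessianPair O H G) (hz : baseProj n z ∈ O) (l i j : Fin n) :
    christoffel (blockMetric H G) (Sum.inr l) (Sum.inr i) (Sum.inr j) z = 0 := by
  simp [h.christoffel_blockMetric_inr hz,
    h.pd_inr_blockMetric_inr hz]

lemma christoffel_inl_inr_inr (h : IsHessianPair O H G) (hz : baseProj n z ∈ O) (l i j : Fin n) :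
    christoffel (blockMetric H G) (Sum.inl l) (Sum.inr i) (Sum.inr j) z =
      (1 / 2) * invGamma G l i j (baseProj n z) := by
  simp [h.christoffel_blockMetric_inl hz, pd_blockMetric_inr_inl,
    h.pd_inl_blockMetric_inr hz,
    invGamma]

lemma christoffel_inr_inl_inr (h : IsHessianPair O H G) (hz : baseProj n z ∈ O) (l i j : Fin n) :
    christoffel (blockMetric H G) (Sum.inr l) (Sum.inl i) (Sum.inr j) z =
      -((1 / 2) * hessGamma H G j i l (baseProj n z)) := by
  rw [← mul_neg, ← h.sum_pd_inv_mul hz, h.christoffel_blockMetric_inr hz]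
  congr 1
  refine Finset.sum_congr rfl fun m _ => ?_
  rw [h.symm _ hz l m]
  simp [pd_blockMetric_inl_inr, h.pd_inl_blockMetric_inr hz,
    mul_comm]

lemma christoffel_inr_inr_inl (h : IsHessianPair O H G) (hz : baseProj n z ∈ O) (l i j : Fin n) :
    christoffel (blockMetric H G) (Sum.inr l) (Sum.inr i) (Sum.inl j) z =
      -((1 / 2) * hessGamma H G i j l (baseProj n z)) := by
  rw [← mul_neg, ← h.sum_pd_inv_mul hz, h.christoffel_blockMetric_inr hz]
  congr 1
  refine Finset.sum_congr rfl fun m _ => ?_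
  rw [h.symm _ hz l m]
  simp [pd_blockMetric_inl_inr, pd_blockMetric_inr_inl, h.pd_inl_blockMetric_inr hz,
    mul_comm]

lemma eventually_mem (h : IsHessianPair O H G) (hz : baseProj n z ∈ O) :
    ∀ᶠ y in 𝓝 z, baseProj n y ∈ O :=
  (baseProj n).continuous.continuousAt.eventually (h.isOpen.mem_nhds hz)

lemma diffAt_hessGamma (h : IsHessianPair O H G) (hz : baseProj n z ∈ O) (l i j : Fin n) :
    DifferentiableAt ℝ (hessGamma H G l i j) (baseProj n z) :=
  ((h.contDiffOn_hessGamma l i j).contDiffAt (h.isOpen.mem_nhds hz)).differentiableAt (by simp)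

lemma diffAt_invGamma (h : IsHessianPair O H G) (hz : baseProj n z ∈ O) (l i j : Fin n) :
    DifferentiableAt ℝ (invGamma G l i j) (baseProj n z) :=
  ((h.contDiffOn_invGamma l i j).contDiffAt (h.isOpen.mem_nhds hz)).differentiableAt (by simp)

/-- The `x`-block of the Ricci tensor.  The traces `Γ^l_{lm}` vanish, since the metric has
determinant one. -/
lemma ricci_inl_inl (h : IsHessianPair O H G) (hz : baseProj n z ∈ O) (i j : Fin n) :
    ricci (blockMetric H G) (Sum.inl i) (Sum.inl j) z =
      (1 / 2) * ∑ l, pd l (hessGamma H G l i j) (baseProj n z) -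
      (1 / 2) * ∑ l, ∑ m,
        hessGamma H G l j m (baseProj n z) * hessGamma H G m i l (baseProj n z) := by
  have hev := h.eventually_mem hz
  have e1 : ∀ l k, pd (Sum.inl k) (christoffel (blockMetric H G) (Sum.inl l) (Sum.inl i)
      (Sum.inl j)) z = (1 / 2) * pd k (hessGamma H G l i j) (baseProj n z) := by
    intro l k
    rw [pd_congr (g := fun y => (1 / 2) * hessGamma H G l i j (baseProj n y))
      (hev.mono fun y hy => h.christoffel_inl_inl_inl hy l i j),
      pd_inl_comp_baseProj (F := fun y => (1 / 2) * hessGamma H G l i j y)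
        ((h.diffAt_hessGamma hz l i j).const_mul _),
      pd_const_mul (h.diffAt_hessGamma hz l i j)]
  have e2 : ∀ l k, pd k (christoffel (blockMetric H G) (Sum.inr l) (Sum.inl i) (Sum.inl j)) z
      = 0 := by
    intro l k
    rw [pd_congr (g := fun _ => 0) (hev.mono fun y hy => h.christoffel_inr_inl_inl hy l i j),
      pd_const]
  have e3 : ∀ l, pd (Sum.inl j) (christoffel (blockMetric H G) (Sum.inl l) (Sum.inl i)
      (Sum.inl l)) z = (1 / 2) * pd j (hessGamma H G l i l) (baseProj n z) := by
    intro l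
    rw [pd_congr (g := fun y => (1 / 2) * hessGamma H G l i l (baseProj n y))
      (hev.mono fun y hy => h.christoffel_inl_inl_inl hy l i l),
      pd_inl_comp_baseProj (F := fun y => (1 / 2) * hessGamma H G l i l y)
        ((h.diffAt_hessGamma hz l i l).const_mul _),
      pd_const_mul (h.diffAt_hessGamma hz l i l)]
  have e4 : ∀ l, pd (Sum.inl j) (christoffel (blockMetric H G) (Sum.inr l) (Sum.inl i)
      (Sum.inr l)) z = -((1 / 2) * pd j (hessGamma H G l i l) (baseProj n z)) := by
    intro l
    rw [pd_congr (g := fun y => -((1 / 2) * hessGamma H G l i l (baseProj n y)))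
      (hev.mono fun y hy => h.christoffel_inr_inl_inr hy l i l),
      pd_neg, pd_inl_comp_baseProj (F := fun y => (1 / 2) * hessGamma H G l i l y)
        ((h.diffAt_hessGamma hz l i l).const_mul _),
      pd_const_mul (h.diffAt_hessGamma hz l i l)]
  simp only [ricci, Fintype.sum_sum_type, e1, e2, e3, e4, h.christoffel_inl_inl_inl hz,
    h.christoffel_inr_inl_inl hz, h.christoffel_inl_inl_inr hz,
    h.christoffel_inr_inl_inr hz,
    h.christoffel_inr_inr_inl hz, mul_zero, add_zero, sub_zero,
    Finset.mul_sum, ← Finset.sum_add_distrib, ← Finset.sum_sub_distrib]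
  -- after symmetrizing, the two quadratic terms differ by the exchange of the summation indices
  trans ∑ l, ((1 / 2) * pd l (hessGamma H G l i j) (baseProj n z) -
      ((1 / 4) * ∑ m, hessGamma H G l j m (baseProj n z) * hessGamma H G m i l (baseProj n z) +
       (1 / 4) * ∑ m,
        hessGamma H G m j l (baseProj n z) * hessGamma H G l i m (baseProj n z)))
  · refine Finset.sum_congr rfl fun l _ => ?_
    simp only [Finset.mul_sum, ← Finset.sum_add_distrib, sub_eq_add_neg, ← Finset.sum_neg_distrib]
    congr 1
    · ring
    · refine Finset.sum_congr rfl fun m _ => ?_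
      rw [h.hessGamma_symm hz l m l]; ring
  · simp only [Finset.sum_sub_distrib, Finset.sum_add_distrib, ← Finset.mul_sum]
    rw [Finset.sum_comm (f := fun l m =>
      hessGamma H G m j l (baseProj n z) * hessGamma H G l i m (baseProj n z))]
    ring

/-- The `θ`-block of the Ricci tensor. -/
lemma ricci_inr_inr (h : IsHessianPair O H G) (hz : baseProj n z ∈ O) (i j : Fin n) :
    ricci (blockMetric H G) (Sum.inr i) (Sum.inr j) z =
      (1 / 2) * ∑ l, pd l (invGamma G l i j) (baseProj n z) +
      (1 / 4) * ∑ l, ∑ m, (invGamma G l j m (baseProj n z) * hessGamma H G i l m (baseProj n z) +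
        invGamma G l i m (baseProj n z) * hessGamma H G j l m (baseProj n z)) := by
  have hev := h.eventually_mem hz
  have e1 : ∀ l k, pd (Sum.inl k) (christoffel (blockMetric H G) (Sum.inl l) (Sum.inr i)
      (Sum.inr j)) z = (1 / 2) * pd k (invGamma G l i j) (baseProj n z) := by
    intro l k
    rw [pd_congr (g := fun y => (1 / 2) * invGamma G l i j (baseProj n y))
      (hev.mono fun y hy => h.christoffel_inl_inr_inr hy l i j),
      pd_inl_comp_baseProj (F := fun y => (1 / 2) * invGamma G l i j y)
        ((h.diffAt_invGamma hz l i j).const_mul _),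
      pd_const_mul (h.diffAt_invGamma hz l i j)]
  have e2 : ∀ l k, pd k (christoffel (blockMetric H G) (Sum.inr l) (Sum.inr i) (Sum.inr j)) z
      = 0 := by
    intro l k
    rw [pd_congr (g := fun _ => 0) (hev.mono fun y hy => h.christoffel_inr_inr_inr hy l i j),
      pd_const]
  have e3 : ∀ l k, pd k (christoffel (blockMetric H G) (Sum.inl l) (Sum.inr i) (Sum.inl l)) z
      = 0 := by
    intro l k
    rw [pd_congr (g := fun _ => 0) (hev.mono fun y hy => h.christoffel_inl_inr_inl hy l i l),
      pd_const]
  have e4 : ∀ l k, pd k (christoffel (blockMetric H G) (Sum.inr l) (Sum.inr i) (Sum.inr l)) z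
      = 0 := by
    intro l k
    rw [pd_congr (g := fun _ => 0) (hev.mono fun y hy => h.christoffel_inr_inr_inr hy l i l),
      pd_const]
  simp only [ricci, Fintype.sum_sum_type, e1, e2, e3, e4, h.christoffel_inl_inl_inl hz,
    h.christoffel_inl_inr_inl hz,
    h.christoffel_inr_inr_inr hz, h.christoffel_inl_inr_inr hz,
    h.christoffel_inr_inr_inl hz, mul_zero, add_zero, sub_zero, zero_sub,
    sub_self,
    Finset.sum_const_zero, Finset.mul_sum, ← Finset.sum_add_distrib]
  refine Finset.sum_congr rfl fun l _ => ?_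
  congr 1
  refine Finset.sum_congr rfl fun m _ => ?_
  rw [h.hessGamma_symm hz l m l, h.hessGamma_symm hz j m l, h.invGamma_symm_right hz m i l,
    h.invGamma_symm_left hz m l i, h.invGamma_symm_right hz l m i]
  ring

/-- **Abreu's formula**: the scalar curvature of `H dx² + G dθ²` is `-∂_i ∂_j G^{ij}`. -/
lemma riemannScalar_blockMetric (h : IsHessianPair O H G) (hz : baseProj n z ∈ O) :
    riemannScalar (blockMetric H G) z =
      -∑ i, ∑ j, pd i (pd j (fun y => G y i j)) (baseProj n z) := by
  set x := baseProj n z with hx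
  have hK : ∀ l i, DifferentiableAt ℝ (pd i (fun y => G y l i)) x := fun l i =>
    ((contDiffOn_pd h.isOpen (h.smooth_inv l i) i).contDiffAt
      (h.isOpen.mem_nhds hz)).differentiableAt (by simp)
  -- the derivative of a contraction whose value is `-∂_i G^{li}`
  have hcontr : ∀ (A : EuclideanSpace ℝ (Fin n) → Matrix (Fin n) (Fin n) ℝ)
      (B : Fin n → Fin n → Fin n → EuclideanSpace ℝ (Fin n) → ℝ),
      (∀ i j, DifferentiableAt ℝ (fun y => A y i j) x) →
      (∀ l i j, DifferentiableAt ℝ (B l i j) x) →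
      (∀ y ∈ O, ∀ l, ∑ i, ∑ j, A y i j * B l i j y = -∑ i, pd i (fun y => G y l i) y) →
      ∑ i, ∑ j, A x i j * ∑ l, pd l (B l i j) x =
        -(∑ i, ∑ j, pd i (pd j (fun y => G y i j)) x) -
          ∑ l, ∑ i, ∑ j, pd l (fun y => A y i j) x * B l i j x := by
    intro A B hA hB hAB
    have h1 : ∀ l, ∑ i, ∑ j, (A x i j * pd l (B l i j) x + pd l (fun y => A y i j) x * B l i j x)
        = -∑ i, pd l (pd i (fun y => G y l i)) x := by
      intro l
      have h2 : pd l (fun y => ∑ i, ∑ j, A y i j * B l i j y) x =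
          pd l (fun y => -∑ i, pd i (fun y => G y l i) y) x :=
        pd_congr (by filter_upwards [h.isOpen.mem_nhds hz] with y hy using hAB y hy l) l
      rw [pd_neg, pd_sum _ fun i _ => hK l i, pd_sum _ fun i _ =>
        DifferentiableAt.fun_sum fun j _ => (hA i j).fun_mul (hB l i j)] at h2
      rw [← h2]
      refine Finset.sum_congr rfl fun i _ => ?_
      rw [pd_sum _ fun j _ => (hA i j).fun_mul (hB l i j)]
      exact Finset.sum_congr rfl fun j _ => (pd_mul (hA i j) (hB l i j) l).symm
    have h3 := Finset.sum_congr (rfl : (Finset.univ : Finset (Fin n)) = Finset.univ)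
      fun l _ => h1 l
    simp only [Finset.sum_add_distrib, Finset.sum_neg_distrib] at h3
    rw [← h3]
    have h4 : ∑ i, ∑ j, A x i j * ∑ l, pd l (B l i j) x =
        ∑ l, ∑ i, ∑ j, A x i j * pd l (B l i j) x := by
      simp only [Finset.mul_sum]
      rw [Finset.sum_comm]
      rw [Finset.sum_congr rfl fun j _ => Finset.sum_comm, Finset.sum_comm]
      exact Finset.sum_congr rfl fun l _ => Finset.sum_comm
    rw [h4]; ring
  have hS1 := hcontr G (hessGamma H G) (fun i j => h.diffAt_inv hz i j)
    (fun l i j => h.diffAt_hessGamma hz l i j) fun y hy l => h.sum_inv_mul_hessGamma hy l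
  have hS2 := hcontr H (invGamma G) (fun i j => h.diffAt hz i j)
    (fun l i j => h.diffAt_invGamma hz l i j) fun y hy l => h.sum_mul_invGamma hy l
  rw [h.sum_pd_inv_mul_hessGamma hz] at hS1
  rw [h.sum_pd_mul_invGamma hz] at hS2
  have hN1 : ∑ i, ∑ j, G x i j * ∑ l, ∑ m, hessGamma H G l j m x * hessGamma H G m i l x =
      thirdNorm H G x := by
    simp only [Finset.mul_sum, thirdNorm]
  have hN2 : ∑ i, ∑ j, H x i j * ∑ l, ∑ m, invGamma G l j m x * hessGamma H G i l m x =
      thirdNorm H G x := by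
    simp only [Finset.mul_sum, h.sum_mul_invGamma_mul_hessGamma hz]
  have hN3 : ∑ i, ∑ j, H x i j * ∑ l, ∑ m, invGamma G l i m x * hessGamma H G j l m x =
      thirdNorm H G x := by
    rw [← hN2, Finset.sum_comm]
    exact Finset.sum_congr rfl fun i _ => Finset.sum_congr rfl fun j _ => by
      rw [h.symm x hz j i]
  have e1 : ∀ i j, G x i j * ricci (blockMetric H G) (Sum.inl i) (Sum.inl j) z =
      (1 / 2) * (G x i j * ∑ l, pd l (hessGamma H G l i j) x) -
      (1 / 2) * (G x i j * ∑ l, ∑ m, hessGamma H G l j m x * hessGamma H G m i l x) := by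
    intro i j; rw [h.ricci_inl_inl hz]; ring
  have e2 : ∀ i j, H x i j * ricci (blockMetric H G) (Sum.inr i) (Sum.inr j) z =
      (1 / 2) * (H x i j * ∑ l, pd l (invGamma G l i j) x) +
      ((1 / 4) * (H x i j * ∑ l, ∑ m, invGamma G l j m x * hessGamma H G i l m x) +
       (1 / 4) * (H x i j * ∑ l, ∑ m, invGamma G l i m x * hessGamma H G j l m x)) := by
    intro i j; rw [h.ricci_inr_inr hz]; simp only [Finset.sum_add_distrib]; ring
  rw [riemannScalar, h.blockMetric_inv hz]
  simp only [Fintype.sum_sum_type, Matrix.fromBlocks_apply₁₁, Matrix.fromBlocks_apply₁₂,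
    Matrix.fromBlocks_apply₂₁, Matrix.fromBlocks_apply₂₂, Matrix.zero_apply, zero_mul,
    Finset.sum_const_zero, add_zero, zero_add, ← hx, e1, e2, Finset.sum_add_distrib,
    Finset.sum_sub_distrib, ← Finset.mul_sum]
  rw [hN1, hN2, hN3, hS1, hS2]
  ring

end IsHessianPair

lemma isHessianPair_potential {D : DelzantPolytope n} {u : EuclideanSpace ℝ (Fin n) → ℝ}
    (hu : IsSymplecticPotential D u) :
    IsHessianPair (interior D.carrier) (hess u) (fun x => (hess u x)⁻¹) where
  isOpen := isOpen_interior
  smooth := contDiffOn_potential hu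
  smooth_inv := contDiffOn_matrix_inv (contDiffOn_potential hu) fun _ hx =>
    (isUnit_hess hu hx).ne_zero
  inv_mul _ hx := Matrix.nonsing_inv_mul _ (isUnit_hess hu hx)
  symm _ hx := hess_symm hu hx
  codazzi _ hx m i j :=
    pd_comm ((contDiffOn_pd isOpen_interior hu.smooth_interior j).contDiffAt
      (isOpen_interior.mem_nhds hx)) m i

lemma riemannScalar_toricMetric {D : DelzantPolytope n} {u : EuclideanSpace ℝ (Fin n) → ℝ}
    (hu : IsSymplecticPotential D u) {x : EuclideanSpace ℝ (Fin n)} (hx : x ∈ interior D.carrier) :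
    riemannScalar (toricMetric u) (WithLp.toLp 2 (Sum.elim (fun i => x i) (fun _ => 0))) =
      -∑ i, ∑ j, pdWithin D.carrier i (pdWithin D.carrier j (invHess D u i j)) x := by
  have hz : baseProj n (WithLp.toLp 2 (Sum.elim (fun i => x i) (fun _ => 0))) = x := by
    ext i; simp [baseProj_apply]
  have h := (isHessianPair_potential hu).riemannScalar_blockMetric
    (z := WithLp.toLp 2 (Sum.elim (fun i => x i) (fun _ => 0))) (by rw [hz]; exact hx)
  rw [hz] at h
  refine h.trans ?_
  congr 1
  refine Finset.sum_congr rfl fun i _ => Finset.sum_congr rfl fun j _ => ?_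
  rw [pdWithin_pdWithin_eq_pd hx]
  refine pd_congr ?_ i
  filter_upwards [isOpen_interior.mem_nhds hx] with y hy
  refine pd_congr ?_ j
  filter_upwards [isOpen_interior.mem_nhds hy] with w hw
  exact (invHess_eq hu hw i j).symm

/-- Abreu's formula `s = -½ ∂_i ∂_j G^{ij}` on the whole polytope. -/
lemma scalarCurvature_eq {D : DelzantPolytope n} {u : EuclideanSpace ℝ (Fin n) → ℝ}
    (hu : IsSymplecticPotential D u) {x : EuclideanSpace ℝ (Fin n)} (hx : x ∈ D.carrier) :
    scalarCurvature D u x =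
      -((1 / 2) * ∑ i, ∑ j, pdWithin D.carrier i (pdWithin D.carrier j (invHess D u i j)) x) := by
  refine extendFrom_eqOn_of_local D isOpen_univ
    (F := fun x => -((1 / 2) *
      ∑ i, ∑ j, pdWithin D.carrier i (pdWithin D.carrier j (invHess D u i j)) x))
    ?_ (fun y hy => ?_) ⟨hx, mem_univ x⟩
  · rw [inter_univ]
    exact ContinuousOn.neg (continuousOn_const.mul (continuousOn_finsetSum _ fun i _ =>
      continuousOn_finsetSum _ fun j _ => (contDiffOn_pdWithin D
        (contDiffOn_pdWithin D (contDiffOn_invHess hu i j) j) i).continuousOn))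
  · simp only [riemannScalar_toricMetric hu hy.1, mul_neg]

lemma contDiffOn_scalarCurvature {D : DelzantPolytope n} {u : EuclideanSpace ℝ (Fin n) → ℝ}
    (hu : IsSymplecticPotential D u) : ContDiffOn ℝ ∞ (scalarCurvature D u) D.carrier := by
  refine ContDiffOn.congr ?_ fun x hx => scalarCurvature_eq hu hx
  exact ContDiffOn.neg (contDiffOn_const.mul (ContDiffOn.sum fun i _ =>
    ContDiffOn.sum fun j _ => contDiffOn_pdWithin D
        (contDiffOn_pdWithin D (contDiffOn_invHess hu i j) j) i))

/-! ### The mass density as a weight on the polytope -/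

/-- The squared length of the section of weight `α`, as a function on the polytope. -/
noncomputable def weight (u : EuclideanSpace ℝ (Fin n) → ℝ) (k : ℕ)
    (α x : EuclideanSpace ℝ (Fin n)) : ℝ :=
  Real.exp (2 * (k : ℝ) * (∑ j, α j * pd j u x - legendre u x))

lemma weight_pos (u : EuclideanSpace ℝ (Fin n) → ℝ) (k : ℕ) (α x : EuclideanSpace ℝ (Fin n)) :
    0 < weight u k α x := Real.exp_pos _

lemma normSqSection_monomialSection (u : EuclideanSpace ℝ (Fin n) → ℝ) (k : ℕ)
    (α : EuclideanSpace ℝ (Fin n)) (p : EuclideanSpace ℝ (Fin n) × (Fin n → ℝ)) :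
    normSqSection u k (monomialSection u k α) p = weight u k α p.1 := by
  rw [normSqSection, monomialSection, Complex.norm_exp, ← Real.exp_nat_mul, ← Real.exp_add, weight]
  congr 1
  have h : ((k : ℂ) * ∑ j, (α j : ℂ) * ((pd j u p.1 : ℂ) + Complex.I * (p.2 j : ℂ))).re =
      (k : ℝ) * ∑ j, α j * pd j u p.1 := by
    rw [← Complex.ofReal_natCast, Complex.re_ofReal_mul, Complex.re_sum]
    congr 1
    refine Finset.sum_congr rfl fun j _ => ?_
    rw [Complex.re_ofReal_mul]
    simp
  rw [h]
  push_cast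
  ring

lemma setIntegral_openOrbit (D : DelzantPolytope n) (g : EuclideanSpace ℝ (Fin n) → ℝ) :
    ∫ p in openOrbit D, g p.1 = (∫ x in interior D.carrier, g x) * (2 * Real.pi) ^ n := by
  have h := setIntegral_prod_mul (μ := (volume : Measure (EuclideanSpace ℝ (Fin n))))
    (ν := (volume : Measure (Fin n → ℝ))) g (fun _ => (1 : ℝ)) (interior D.carrier)
    (Set.pi univ (fun _ => Ioc 0 (2 * Real.pi)))
  simp only [mul_one] at h
  rw [openOrbit, Measure.volume_eq_prod, h]
  congr 1
  simp [Measure.real, Real.volume_pi_Ioc, Real.pi_pos.le]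

/-- The normalizing factor cancels the volume of the torus. -/
lemma pairing_eq (D : DelzantPolytope n) (u : EuclideanSpace ℝ (Fin n) → ℝ) (k : ℕ)
    (α : EuclideanSpace ℝ (Fin n)) (f : EuclideanSpace ℝ (Fin n) → ℝ) :
    pairing D u k α f = (∫ x in interior D.carrier, weight u k α x * f x) /
      ∫ x in interior D.carrier, weight u k α x := by
  set N := ∫ q in openOrbit D, normSqSection u k (monomialSection u k α) q with hN
  have hN0 : 0 ≤ N := by
    refine integral_nonneg fun q => ?_
    rw [normSqSection_monomialSection]
    exact (weight_pos u k α q.1).le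
  have hmass : ∀ p, massDensity D u k α p = weight u k α p.1 / N := by
    intro p
    rw [← normSqSection_monomialSection, massDensity, normSqSection, unitSection, norm_div,
      div_pow, normSqSection, ← hN, Complex.norm_real, Real.norm_of_nonneg (Real.sqrt_nonneg _),
      Real.sq_sqrt hN0]
    ring
  have h1 : N = (∫ x in interior D.carrier, weight u k α x) * (2 * Real.pi) ^ n := by
    rw [hN, ← setIntegral_openOrbit]
    simp only [normSqSection_monomialSection]
  have h2 : pairing D u k α f =
      ((∫ x in interior D.carrier, weight u k α x * f x) * (2 * Real.pi) ^ n) / N := by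
    rw [pairing, ← setIntegral_openOrbit, ← integral_div]
    refine integral_congr_ae (Filter.Eventually.of_forall fun p => ?_)
    simp only [hmass]
    ring
  have hpi : (2 * Real.pi) ^ n ≠ 0 := by positivity
  rw [h2, h1, mul_div_mul_right _ _ hpi]

/-- The part of the exponent of `weight` that is smooth up to the boundary. -/
noncomputable def regularExponent (D : DelzantPolytope n) (u : EuclideanSpace ℝ (Fin n) → ℝ)
    (α x : EuclideanSpace ℝ (Fin n)) : ℝ :=
  (1 / 2) * ∑ a, (D.ell a α - D.ell a x) + smoothPart D u x +
    ∑ j, (α j - x j) * pdWithin D.carrier j (smoothPart D u) x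

lemma continuousOn_regularExponent {D : DelzantPolytope n} {u : EuclideanSpace ℝ (Fin n) → ℝ}
    (hu : IsSymplecticPotential D u) (α : EuclideanSpace ℝ (Fin n)) :
    ContinuousOn (regularExponent D u α) D.carrier := by
  refine ContinuousOn.add (ContinuousOn.add ?_ (contDiffOn_smoothPart hu).continuousOn) ?_
  · exact (Continuous.mul continuous_const (continuous_finsetSum _ fun a _ =>
      continuous_const.sub (continuous_ell D a))).continuousOn
  · refine continuousOn_finsetSum _ fun j _ => ContinuousOn.mul (by fun_prop)
      (contDiffOn_pdWithin D (contDiffOn_smoothPart hu) j).continuousOn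

lemma exponent_eq {D : DelzantPolytope n} {u : EuclideanSpace ℝ (Fin n) → ℝ}
    (hu : IsSymplecticPotential D u) (α : EuclideanSpace ℝ (Fin n))
    {x : EuclideanSpace ℝ (Fin n)} (hx : x ∈ interior D.carrier) :
    ∑ j, α j * pd j u x - legendre u x =
      (1 / 2) * ∑ a, D.ell a α * Real.log (D.ell a x) + regularExponent D u α x := by
  have hux : u x = (1 / 2) * ∑ a, D.ell a x * Real.log (D.ell a x) + smoothPart D u x := by
    simp only [smoothPart, guillemin]; ring
  have h1 : ∑ j, α j * pd j u x - legendre u x = ∑ j, (α j - x j) * pd j u x + u x := by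
    simp only [legendre, sub_mul, Finset.sum_sub_distrib]; ring
  have h2 : ∑ j, (α j - x j) * ∑ a, (D.normal a j : ℝ) * (Real.log (D.ell a x) + 1) =
      ∑ a, (D.ell a α - D.ell a x) * (Real.log (D.ell a x) + 1) := by
    simp only [Finset.mul_sum]
    rw [Finset.sum_comm]
    refine Finset.sum_congr rfl fun a _ => ?_
    have h4 : D.ell a α - D.ell a x = D.conormal a (α - x) := by
      rw [ell_eq, ell_eq, sub_sub_sub_cancel_right, map_sub]
    rw [h4, conormal_apply, Finset.sum_mul]
    exact Finset.sum_congr rfl fun j _ => by rw [PiLp.sub_apply]; ring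
  have h3 : ∀ j, (α j - x j) * pd j u x =
      (1 / 2) * ((α j - x j) * ∑ a, (D.normal a j : ℝ) * (Real.log (D.ell a x) + 1)) +
      (α j - x j) * pdWithin D.carrier j (smoothPart D u) x := by
    intro j; rw [pd_potential hu hx]; ring
  rw [h1, hux, Finset.sum_congr rfl fun j _ => h3 j, Finset.sum_add_distrib, ← Finset.mul_sum, h2,
    regularExponent]
  simp only [mul_add, mul_one, sub_mul, Finset.sum_add_distrib, Finset.sum_sub_distrib]
  ring

/-! ### Smoothness of Laplace transforms -/

lemma exp_sum_le {ι : Type*} [Fintype ι] (t : ι → ℝ) :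
    Real.exp (∑ j, t j) ≤ 1 + ∑ j, Real.exp (Fintype.card ι * t j) := by
  rcases isEmpty_or_nonempty ι with h | h
  · simp
  · obtain ⟨j, -, hj⟩ := Finset.exists_max_image Finset.univ t Finset.univ_nonempty
    have h1 : ∑ i, t i ≤ Fintype.card ι * t j := by
      have := Finset.sum_le_card_nsmul Finset.univ t (t j) hj
      simpa using this
    calc Real.exp (∑ j, t j) ≤ Real.exp (Fintype.card ι * t j) := Real.exp_le_exp.2 h1
      _ ≤ ∑ j, Real.exp (Fintype.card ι * t j) :=
        Finset.single_le_sum (f := fun j => Real.exp (Fintype.card ι * t j))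
          (fun i _ => (Real.exp_pos _).le) (Finset.mem_univ j)
      _ ≤ _ := by linarith

section laplace

variable {X : Type*} [MeasurableSpace X] {μ : Measure X} {g : Fin n → X → ℝ}

lemma norm_proj_le (j : Fin n) :
    ‖(EuclideanSpace.proj j : EuclideanSpace ℝ (Fin n) →L[ℝ] ℝ)‖ ≤ 1 :=
  ContinuousLinearMap.opNorm_le_bound _ zero_le_one fun x => by
    rw [one_mul]; exact PiLp.norm_apply_le x j

lemma sum_add_smul_single (α : EuclideanSpace ℝ (Fin n)) (s : ℝ) (j : Fin n) (y : Fin n → ℝ) :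
    ∑ i, (α + s • EuclideanSpace.single j (1 : ℝ)) i * y i = ∑ i, α i * y i + s * y j := by
  simp [add_mul, Finset.sum_add_distrib]

/-- An integrable majorant, locally uniform in `α`, for the integrand of the derivative of a Laplace
transform. -/
lemma exists_laplace_bound {U : Set (EuclideanSpace ℝ (Fin n))} (hU : IsOpen U) {w : X → ℝ}
    (hw : ∀ α ∈ U, Integrable (fun x => w x * Real.exp (∑ j, α j * g j x)) μ)
    {α₀ : EuclideanSpace ℝ (Fin n)} (hα₀ : α₀ ∈ U) :
    ∃ (r : ℝ) (b : X → ℝ), 0 < r ∧ Metric.ball α₀ r ⊆ U ∧ Integrable b μ ∧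
      ∀ α ∈ Metric.ball α₀ r, ∀ j x, |w x * g j x * Real.exp (∑ j, α j * g j x)| ≤ b x := by
  obtain ⟨s, hs, hsU⟩ := Metric.isOpen_iff.1 hU α₀ hα₀
  set r : ℝ := s / (2 * (n + 1)) with hr
  have hr0 : 0 < r := by positivity
  have hrs : r ≤ s := by
    rw [hr]; apply div_le_self hs.le
    have : (0 : ℝ) ≤ n := Nat.cast_nonneg n
    linarith
  set c : ℝ := n * (2 * r) with hc
  have hc0 : 0 ≤ c := by positivity
  have hcs : c < s := by
    have : c * (n + 1) = n * s := by rw [hc, hr]; field_simp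
    have hn : (0 : ℝ) ≤ n := Nat.cast_nonneg n
    by_contra hcon
    push Not at hcon
    nlinarith
  have hint : ∀ j, ∀ ε : ℝ, |ε| = 1 →
      Integrable (fun x => w x * (Real.exp (∑ j, α₀ j * g j x) * Real.exp (ε * c * g j x))) μ := by
    intro j ε hε
    have hmem : α₀ + (ε * c) • EuclideanSpace.single j (1 : ℝ) ∈ U := by
      apply hsU
      rw [Metric.mem_ball, dist_eq_norm, add_sub_cancel_left, norm_smul]
      simp only [PiLp.norm_single, Real.norm_eq_abs, abs_mul, hε, abs_one, mul_one, one_mul]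
      rwa [abs_of_nonneg hc0]
    refine (hw _ hmem).congr (Filter.Eventually.of_forall fun x => ?_)
    simp only [sum_add_smul_single α₀ _ j (fun i => g i x), Real.exp_add]
  refine ⟨r, fun x => r⁻¹ * (|w x * Real.exp (∑ j, α₀ j * g j x)| + ∑ j,
      (|w x * (Real.exp (∑ j, α₀ j * g j x) * Real.exp (1 * c * g j x))| +
       |w x * (Real.exp (∑ j, α₀ j * g j x) * Real.exp (-1 * c * g j x))|)), hr0,
    (Metric.ball_subset_ball hrs).trans hsU, ?_, fun α hα j x => ?_⟩
  · refine Integrable.const_mul ((hw α₀ hα₀).abs.add (integrable_finsetSum _ fun j _ => ?_)) _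
    exact (hint j 1 (by simp)).abs.add (hint j (-1) (by simp)).abs
  · set e := Real.exp (∑ j, α₀ j * g j x) with he
    have hdiff : ∀ i, |α i - α₀ i| ≤ r := fun i => by
      have := PiLp.norm_apply_le (α - α₀) i
      rw [← dist_eq_norm] at this
      exact this.trans (Metric.mem_ball.1 hα).le
    have h1 : Real.exp (∑ j, α j * g j x) ≤ e * Real.exp (∑ i, r * |g i x|) := by
      rw [he, ← Real.exp_add, Real.exp_le_exp, ← Finset.sum_add_distrib]
      refine Finset.sum_le_sum fun i _ => ?_
      have h2 : (α i - α₀ i) * g i x ≤ r * |g i x| :=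
        (le_abs_self _).trans (by rw [abs_mul]; gcongr; exact hdiff i)
      linarith
    have h3 : |g j x| ≤ r⁻¹ * Real.exp (∑ i, r * |g i x|) := by
      rw [inv_mul_eq_div, le_div_iff₀ hr0]
      have h4 : r * |g j x| ≤ ∑ i, r * |g i x| :=
        Finset.single_le_sum (f := fun i => r * |g i x|) (fun i _ => by positivity)
          (Finset.mem_univ j)
      have h5 := Real.add_one_le_exp (∑ i, r * |g i x|)
      linarith
    have h6 : Real.exp (∑ i, r * |g i x|) * Real.exp (∑ i, r * |g i x|) ≤
        1 + ∑ i, (Real.exp (1 * c * g i x) + Real.exp (-1 * c * g i x)) := by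
      rw [← Real.exp_add, ← Finset.sum_add_distrib]
      refine (exp_sum_le _).trans ?_
      gcongr with i
      have h7 : (Fintype.card (Fin n) : ℝ) * (r * |g i x| + r * |g i x|) = c * |g i x| := by
        rw [hc, Fintype.card_fin]; ring
      rw [h7]
      rcases abs_cases (g i x) with ⟨h, -⟩ | ⟨h, -⟩ <;> rw [h]
      · have := Real.exp_pos (-1 * c * g i x)
        have h8 : Real.exp (c * g i x) = Real.exp (1 * c * g i x) := by rw [one_mul]
        linarith
      · have := Real.exp_pos (1 * c * g i x)
        have h8 : Real.exp (c * -g i x) = Real.exp (-1 * c * g i x) := by congr 1; ring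
        linarith
    have he0 : 0 < e := Real.exp_pos _
    have hE := Real.exp_pos (∑ i, r * |g i x|)
    rw [abs_mul, abs_mul, abs_of_pos (Real.exp_pos _)]
    calc |w x| * |g j x| * Real.exp (∑ j, α j * g j x)
        ≤ |w x| * (r⁻¹ * Real.exp (∑ i, r * |g i x|)) * (e * Real.exp (∑ i, r * |g i x|)) := by
          gcongr
      _ = r⁻¹ * (|w x| * e *
          (Real.exp (∑ i, r * |g i x|) * Real.exp (∑ i, r * |g i x|))) := by ring
      _ ≤ r⁻¹ * (|w x| * e *
          (1 + ∑ i, (Real.exp (1 * c * g i x) + Real.exp (-1 * c * g i x)))) := by gcongr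
      _ = _ := by
          simp only [← he, abs_mul, abs_of_pos he0, abs_of_pos (Real.exp_pos _), mul_add, mul_one,
            Finset.mul_sum, mul_assoc]

lemma laplace_hasFDerivAt (hg : ∀ j, AEStronglyMeasurable (g j) μ)
    {U : Set (EuclideanSpace ℝ (Fin n))} (hU : IsOpen U) {w : X → ℝ}
    (hwm : AEStronglyMeasurable w μ)
    (hw : ∀ α ∈ U, Integrable (fun x => w x * Real.exp (∑ j, α j * g j x)) μ)
    {α₀ : EuclideanSpace ℝ (Fin n)} (hα₀ : α₀ ∈ U) :
    (∀ j, Integrable (fun x => w x * g j x * Real.exp (∑ j, α₀ j * g j x)) μ) ∧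
    HasFDerivAt (fun α : EuclideanSpace ℝ (Fin n) => ∫ x, w x * Real.exp (∑ j, α j * g j x) ∂μ)
      (∑ j, (∫ x, w x * g j x * Real.exp (∑ j, α₀ j * g j x) ∂μ) •
        (EuclideanSpace.proj j : EuclideanSpace ℝ (Fin n) →L[ℝ] ℝ)) α₀ := by
  obtain ⟨r, b, hr, hrU, hb, hbound⟩ := exists_laplace_bound hU hw hα₀
  have hexp : ∀ α : EuclideanSpace ℝ (Fin n),
      AEStronglyMeasurable (fun x => Real.exp (∑ j, α j * g j x)) μ := fun α =>
    Real.continuous_exp.comp_aestronglyMeasurable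
      (Finset.aestronglyMeasurable_fun_sum _ fun j _ => (hg j).const_mul _)
  have hm : ∀ j, AEStronglyMeasurable (fun x => w x * g j x * Real.exp (∑ j, α₀ j * g j x)) μ :=
    fun j => (hwm.mul (hg j)).mul (hexp α₀)
  have hI : ∀ j, Integrable (fun x => w x * g j x * Real.exp (∑ j, α₀ j * g j x)) μ := fun j =>
    hb.mono' (hm j) (Filter.Eventually.of_forall fun x =>
      hbound α₀ (Metric.mem_ball_self hr) j x)
  refine ⟨hI, ?_⟩
  have key := hasFDerivAt_integral_of_dominated_of_fderiv_le (𝕜 := ℝ) (μ := μ)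
    (F := fun (α : EuclideanSpace ℝ (Fin n)) x => w x * Real.exp (∑ j, α j * g j x))
    (F' := fun (α : EuclideanSpace ℝ (Fin n)) x =>
      ∑ j, (w x * g j x * Real.exp (∑ j, α j * g j x)) •
        (EuclideanSpace.proj j : EuclideanSpace ℝ (Fin n) →L[ℝ] ℝ))
    (x₀ := α₀) (bound := fun x => n * b x) (Metric.ball_mem_nhds α₀ hr)
    (Filter.Eventually.of_forall fun α => hwm.mul (hexp α)) (hw α₀ hα₀)
    (Finset.aestronglyMeasurable_fun_sum _ fun j _ => (hm j).smul_const _)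
    (Filter.Eventually.of_forall fun x α hα => ?_) (hb.const_mul _)
    (Filter.Eventually.of_forall fun x α hα => ?_)
  · rw [integral_finsetSum _ fun j _ => (hI j).smul_const _] at key
    simpa only [integral_smul_const] using key
  · refine (norm_sum_le _ _).trans ((Finset.sum_le_card_nsmul _ _ (b x) fun j _ => ?_).trans ?_)
    · rw [norm_smul]
      exact (mul_le_of_le_one_right (norm_nonneg _) (norm_proj_le j)).trans (hbound α hα j x)
    · simp
  · have h1 : HasFDerivAt (fun α : EuclideanSpace ℝ (Fin n) => ∑ j, α j * g j x)
        (∑ j, g j x • (EuclideanSpace.proj j : EuclideanSpace ℝ (Fin n) →L[ℝ] ℝ)) α :=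
      HasFDerivAt.fun_sum fun j _ =>
        (EuclideanSpace.proj j : EuclideanSpace ℝ (Fin n) →L[ℝ] ℝ).hasFDerivAt.mul_const _
    refine (h1.exp.const_mul (w x)).congr_fderiv ?_
    rw [Finset.smul_sum, Finset.smul_sum]
    refine Finset.sum_congr rfl fun j _ => ?_
    rw [smul_smul, smul_smul]
    congr 1; ring

/-- A Laplace transform is smooth in the interior of its domain of convergence. -/
lemma contDiffOn_laplace (hg : ∀ j, AEStronglyMeasurable (g j) μ)
    {U : Set (EuclideanSpace ℝ (Fin n))} (hU : IsOpen U) {w : X → ℝ}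
    (hwm : AEStronglyMeasurable w μ)
    (hw : ∀ α ∈ U, Integrable (fun x => w x * Real.exp (∑ j, α j * g j x)) μ) :
    ContDiffOn ℝ ∞
      (fun α : EuclideanSpace ℝ (Fin n) => ∫ x, w x * Real.exp (∑ j, α j * g j x) ∂μ) U := by
  rw [contDiffOn_infty]
  intro N
  induction N generalizing w with
  | zero =>
    exact contDiffOn_zero.2 fun α hα =>
      (laplace_hasFDerivAt hg hU hwm hw hα).2.continuousAt.continuousWithinAt
  | succ N ih =>
    push_cast
    rw [contDiffOn_succ_iff_fderiv_of_isOpen hU]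
    refine ⟨fun α hα =>
      (laplace_hasFDerivAt hg hU hwm hw hα).2.differentiableAt.differentiableWithinAt, by simp, ?_⟩
    refine ContDiffOn.congr ?_ fun α hα => (laplace_hasFDerivAt hg hU hwm hw hα).2.fderiv
    refine ContDiffOn.sum fun j _ => ContDiffOn.fun_smul ?_ contDiffOn_const
    exact ih (hwm.mul (hg j)) fun α hα => (laplace_hasFDerivAt hg hU hwm hw hα).1 j

end laplace

/-! ### Integrability of the weights -/

/-- The inverse square root of an affine function is integrable on bounded sets. -/
lemma integrableOn_affine_rpow {L : EuclideanSpace ℝ (Fin n) →L[ℝ] ℝ} (hL : L ≠ 0) (c : ℝ)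
    {B : Set (EuclideanSpace ℝ (Fin n))} (hB : Bornology.IsBounded B) (hBm : MeasurableSet B) :
    IntegrableOn (fun x => (L x - c) ^ (-(1 / 2) : ℝ)) B := by
  obtain ⟨i, hi⟩ : ∃ i, L (EuclideanSpace.single i 1) ≠ 0 := by
    by_contra h
    push Not at h
    apply hL
    ext x
    have hx : x = ∑ i, x i • EuclideanSpace.single i (1 : ℝ) := by
      ext j
      simp [Pi.single_apply]
    rw [hx]
    simp [h]
  -- linear coordinates on the space of which `L` is the `i`-th
  let T₀ : EuclideanSpace ℝ (Fin n) →ₗ[ℝ] (Fin n → ℝ) :=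
    LinearMap.pi fun j => if j = i then (L : EuclideanSpace ℝ (Fin n) →ₗ[ℝ] ℝ) else
      ((EuclideanSpace.proj j : EuclideanSpace ℝ (Fin n) →L[ℝ] ℝ) :
        EuclideanSpace ℝ (Fin n) →ₗ[ℝ] ℝ)
  have hT₀i : ∀ x, T₀ x i = L x := fun x => by simp [T₀]
  have hT₀j : ∀ x j, j ≠ i → T₀ x j = x j := fun x j hj => by simp [T₀, hj]
  have hinj : Function.Injective T₀ := by
    rw [injective_iff_map_eq_zero]
    intro x hx
    have hxj : ∀ j, j ≠ i → x j = 0 := fun j hj => by rw [← hT₀j x j hj, hx]; rfl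
    have hxs : x = x i • EuclideanSpace.single i (1 : ℝ) := by
      ext j
      by_cases hj : j = i
      · subst hj; simp
      · simp [hj, hxj j hj]
    have hxi : L x = 0 := by rw [← hT₀i, hx]; rfl
    rw [hxs, map_smul, smul_eq_mul] at hxi
    rw [hxs, (mul_eq_zero.1 hxi).resolve_right hi, zero_smul]
  let T : EuclideanSpace ℝ (Fin n) ≃L[ℝ] (Fin n → ℝ) :=
    (LinearEquiv.ofInjectiveOfFinrankEq T₀ hinj (by simp)).toContinuousLinearEquiv
  have hT : ∀ x, T x = T₀ x := fun x => rfl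
  obtain ⟨M, hM0, hM⟩ : ∃ M : ℝ, 0 ≤ M ∧ ∀ x ∈ B, ∀ j, T x j ∈ Icc (-M) M := by
    obtain ⟨M, hM0, hM⟩ := (T.lipschitz.isBounded_image hB).exists_pos_norm_le
    exact ⟨M, hM0.le, fun x hx j =>
      abs_le.1 ((norm_le_pi_norm (T x) j).trans (hM _ ⟨x, hx, rfl⟩))⟩
  let q : Fin n → ℝ → ℝ := fun j => (Icc (-M) M).indicator
    fun t => if j = i then (t - c) ^ (-(1 / 2) : ℝ) else 1
  have hq : ∀ j, Integrable (q j) := by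
    intro j
    rw [integrable_indicator_iff measurableSet_Icc]
    by_cases hj : j = i
    · simp only [hj, if_true]
      have h1 : IntervalIntegrable (fun t : ℝ => (t - c) ^ (-(1 / 2) : ℝ)) volume (-M) M := by
        have := (intervalIntegral.intervalIntegrable_rpow' (r := -(1 / 2)) (by norm_num)
          (a := -M - c) (b := M - c)).comp_sub_right c
        simpa using this
      exact (intervalIntegrable_iff_integrableOn_Icc_of_le (by linarith)).1 h1
    · simp only [hj, if_false]
      exact integrableOn_const (by simp)
  have hQ : Integrable (fun y : Fin n → ℝ => ∏ j, q j (y j)) (volume.map T) := by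
    have h := Integrable.fintype_prod (μ := fun _ : Fin n => (volume : Measure ℝ)) hq
    have : (volume : Measure (EuclideanSpace ℝ (Fin n))).map T =
        Measure.addHaarScalarFactor (volume.map T) (Measure.pi fun _ : Fin n => volume) •
          (Measure.pi fun _ : Fin n => (volume : Measure ℝ)) :=
      Measure.isAddLeftInvariant_eq_smul _ _
    rw [this]
    exact h.smul_measure_nnreal
  have hQ' := hQ.comp_measurable T.continuous.measurable
  refine (hQ'.integrableOn (s := B)).congr_fun (fun x hx => ?_) hBm
  have h1 : ∀ j, q j (T x j) = if j = i then (L x - c) ^ (-(1 / 2) : ℝ) else 1 := by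
    intro j
    simp only [q, indicator_of_mem (hM x hx j)]
    by_cases hj : j = i
    · subst hj; simp [hT, hT₀i]
    · simp [hj]
  simp only [Function.comp, h1]
  simp

/-- A neighbourhood of the polytope for whose elements `α` the weights are integrable: up to a
bounded factor the weight is `∏ ℓ_a ^ (k ℓ_a(α))`, and the exponents exceed `-1/(2d)`. -/
def convergenceDomain (D : DelzantPolytope n) (k : ℕ) : Set (EuclideanSpace ℝ (Fin n)) :=
  {α | ∀ a, -(1 / (2 * (D.d : ℝ))) < (k : ℝ) * D.ell a α}

lemma isOpen_convergenceDomain (D : DelzantPolytope n) (k : ℕ) :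
    IsOpen (convergenceDomain D k) := by
  have : convergenceDomain D k =
      ⋂ a, {α | -(1 / (2 * (D.d : ℝ))) < (k : ℝ) * D.ell a α} := by
    ext; simp [convergenceDomain]
  rw [this]
  exact isOpen_iInter_of_finite fun a =>
    isOpen_lt continuous_const (continuous_const.mul (continuous_ell D a))

lemma carrier_subset_convergenceDomain (D : DelzantPolytope n) (k : ℕ) :
    D.carrier ⊆ convergenceDomain D k := by
  intro α hα a
  have h1 : 0 ≤ (k : ℝ) * D.ell a α := mul_nonneg (Nat.cast_nonneg k) (hα a)
  have h2 : (0 : ℝ) < D.d := Nat.cast_pos.2 a.pos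
  have h3 : 0 < 1 / (2 * (D.d : ℝ)) := by positivity
  linarith

lemma contDiffOn_legendre {D : DelzantPolytope n} {u : EuclideanSpace ℝ (Fin n) → ℝ}
    (hu : IsSymplecticPotential D u) : ContDiffOn ℝ ∞ (legendre u) (interior D.carrier) := by
  refine ContDiffOn.sub (ContDiffOn.sum fun j _ => ContDiffOn.mul ?_
    (contDiffOn_pd isOpen_interior hu.smooth_interior j)) hu.smooth_interior
  exact (EuclideanSpace.proj j : EuclideanSpace ℝ (Fin n) →L[ℝ] ℝ).contDiff.contDiffOn

lemma contDiffOn_weight {D : DelzantPolytope n} {u : EuclideanSpace ℝ (Fin n) → ℝ}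
    (hu : IsSymplecticPotential D u) (k : ℕ) (α : EuclideanSpace ℝ (Fin n)) :
    ContDiffOn ℝ ∞ (weight u k α) (interior D.carrier) := by
  refine ContDiffOn.exp (contDiffOn_const.mul (ContDiffOn.sub (ContDiffOn.sum fun j _ => ?_)
    (contDiffOn_legendre hu)))
  exact contDiffOn_const.mul (contDiffOn_pd isOpen_interior hu.smooth_interior j)

lemma exists_bound_regularExponent {D : DelzantPolytope n} {u : EuclideanSpace ℝ (Fin n) → ℝ}
    (hu : IsSymplecticPotential D u) (α : EuclideanSpace ℝ (Fin n)) :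
    ∃ C, ∀ x ∈ D.carrier, |regularExponent D u α x| ≤ C :=
  (isCompact_carrier D).exists_bound_of_continuousOn (continuousOn_regularExponent hu α)

lemma exists_bound_ell (D : DelzantPolytope n) :
    ∃ M, 1 ≤ M ∧ ∀ x ∈ D.carrier, ∀ a, D.ell a x ≤ M := by
  choose C hC using fun a => (isCompact_carrier D).exists_bound_of_continuousOn
    (continuous_ell D a).continuousOn
  refine ⟨1 + ∑ a, |C a|, ?_, fun x hx a => ?_⟩
  · have : 0 ≤ ∑ a, |C a| := Finset.sum_nonneg fun a _ => abs_nonneg _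
    linarith
  · have h1 := Finset.single_le_sum (f := fun a => |C a|) (fun a _ => abs_nonneg _)
      (Finset.mem_univ a)
    have h2 := (le_abs_self _).trans ((hC a x hx).trans (le_abs_self _))
    linarith

/-- The weight is dominated by `∏ ℓ_a ^ (-1/(2d))`, a product of `d` factors, and hence by
`1 + ∑ ℓ_a ^ (-1/2)`. -/
lemma integrableOn_weight {D : DelzantPolytope n} {u : EuclideanSpace ℝ (Fin n) → ℝ}
    (hu : IsSymplecticPotential D u) {k : ℕ} {α : EuclideanSpace ℝ (Fin n)}
    (hα : α ∈ convergenceDomain D k) : IntegrableOn (weight u k α) (interior D.carrier) := by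
  obtain ⟨C, hC⟩ := exists_bound_regularExponent hu α
  obtain ⟨M, hM1, hM⟩ := exists_bound_ell D
  set r : ℝ := 1 / (2 * (D.d : ℝ)) with hr
  set K : ℝ := 2 * k * C + ∑ a, (k * D.ell a α + r) * Real.log M with hK
  have hint : IntegrableOn (fun x => Real.exp K *
      (1 + ∑ a, (D.conormal a x - D.offset a) ^ (-(1 / 2) : ℝ))) (interior D.carrier) := by
    have hbd : Bornology.IsBounded (interior D.carrier) :=
      (isCompact_carrier D).isBounded.subset interior_subset
    refine Integrable.const_mul (Integrable.add ?_ (integrable_finsetSum _ fun a _ => ?_)) _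
    · exact integrableOn_const (hbd.measure_lt_top.ne)
    · exact integrableOn_affine_rpow (conormal_ne_zero D a) _ hbd isOpen_interior.measurableSet
  refine hint.mono' ((contDiffOn_weight hu k α).continuousOn.aestronglyMeasurable
    isOpen_interior.measurableSet) ?_
  refine (ae_restrict_iff' isOpen_interior.measurableSet).2 (Filter.Eventually.of_forall ?_)
  intro x hx
  have hpos := (mem_interior_carrier D).1 hx
  rw [Real.norm_of_nonneg (weight_pos u k α x).le, weight, exponent_eq hu α hx]
  have h1 : 2 * (k : ℝ) * ((1 / 2) * ∑ a, D.ell a α * Real.log (D.ell a x) +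
      regularExponent D u α x) ≤ K + ∑ a, -r * Real.log (D.ell a x) := by
    have h2 : ∀ a, k * D.ell a α * Real.log (D.ell a x) ≤
        (k * D.ell a α + r) * Real.log M + -r * Real.log (D.ell a x) := by
      intro a
      have h3 : 0 ≤ k * D.ell a α + r := by have := hα a; rw [← hr] at this; linarith
      have h4 := mul_le_mul_of_nonneg_left
        (Real.log_le_log (hpos a) (hM x (interior_subset hx) a)) h3
      linarith
    have h5 := Finset.sum_le_sum fun a (_ : a ∈ Finset.univ) => h2 a
    rw [Finset.sum_add_distrib] at h5
    have h6 := mul_le_mul_of_nonneg_left ((le_abs_self _).trans (hC x (interior_subset hx)))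
      (by positivity : 0 ≤ 2 * (k : ℝ))
    have h7 : 2 * (k : ℝ) * ((1 / 2) * ∑ a, D.ell a α * Real.log (D.ell a x)) =
        ∑ a, k * D.ell a α * Real.log (D.ell a x) := by
      rw [← mul_assoc, Finset.mul_sum]
      exact Finset.sum_congr rfl fun a _ => by ring
    rw [mul_add, h7, hK]
    linarith
  refine (Real.exp_le_exp.2 h1).trans ?_
  rw [Real.exp_add]
  refine mul_le_mul_of_nonneg_left ((exp_sum_le _).trans ?_) (Real.exp_pos _).le
  gcongr with a
  rw [← ell_eq, Real.rpow_def_of_pos (hpos a), Real.exp_le_exp, Fintype.card_fin, hr]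
  have hd : (D.d : ℝ) ≠ 0 := Nat.cast_ne_zero.2 a.pos.ne'
  apply le_of_eq
  field_simp

lemma integrableOn_weight_mul {D : DelzantPolytope n} {u : EuclideanSpace ℝ (Fin n) → ℝ}
    (hu : IsSymplecticPotential D u) {k : ℕ} {α : EuclideanSpace ℝ (Fin n)}
    (hα : α ∈ convergenceDomain D k) {f : EuclideanSpace ℝ (Fin n) → ℝ}
    (hf : ContDiffOn ℝ ∞ f D.carrier) :
    IntegrableOn (fun x => weight u k α x * f x) (interior D.carrier) := by
  obtain ⟨C, -, hC⟩ := exists_bound_of_contDiffOn D hf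
  refine (integrableOn_weight hu hα).mul_bdd (c := C)
    ((hf.mono interior_subset).continuousOn.aestronglyMeasurable isOpen_interior.measurableSet) ?_
  refine (ae_restrict_iff' isOpen_interior.measurableSet).2 (Filter.Eventually.of_forall ?_)
  exact fun x hx => hC x (interior_subset hx)

lemma integral_weight_pos {D : DelzantPolytope n} {u : EuclideanSpace ℝ (Fin n) → ℝ}
    (hu : IsSymplecticPotential D u) {k : ℕ} {α : EuclideanSpace ℝ (Fin n)}
    (hα : α ∈ convergenceDomain D k) : 0 < ∫ x in interior D.carrier, weight u k α x := by
  rw [setIntegral_pos_iff_support_of_nonneg_ae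
    (Filter.Eventually.of_forall fun x => (weight_pos u k α x).le) (integrableOn_weight hu hα)]
  have : Function.support (weight u k α) = univ :=
    eq_univ_of_forall fun x => (weight_pos u k α x).ne'
  rw [this, univ_inter]
  exact isOpen_interior.measure_pos _ (interior_nonempty D)

lemma contDiffOn_integral_weight {D : DelzantPolytope n} {u : EuclideanSpace ℝ (Fin n) → ℝ}
    (hu : IsSymplecticPotential D u) (k : ℕ) {f : EuclideanSpace ℝ (Fin n) → ℝ}
    (hf : ContDiffOn ℝ ∞ f D.carrier) :
    ContDiffOn ℝ ∞ (fun α => ∫ x in interior D.carrier, weight u k α x * f x)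
      (convergenceDomain D k) := by
  have hw : ∀ α x, weight u k α x * f x =
      (f x * Real.exp (-(2 * (k : ℝ) * legendre u x))) *
        Real.exp (∑ j, α j * (2 * (k : ℝ) * pd j u x)) := by
    intro α x
    rw [mul_assoc, ← Real.exp_add, mul_comm, weight]
    congr 2
    rw [mul_sub, Finset.mul_sum, sub_eq_neg_add]
    congr 1
    exact Finset.sum_congr rfl fun j _ => by ring
  simp only [hw]
  have hfc : ContinuousOn f (interior D.carrier) := hf.continuousOn.mono interior_subset
  refine contDiffOn_laplace (g := fun j x => 2 * (k : ℝ) * pd j u x) (fun j => ?_)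
    (isOpen_convergenceDomain D k) ?_ fun α hα => ?_
  · exact (continuousOn_const.mul (contDiffOn_pd isOpen_interior
      hu.smooth_interior j).continuousOn).aestronglyMeasurable isOpen_interior.measurableSet
  · refine ContinuousOn.aestronglyMeasurable ?_ isOpen_interior.measurableSet
    exact hfc.mul (Real.continuous_exp.comp_continuousOn
      (continuousOn_const.mul (contDiffOn_legendre hu).continuousOn).neg)
  · simp only [← hw]
    exact integrableOn_weight_mul hu hα hf

lemma contDiffOn_pairing {D : DelzantPolytope n} {u : EuclideanSpace ℝ (Fin n) → ℝ}
    (hu : IsSymplecticPotential D u) (k : ℕ) {f : EuclideanSpace ℝ (Fin n) → ℝ}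
    (hf : ContDiffOn ℝ ∞ f D.carrier) :
    ContDiffOn ℝ ∞ (fun α => pairing D u k α f) D.carrier := by
  simp only [pairing_eq]
  have h1 := contDiffOn_integral_weight hu k (f := fun _ => (1 : ℝ)) contDiffOn_const
  simp only [mul_one] at h1
  refine (ContDiffOn.div (contDiffOn_integral_weight hu k hf) h1 fun α hα => ?_).mono
    (carrier_subset_convergenceDomain D k)
  exact (integral_weight_pos hu hα).ne'

/-! ### Integration by parts -/

lemma integral_pd_eq_zero {Y : EuclideanSpace ℝ (Fin n) → ℝ} (hY : ContDiff ℝ ∞ Y)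
    (hc : HasCompactSupport Y) (j : Fin n) :
    Integrable (pd j Y) ∧ ∫ x, pd j Y x = 0 := by
  have h1 : Integrable (pd j Y) := by
    refine Continuous.integrable_of_hasCompactSupport ?_ (hc.fderiv_apply (𝕜 := ℝ) _)
    exact (hY.continuous_fderiv (by simp)).clm_apply continuous_const
  have h2 : Integrable Y := hY.continuous.integrable_of_hasCompactSupport hc
  refine ⟨h1, ?_⟩
  have := integral_mul_fderiv_eq_neg_fderiv_mul_of_integrable (μ := volume) (f := Y)
    (g := fun _ => (1 : ℝ)) (v := EuclideanSpace.single j (1 : ℝ))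
    (by simp only [mul_one]; exact h1) (by simp) (by simpa using h2)
    (fun x _ => hY.differentiable (by simp) x) (fun x _ => differentiableAt_const _)
  simp only [mul_one, fderiv_fun_const] at this
  simpa [pd] using this

/-- The divergence theorem for the vector field `F(ρ) X`, where `F` vanishes below a positive
level and the superlevel sets of `ρ` are compact. -/
lemma integral_cutoff_divergence {I : Set (EuclideanSpace ℝ (Fin n))} (hI : IsOpen I)
    (hIb : Bornology.IsBounded I) {ρ c : EuclideanSpace ℝ (Fin n) → ℝ}
    (hρ : ContDiffOn ℝ ∞ ρ I) {X : Fin n → EuclideanSpace ℝ (Fin n) → ℝ}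
    (hX : ∀ j, ContDiffOn ℝ ∞ (X j) I)
    (hρX : ∀ x ∈ I, ∑ j, X j x * pd j ρ x = ρ x * c x)
    {F : ℝ → ℝ} (hF : ContDiff ℝ ∞ F) {ε : ℝ} (hFε : ∀ s, s < ε → F s = 0)
    (hK : IsClosed {x | x ∈ I ∧ ε ≤ ρ x}) :
    ∫ x in I, (deriv F (ρ x) * ρ x * c x + F (ρ x) * ∑ j, pd j (X j) x) = 0 := by
  set K := {x | x ∈ I ∧ ε ≤ ρ x} with hKdef
  have hKc : IsCompact K := Metric.isCompact_of_isClosed_isBounded hK (hIb.subset fun x hx => hx.1)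
  let Y : Fin n → EuclideanSpace ℝ (Fin n) → ℝ := fun j => I.indicator fun x => F (ρ x) * X j x
  have hYK : ∀ j x, x ∉ K → Y j x = 0 := by
    intro j x hx
    by_cases hxI : x ∈ I
    · have : ρ x < ε := by
        by_contra h
        exact hx ⟨hxI, not_lt.1 h⟩
      simp [Y, hxI, hFε _ this]
    · simp [Y, hxI]
  have hYev : ∀ j, ∀ x ∈ I, Y j =ᶠ[𝓝 x] fun x => F (ρ x) * X j x := by
    intro j x hx
    filter_upwards [hI.mem_nhds hx] with y hy
    simp [Y, hy]
  have hFX : ∀ j, ∀ x ∈ I, ContDiffAt ℝ ∞ (fun x => F (ρ x) * X j x) x := fun j x hx =>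
    (hF.contDiffAt.comp x (hρ.contDiffAt (hI.mem_nhds hx))).mul ((hX j).contDiffAt (hI.mem_nhds hx))
  have hYs : ∀ j, ContDiff ℝ ∞ (Y j) := by
    intro j
    rw [contDiff_iff_contDiffAt]
    intro x
    by_cases hx : x ∈ I
    · exact (hFX j x hx).congr_of_eventuallyEq (hYev j x hx)
    · have hxK : x ∈ Kᶜ := fun h => hx h.1
      refine contDiffAt_const (c := (0 : ℝ)) |>.congr_of_eventuallyEq ?_
      filter_upwards [hK.isOpen_compl.mem_nhds hxK] with y hy using hYK j y hy
  have hYc : ∀ j, HasCompactSupport (Y j) := fun j =>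
    HasCompactSupport.intro hKc fun x hx => hYK j x hx
  have hdiv : ∀ x, I.indicator (fun x => deriv F (ρ x) * ρ x * c x +
      F (ρ x) * ∑ j, pd j (X j) x) x = ∑ j, pd j (Y j) x := by
    intro x
    by_cases hx : x ∈ I
    · rw [indicator_of_mem hx, mul_assoc, ← hρX x hx, Finset.mul_sum, Finset.mul_sum,
        ← Finset.sum_add_distrib]
      refine Finset.sum_congr rfl fun j _ => ?_
      have hρd : DifferentiableAt ℝ ρ x :=
        (hρ.contDiffAt (hI.mem_nhds hx)).differentiableAt (by simp)
      have hXd : DifferentiableAt ℝ (X j) x :=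
        ((hX j).contDiffAt (hI.mem_nhds hx)).differentiableAt (by simp)
      have hFd : DifferentiableAt ℝ F (ρ x) := hF.differentiable (by simp) _
      have h1 : HasFDerivAt (fun y => F (ρ y)) (deriv F (ρ x) • fderiv ℝ ρ x) x :=
        hFd.hasDerivAt.comp_hasFDerivAt x hρd.hasFDerivAt
      rw [pd_congr (hYev j x hx), pd_mul h1.differentiableAt hXd, pd_eq_of_hasFDerivAt h1]
      simp only [pd, _root_.smul_apply, smul_eq_mul]
      ring
    · rw [indicator_of_notMem hx, Finset.sum_eq_zero]
      intro j _
      have hxK : x ∈ Kᶜ := fun h => hx h.1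
      have : Y j =ᶠ[𝓝 x] fun _ => (0 : ℝ) := by
        filter_upwards [hK.isOpen_compl.mem_nhds hxK] with y hy using hYK j y hy
      rw [pd_congr this, pd_const]
  rw [← integral_indicator hI.measurableSet]
  simp only [hdiv]
  rw [integral_finsetSum _ fun j _ => (integral_pd_eq_zero (hYs j) (hYc j) j).1]
  exact Finset.sum_eq_zero fun j _ => (integral_pd_eq_zero (hYs j) (hYc j) j).2

lemma deriv_smoothTransition_eq_zero {t : ℝ} (ht : t < 0 ∨ 1 < t) :
    deriv Real.smoothTransition t = 0 := by
  rcases ht with ht | ht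
  · have : Real.smoothTransition =ᶠ[𝓝 t] fun _ => (0 : ℝ) := by
      filter_upwards [gt_mem_nhds ht] with s hs using Real.smoothTransition.zero_of_nonpos hs.le
    rw [this.deriv_eq, deriv_const]
  · have : Real.smoothTransition =ᶠ[𝓝 t] fun _ => (1 : ℝ) := by
      filter_upwards [lt_mem_nhds ht] with s hs using Real.smoothTransition.one_of_one_le hs.le
    rw [this.deriv_eq, deriv_const]

lemma exists_bound_deriv_smoothTransition :
    ∃ B, ∀ t : ℝ, |(t + 1) * deriv Real.smoothTransition t| ≤ B := by
  have hc : Continuous fun t : ℝ => (t + 1) * deriv Real.smoothTransition t :=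
    (continuous_id.add continuous_const).mul
      ((Real.smoothTransition.contDiff (n := 1)).continuous_deriv (by simp))
  obtain ⟨B, hB⟩ := (isCompact_Icc (a := (0 : ℝ)) (b := 1)).exists_bound_of_continuousOn
    hc.continuousOn
  refine ⟨B, fun t => ?_⟩
  by_cases ht : t ∈ Icc (0 : ℝ) 1
  · exact hB t ht
  · have h : t < 0 ∨ 1 < t := by
      by_contra h
      push Not at h
      exact ht h
    rw [deriv_smoothTransition_eq_zero h, mul_zero, abs_zero]
    exact (abs_nonneg _).trans (hB 0 (by simp))

/-- The divergence theorem for `ρ X` without boundary terms: the vector field `X` may be arbitrary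
at the boundary, as long as `X` is bounded with bounded divergence and the logarithmic derivative
`c` of `ρ` along `X` is bounded. -/
lemma integral_weighted_divergence {I : Set (EuclideanSpace ℝ (Fin n))} (hI : IsOpen I)
    (hIb : Bornology.IsBounded I) {ρ c : EuclideanSpace ℝ (Fin n) → ℝ}
    (hρ : ContDiffOn ℝ ∞ ρ I) (hρpos : ∀ x ∈ I, 0 < ρ x) {C₀ C₁ C₂ : ℝ} (hρb : ∀ x ∈ I, ρ x ≤ C₀)
    (hK : ∀ ε > 0, IsClosed {x | x ∈ I ∧ ε ≤ ρ x})
    {X : Fin n → EuclideanSpace ℝ (Fin n) → ℝ} (hX : ∀ j, ContDiffOn ℝ ∞ (X j) I)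
    (hρX : ∀ x ∈ I, ∑ j, X j x * pd j ρ x = ρ x * c x)
    (hc : ContinuousOn c I) (hcb : ∀ x ∈ I, |c x| ≤ C₁)
    (hdb : ∀ x ∈ I, |∑ j, pd j (X j) x| ≤ C₂) :
    ∫ x in I, ρ x * (c x + ∑ j, pd j (X j) x) = 0 := by
  obtain ⟨B, hB⟩ := exists_bound_deriv_smoothTransition
  -- `F m` vanishes on `s < 1 / (m + 1)` and tends to the identity
  let F : ℕ → ℝ → ℝ := fun m s => s * Real.smoothTransition ((m + 1) * s - 1)
  have hFd : ∀ m s, HasDerivAt (F m) (Real.smoothTransition ((m + 1) * s - 1) +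
      ((m + 1) * s - 1 + 1) * deriv Real.smoothTransition ((m + 1) * s - 1)) s := by
    intro m s
    have h1 : HasDerivAt (fun s : ℝ => ((m : ℝ) + 1) * s - 1) ((m : ℝ) + 1) s := by
      simpa using ((hasDerivAt_id s).const_mul ((m : ℝ) + 1)).sub_const 1
    have h2 := ((Real.smoothTransition.contDiff (n := 1)).differentiable (by simp)
      (((m : ℝ) + 1) * s - 1)).hasDerivAt.comp s h1
    refine ((hasDerivAt_id s).mul h2).congr_deriv ?_
    simp only [id, Function.comp]
    ring
  have hFs : ∀ m, ContDiff ℝ ∞ (F m) := fun m =>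
    contDiff_id.mul (Real.smoothTransition.contDiff.comp
      ((contDiff_const.mul contDiff_id).sub contDiff_const))
  have hF0 : ∀ (m : ℕ) s, s < 1 / ((m : ℝ) + 1) → F m s = 0 := by
    intro m s hs
    have hm : (0 : ℝ) < m + 1 := by positivity
    rw [lt_div_iff₀ hm] at hs
    simp only [F]
    rw [Real.smoothTransition.zero_of_nonpos (by linarith), mul_zero]
  have hzero : ∀ m, ∫ x in I, (deriv (F m) (ρ x) * ρ x * c x +
      F m (ρ x) * ∑ j, pd j (X j) x) = 0 := fun m =>
    integral_cutoff_divergence hI hIb hρ hX hρX (hFs m) (hF0 m) (hK _ (by positivity))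
  have hdivc : ContinuousOn (fun x => ∑ j, pd j (X j) x) I :=
    continuousOn_finsetSum _ fun j _ => (contDiffOn_pd hI (hX j) j).continuousOn
  have hlim : Filter.Tendsto (fun m : ℕ => ∫ x in I, (deriv (F m) (ρ x) * ρ x * c x +
      F m (ρ x) * ∑ j, pd j (X j) x)) Filter.atTop
      (𝓝 (∫ x in I, ρ x * (c x + ∑ j, pd j (X j) x))) := by
    refine tendsto_integral_of_dominated_convergence
      (fun _ => (1 + B) * C₀ * C₁ + C₀ * C₂) (fun m => ?_)
      (integrableOn_const hIb.measure_lt_top.ne) (fun m => ?_) ?_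
    · refine ContinuousOn.aestronglyMeasurable ?_ hI.measurableSet
      exact ((((hFs m).continuous_deriv (by simp)).comp_continuousOn hρ.continuousOn).mul
        hρ.continuousOn).mul hc |>.add
        (((hFs m).continuous.comp_continuousOn hρ.continuousOn).mul hdivc)
    · refine (ae_restrict_iff' hI.measurableSet).2 (Filter.Eventually.of_forall fun x hx => ?_)
      have hρ0 := hρpos x hx
      have hη0 := Real.smoothTransition.nonneg ((m + 1) * ρ x - 1)
      have hη1 := Real.smoothTransition.le_one ((m + 1) * ρ x - 1)
      have hB0 : 0 ≤ B := (abs_nonneg _).trans (hB 0)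
      have h1 : |deriv (F m) (ρ x)| ≤ 1 + B := by
        rw [(hFd m _).deriv]
        refine (abs_add_le _ _).trans (add_le_add ?_ (hB _))
        rwa [abs_of_nonneg hη0]
      have h2 : |F m (ρ x)| ≤ C₀ := by
        simp only [F]
        rw [abs_mul, abs_of_pos hρ0, abs_of_nonneg hη0]
        exact (mul_le_of_le_one_right hρ0.le hη1).trans (hρb x hx)
      have h3 : |ρ x| ≤ C₀ := by rw [abs_of_pos hρ0]; exact hρb x hx
      have hC0 : 0 ≤ C₀ := hρ0.le.trans (hρb x hx)
      rw [Real.norm_eq_abs]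
      refine (abs_add_le _ _).trans (add_le_add ?_ ?_)
      · rw [abs_mul, abs_mul]
        gcongr
        exact hcb x hx
      · rw [abs_mul]
        gcongr
        exact hdb x hx
    · refine (ae_restrict_iff' hI.measurableSet).2 (Filter.Eventually.of_forall fun x hx => ?_)
      refine tendsto_const_nhds.congr' ?_
      have hρ0 := hρpos x hx
      filter_upwards [Filter.eventually_gt_atTop (Nat.ceil (2 / ρ x))] with m hm
      have hm' : 2 / ρ x < m := (Nat.le_ceil _).trans_lt (by exact_mod_cast hm)
      rw [div_lt_iff₀ hρ0] at hm'
      have h1 : 1 < ((m : ℝ) + 1) * ρ x - 1 := by linarith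
      rw [(hFd m _).deriv, deriv_smoothTransition_eq_zero (Or.inr h1)]
      simp only [F]
      rw [Real.smoothTransition.one_of_one_le h1.le]
      ring
  simp only [hzero] at hlim
  exact (tendsto_nhds_unique hlim tendsto_const_nhds)

lemma pd_legendre {D : DelzantPolytope n} {u : EuclideanSpace ℝ (Fin n) → ℝ}
    (hu : IsSymplecticPotential D u) {x : EuclideanSpace ℝ (Fin n)} (hx : x ∈ interior D.carrier)
    (j : Fin n) : pd j (legendre u) x = ∑ l, x l * hess u x j l := by
  have hud : DifferentiableAt ℝ u x :=
    (hu.smooth_interior.contDiffAt (isOpen_interior.mem_nhds hx)).differentiableAt (by simp)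
  have hpd : ∀ l, HasFDerivAt (pd l u) (fderiv ℝ (pd l u) x) x := fun l =>
    ((contDiffOn_pd isOpen_interior hu.smooth_interior l).contDiffAt
      (isOpen_interior.mem_nhds hx)).differentiableAt (by simp) |>.hasFDerivAt
  have h : HasFDerivAt (legendre u) _ x :=
    (HasFDerivAt.fun_sum (u := Finset.univ) fun l _ =>
      ((EuclideanSpace.proj l : EuclideanSpace ℝ (Fin n) →L[ℝ] ℝ).hasFDerivAt (x := x)).fun_mul
        (hpd l)).fun_sub hud.hasFDerivAt
  rw [pd_eq_of_hasFDerivAt h]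
  simp [Finset.sum_add_distrib, hess, pd]

lemma pd_weight {D : DelzantPolytope n} {u : EuclideanSpace ℝ (Fin n) → ℝ}
    (hu : IsSymplecticPotential D u) (k : ℕ) (α : EuclideanSpace ℝ (Fin n))
    {x : EuclideanSpace ℝ (Fin n)} (hx : x ∈ interior D.carrier) (j : Fin n) :
    pd j (weight u k α) x = weight u k α x * (2 * k * ∑ l, (α l - x l) * hess u x j l) := by
  have hpd : ∀ l, HasFDerivAt (pd l u) (fderiv ℝ (pd l u) x) x := fun l =>
    ((contDiffOn_pd isOpen_interior hu.smooth_interior l).contDiffAt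
      (isOpen_interior.mem_nhds hx)).differentiableAt (by simp) |>.hasFDerivAt
  have hl : HasFDerivAt (legendre u) (fderiv ℝ (legendre u) x) x :=
    ((contDiffOn_legendre hu).contDiffAt
      (isOpen_interior.mem_nhds hx)).differentiableAt (by simp) |>.hasFDerivAt
  have h : HasFDerivAt (weight u k α) _ x :=
    (((HasFDerivAt.fun_sum (u := Finset.univ) fun l _ => (hpd l).const_mul (α l)).fun_sub
      hl).const_mul (2 * (k : ℝ))).exp
  rw [pd_eq_of_hasFDerivAt h]
  have h2 : fderiv ℝ (legendre u) x (EuclideanSpace.single j 1) = ∑ l, x l * hess u x j l :=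
    pd_legendre hu hx j
  simp only [_root_.smul_apply, _root_.sub_apply, _root_.sum_apply, smul_eq_mul, h2, weight,
    sub_mul, Finset.sum_sub_distrib]
  rfl

/-- An upper bound for the weight in terms of the distance to one facet. -/
lemma exists_weight_le {D : DelzantPolytope n} {u : EuclideanSpace ℝ (Fin n) → ℝ}
    (hu : IsSymplecticPotential D u) (k : ℕ) {α : EuclideanSpace ℝ (Fin n)}
    (hα : α ∈ D.carrier) : ∃ K : ℝ, ∀ x ∈ interior D.carrier, weight u k α x ≤ Real.exp K ∧
      ∀ a, weight u k α x ≤ Real.exp (k * D.ell a α * Real.log (D.ell a x) + K) := by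
  obtain ⟨C, hC⟩ := exists_bound_regularExponent hu α
  obtain ⟨M, hM1, hM⟩ := exists_bound_ell D
  have hk : (0 : ℝ) ≤ k := Nat.cast_nonneg k
  have hlogM : 0 ≤ Real.log M := Real.log_nonneg hM1
  refine ⟨2 * k * C + ∑ a, k * D.ell a α * Real.log M, fun x hx => ?_⟩
  have hpos := (mem_interior_carrier D).1 hx
  have hterm : ∀ a, k * D.ell a α * Real.log (D.ell a x) ≤ k * D.ell a α * Real.log M := fun a =>
    mul_le_mul_of_nonneg_left (Real.log_le_log (hpos a) (hM x (interior_subset hx) a))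
      (mul_nonneg hk (hα a))
  have hreg := mul_le_mul_of_nonneg_left ((le_abs_self _).trans (hC x (interior_subset hx)))
    (by positivity : 0 ≤ 2 * (k : ℝ))
  have hw : weight u k α x = Real.exp (∑ a, k * D.ell a α * Real.log (D.ell a x) +
      2 * k * regularExponent D u α x) := by
    rw [weight, exponent_eq hu α hx, mul_add, ← mul_assoc, Finset.mul_sum]
    congr 2
    exact Finset.sum_congr rfl fun a _ => by ring
  refine ⟨?_, fun a => ?_⟩
  · rw [hw, Real.exp_le_exp]
    have := Finset.sum_le_sum fun a (_ : a ∈ Finset.univ) => hterm a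
    linarith
  · rw [hw, Real.exp_le_exp, ← Finset.add_sum_erase _ _ (Finset.mem_univ a)]
    have h1 : ∑ b ∈ Finset.univ.erase a, k * D.ell b α * Real.log (D.ell b x) ≤
        ∑ b ∈ Finset.univ.erase a, k * D.ell b α * Real.log M :=
      Finset.sum_le_sum fun b _ => hterm b
    have h2 : ∑ b ∈ Finset.univ.erase a, k * D.ell b α * Real.log M ≤
        ∑ b, k * D.ell b α * Real.log M :=
      Finset.sum_le_sum_of_subset_of_nonneg (Finset.erase_subset _ _) fun b _ _ =>
        mul_nonneg (mul_nonneg hk (hα b)) hlogM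
    linarith

/-- For `α` in the interior the weight tends to zero at the boundary. -/
lemma isClosed_superlevel_weight {D : DelzantPolytope n} {u : EuclideanSpace ℝ (Fin n) → ℝ}
    (hu : IsSymplecticPotential D u) {k : ℕ} (hk : 1 ≤ k) {α : EuclideanSpace ℝ (Fin n)}
    (hα : α ∈ interior D.carrier) {ε : ℝ} (hε : 0 < ε) :
    IsClosed {x | x ∈ interior D.carrier ∧ ε ≤ weight u k α x} := by
  obtain ⟨K, hK⟩ := exists_weight_le hu k (interior_subset hα)
  have hαpos := (mem_interior_carrier D).1 hα
  have hk0 : (0 : ℝ) < k := by exact_mod_cast hk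
  set Q : Set (EuclideanSpace ℝ (Fin n)) :=
    {x | ∀ a, Real.exp ((Real.log ε - K) / (k * D.ell a α)) ≤ D.ell a x} with hQ
  have hQc : IsClosed Q := by
    have : Q = ⋂ a, {x | Real.exp ((Real.log ε - K) / (k * D.ell a α)) ≤ D.ell a x} := by
      ext; simp [hQ]
    rw [this]
    exact isClosed_iInter fun a => isClosed_le continuous_const (continuous_ell D a)
  have hQI : Q ⊆ interior D.carrier := fun x hx =>
    (mem_interior_carrier D).2 fun a => (Real.exp_pos _).trans_le (hx a)
  have hsub : {x | x ∈ interior D.carrier ∧ ε ≤ weight u k α x} =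
      Q ∩ weight u k α ⁻¹' Ici ε := by
    ext x
    constructor
    · rintro ⟨hx, hxε⟩
      refine ⟨fun a => ?_, hxε⟩
      have hpos := (mem_interior_carrier D).1 hx a
      have h1 := hxε.trans ((hK x hx).2 a)
      rw [← Real.log_le_iff_le_exp hε] at h1
      rw [← Real.le_log_iff_exp_le hpos, div_le_iff₀ (mul_pos hk0 (hαpos a))]
      linarith
    · rintro ⟨hx, hxε⟩
      exact ⟨hQI hx, hxε⟩
  rw [hsub]
  exact ((contDiffOn_weight hu k α).continuousOn.mono hQI).preimage_isClosed_of_isClosed hQc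
    isClosed_Ici

lemma contDiff_coord (i : Fin n) :
    ContDiff ℝ ∞ fun x : EuclideanSpace ℝ (Fin n) => x i :=
  (EuclideanSpace.proj i : EuclideanSpace ℝ (Fin n) →L[ℝ] ℝ).contDiff

lemma contDiffOn_coord_sub (D : DelzantPolytope n) (α : EuclideanSpace ℝ (Fin n)) (i : Fin n) :
    ContDiffOn ℝ ∞ (fun x => x i - α i) D.carrier :=
  ((contDiff_coord i).sub contDiff_const).contDiffOn

/-- Integration by parts against the weight: since `G^{ij} ∂_j ρ = 2k (α_i - x_i) ρ`, a factor
`x_i - α_i` can be traded for `1/(2k)` and one derivative. -/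
lemma integral_weight_coord_sub_mul {D : DelzantPolytope n} {u : EuclideanSpace ℝ (Fin n) → ℝ}
    (hu : IsSymplecticPotential D u) {k : ℕ} (hk : 1 ≤ k) {α : EuclideanSpace ℝ (Fin n)}
    (hα : α ∈ interior D.carrier) {g : EuclideanSpace ℝ (Fin n) → ℝ}
    (hg : ContDiffOn ℝ ∞ g D.carrier) (i : Fin n) :
    ∫ x in interior D.carrier, weight u k α x * ((x i - α i) * g x) =
      1 / (2 * (k : ℝ)) * ∫ x in interior D.carrier, weight u k α x *
        ∑ j, pdWithin D.carrier j (fun y => invHess D u i j y * g y) x := by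
  have hk0 : (0 : ℝ) < k := by exact_mod_cast hk
  have hXs : ∀ j, ContDiffOn ℝ ∞ (fun y => invHess D u i j y * g y) D.carrier := fun j =>
    (contDiffOn_invHess hu i j).mul hg
  have hdiv : ContDiffOn ℝ ∞ (fun x => ∑ j, pdWithin D.carrier j
      (fun y => invHess D u i j y * g y) x) D.carrier :=
    ContDiffOn.sum fun j _ => contDiffOn_pdWithin D (hXs j) j
  have hcs : ContDiffOn ℝ ∞ (fun x => (x i - α i) * g x) D.carrier :=
    (contDiffOn_coord_sub D α i).mul hg
  have hcs' : ContDiffOn ℝ ∞ (fun x => -(2 * (k : ℝ)) * ((x i - α i) * g x)) D.carrier :=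
    contDiffOn_const.mul hcs
  obtain ⟨K, hK⟩ := exists_weight_le hu k (interior_subset hα)
  obtain ⟨C₁, -, hC₁⟩ := exists_bound_of_contDiffOn D hcs'
  obtain ⟨C₂, -, hC₂⟩ := exists_bound_of_contDiffOn D hdiv
  have hpde : ∀ x ∈ interior D.carrier, ∑ j, pd j (fun y => invHess D u i j y * g y) x =
      ∑ j, pdWithin D.carrier j (fun y => invHess D u i j y * g y) x := fun x hx =>
    Finset.sum_congr rfl fun j _ => (pdWithin_eq_pd hx j _).symm
  have key := integral_weighted_divergence (I := interior D.carrier) isOpen_interior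
    ((isCompact_carrier D).isBounded.subset interior_subset)
    (ρ := weight u k α) (c := fun x => -(2 * (k : ℝ)) * ((x i - α i) * g x))
    (contDiffOn_weight hu k α)
    (fun x _ => weight_pos u k α x) (fun x hx => (hK x hx).1)
    (fun ε hε => isClosed_superlevel_weight hu hk hα hε)
    (X := fun j y => invHess D u i j y * g y) (fun j => (hXs j).mono interior_subset)
    (fun x hx => ?_) (hcs'.continuousOn.mono interior_subset)
    (fun x hx => hC₁ x (interior_subset hx))
    (fun x hx => by rw [hpde x hx]; exact hC₂ x (interior_subset hx))
  · have hαc := carrier_subset_convergenceDomain D k (interior_subset hα)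
    have h1 := integrableOn_weight_mul hu hαc hcs'
    have h2 := integrableOn_weight_mul hu hαc hdiv
    rw [setIntegral_congr_fun isOpen_interior.measurableSet
      (g := fun x => weight u k α x * (-(2 * (k : ℝ)) * ((x i - α i) * g x)) +
        weight u k α x * ∑ j, pdWithin D.carrier j (fun y => invHess D u i j y * g y) x)
      (fun x hx => by simp only [hpde x hx, mul_add]), integral_add h1 h2] at key
    have h3 : ∫ x in interior D.carrier,
        weight u k α x * (-(2 * (k : ℝ)) * ((x i - α i) * g x)) =
        -(2 * (k : ℝ)) * ∫ x in interior D.carrier, weight u k α x * ((x i - α i) * g x) := by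
      rw [← integral_const_mul]
      exact integral_congr_ae (Filter.Eventually.of_forall fun x => by ring)
    rw [h3] at key
    rw [one_div, eq_inv_mul_iff_mul_eq₀ (by positivity)]
    linarith
  · have hinv := (isHessianPair_potential hu).inv_mul x hx
    have hsum : ∀ l, ∑ j, invHess D u i j x * hess u x j l =
        (1 : Matrix (Fin n) (Fin n) ℝ) i l := by
      intro l
      rw [← hinv, Matrix.mul_apply]
      exact Finset.sum_congr rfl fun j _ => by rw [invHess_eq hu hx]
    have h4 : ∑ j, invHess D u i j x * ∑ l, (α l - x l) * hess u x j l = α i - x i := by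
      simp only [Finset.mul_sum]
      rw [Finset.sum_comm]
      have : ∀ l, ∑ j, invHess D u i j x * ((α l - x l) * hess u x j l) =
          (α l - x l) * (1 : Matrix (Fin n) (Fin n) ℝ) i l := by
        intro l
        rw [← hsum l, Finset.mul_sum]
        exact Finset.sum_congr rfl fun j _ => by ring
      simp [this, Matrix.one_apply]
    calc ∑ j, invHess D u i j x * g x * pd j (weight u k α) x
        = weight u k α x * (2 * k * g x *
          ∑ j, invHess D u i j x * ∑ l, (α l - x l) * hess u x j l) := by
          rw [Finset.mul_sum, Finset.mul_sum]
          exact Finset.sum_congr rfl fun j _ => by rw [pd_weight hu k α hx]; ring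
      _ = _ := by rw [h4]; ring

/-! ### Moments of the mass density -/

lemma pairing_add {D : DelzantPolytope n} {u : EuclideanSpace ℝ (Fin n) → ℝ}
    (hu : IsSymplecticPotential D u) (k : ℕ) {α : EuclideanSpace ℝ (Fin n)} (hα : α ∈ D.carrier)
    {f g : EuclideanSpace ℝ (Fin n) → ℝ} (hf : ContDiffOn ℝ ∞ f D.carrier)
    (hg : ContDiffOn ℝ ∞ g D.carrier) :
    pairing D u k α (fun x => f x + g x) = pairing D u k α f + pairing D u k α g := by
  have hα' := carrier_subset_convergenceDomain D k hα
  simp only [pairing_eq, mul_add]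
  rw [integral_add (integrableOn_weight_mul hu hα' hf) (integrableOn_weight_mul hu hα' hg), add_div]

lemma pairing_const_mul (D : DelzantPolytope n) (u : EuclideanSpace ℝ (Fin n) → ℝ)
    (k : ℕ) (α : EuclideanSpace ℝ (Fin n)) (c : ℝ) (f : EuclideanSpace ℝ (Fin n) → ℝ) :
    pairing D u k α (fun x => c * f x) = c * pairing D u k α f := by
  simp only [pairing_eq]
  rw [← mul_div_assoc, ← integral_const_mul]
  congr 1
  exact integral_congr_ae (Filter.Eventually.of_forall fun x => by ring)

/-- The pairing with the mass density as a linear functional on `C^∞(P)`. -/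
noncomputable def pairingLM {D : DelzantPolytope n} {u : EuclideanSpace ℝ (Fin n) → ℝ}
    (hu : IsSymplecticPotential D u) (k : ℕ) {α : EuclideanSpace ℝ (Fin n)} (hα : α ∈ D.carrier) :
    smoothFunctions D →ₗ[ℝ] ℝ where
  toFun f := pairing D u k α f.1
  map_add' f g := pairing_add hu k hα f.2 g.2
  map_smul' c f := pairing_const_mul D u k α c f.1

lemma pairing_congr {D : DelzantPolytope n} {u : EuclideanSpace ℝ (Fin n) → ℝ}
    (k : ℕ) (α : EuclideanSpace ℝ (Fin n)) {f g : EuclideanSpace ℝ (Fin n) → ℝ}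
    (h : EqOn f g D.carrier) : pairing D u k α f = pairing D u k α g := by
  simp only [pairing_eq]
  congr 1
  exact setIntegral_congr_fun isOpen_interior.measurableSet
    fun x hx => by simp only [h (interior_subset hx)]

lemma pairing_const {D : DelzantPolytope n} {u : EuclideanSpace ℝ (Fin n) → ℝ}
    (hu : IsSymplecticPotential D u) (k : ℕ) {α : EuclideanSpace ℝ (Fin n)} (hα : α ∈ D.carrier)
    (c : ℝ) : pairing D u k α (fun _ => c) = c := by
  have h := integral_weight_pos hu (carrier_subset_convergenceDomain D k hα)
  rw [pairing_eq, integral_mul_const, mul_comm, mul_div_assoc, div_self h.ne', mul_one]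

lemma abs_pairing_le {D : DelzantPolytope n} {u : EuclideanSpace ℝ (Fin n) → ℝ}
    (hu : IsSymplecticPotential D u) (k : ℕ) {α : EuclideanSpace ℝ (Fin n)} (hα : α ∈ D.carrier)
    {f g : EuclideanSpace ℝ (Fin n) → ℝ} (hg : ContDiffOn ℝ ∞ g D.carrier)
    (h : ∀ x ∈ D.carrier, |f x| ≤ g x) :
    |pairing D u k α f| ≤ pairing D u k α g := by
  have hα' := carrier_subset_convergenceDomain D k hα
  have hpos := integral_weight_pos hu hα'
  rw [pairing_eq, pairing_eq, abs_div, abs_of_pos hpos]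
  refine div_le_div_of_nonneg_right ?_ hpos.le
  rw [← Real.norm_eq_abs]
  refine norm_integral_le_of_norm_le (integrableOn_weight_mul hu hα' hg)
    ((ae_restrict_iff' isOpen_interior.measurableSet).2
      (Filter.Eventually.of_forall fun x hx => ?_))
  rw [Real.norm_eq_abs, abs_mul, abs_of_pos (weight_pos u k α x)]
  exact mul_le_mul_of_nonneg_left (h x (interior_subset hx)) (weight_pos u k α x).le

/-- The operator `g ↦ ∂_j (G^{ij} g)`. -/
noncomputable def steinOp (D : DelzantPolytope n) (u : EuclideanSpace ℝ (Fin n) → ℝ) (i : Fin n)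
    (g : EuclideanSpace ℝ (Fin n) → ℝ) (x : EuclideanSpace ℝ (Fin n)) : ℝ :=
  ∑ j, pdWithin D.carrier j (fun y => invHess D u i j y * g y) x

lemma contDiffOn_steinOp {D : DelzantPolytope n} {u : EuclideanSpace ℝ (Fin n) → ℝ}
    (hu : IsSymplecticPotential D u) (i : Fin n) {g : EuclideanSpace ℝ (Fin n) → ℝ}
    (hg : ContDiffOn ℝ ∞ g D.carrier) : ContDiffOn ℝ ∞ (steinOp D u i g) D.carrier :=
  ContDiffOn.sum fun j _ => contDiffOn_pdWithin D ((contDiffOn_invHess hu i j).mul hg) j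

lemma pdWithin_coord_sub (D : DelzantPolytope n) (α : EuclideanSpace ℝ (Fin n)) (l j : Fin n)
    {x : EuclideanSpace ℝ (Fin n)} (hx : x ∈ D.carrier) :
    pdWithin D.carrier j (fun y => y l - α l) x = if j = l then 1 else 0 := by
  have h : HasFDerivAt (fun y : EuclideanSpace ℝ (Fin n) => y l - α l)
      (EuclideanSpace.proj l : EuclideanSpace ℝ (Fin n) →L[ℝ] ℝ) x :=
    ((EuclideanSpace.proj l : EuclideanSpace ℝ (Fin n) →L[ℝ] ℝ).hasFDerivAt).sub_const _
  rw [pdWithin, h.hasFDerivWithinAt.fderivWithin (uniqueDiffOn_carrier D x hx)]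
  simp [eq_comm]

lemma steinOp_coord_sub_mul {D : DelzantPolytope n} {u : EuclideanSpace ℝ (Fin n) → ℝ}
    (hu : IsSymplecticPotential D u) (α : EuclideanSpace ℝ (Fin n)) (i l : Fin n)
    {g : EuclideanSpace ℝ (Fin n) → ℝ} (hg : ContDiffOn ℝ ∞ g D.carrier)
    {x : EuclideanSpace ℝ (Fin n)} (hx : x ∈ D.carrier) :
    steinOp D u i (fun y => (y l - α l) * g y) x =
      (x l - α l) * steinOp D u i g x + invHess D u i l x * g x := by
  have h1 : ∀ j, pdWithin D.carrier j (fun y => invHess D u i j y * ((y l - α l) * g y)) x =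
      (x l - α l) * pdWithin D.carrier j (fun y => invHess D u i j y * g y) x +
        (if j = l then invHess D u i j x * g x else 0) := by
    intro j
    have e : (fun y => invHess D u i j y * ((y l - α l) * g y)) =
        fun y => (y l - α l) * (invHess D u i j y * g y) := by ext y; ring
    rw [e, pdWithin_mul D (contDiffOn_coord_sub D α l) ((contDiffOn_invHess hu i j).mul hg) hx,
      pdWithin_coord_sub D α l j hx]
    split_ifs <;> ring
  simp only [steinOp, h1, Finset.sum_add_distrib, ← Finset.mul_sum]
  simp

lemma pairing_coord_sub_mul {D : DelzantPolytope n} {u : EuclideanSpace ℝ (Fin n) → ℝ}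
    (hu : IsSymplecticPotential D u) {k : ℕ} (hk : 1 ≤ k) {α : EuclideanSpace ℝ (Fin n)}
    (hα : α ∈ interior D.carrier) {g : EuclideanSpace ℝ (Fin n) → ℝ}
    (hg : ContDiffOn ℝ ∞ g D.carrier) (i : Fin n) :
    pairing D u k α (fun x => (x i - α i) * g x) =
      1 / (2 * (k : ℝ)) * pairing D u k α (steinOp D u i g) := by
  rw [pairing_eq, integral_weight_coord_sub_mul hu hk hα hg i, pairing_eq, mul_div_assoc]
  rfl

/-- Two factors `x - α`. -/
lemma pairing_coord_sub_mul_coord_sub_mul {D : DelzantPolytope n}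
    {u : EuclideanSpace ℝ (Fin n) → ℝ}
    (hu : IsSymplecticPotential D u) {k : ℕ} (hk : 1 ≤ k) {α : EuclideanSpace ℝ (Fin n)}
    (hα : α ∈ interior D.carrier) {g : EuclideanSpace ℝ (Fin n) → ℝ}
    (hg : ContDiffOn ℝ ∞ g D.carrier) (i l : Fin n) :
    pairing D u k α (fun x => (x i - α i) * ((x l - α l) * g x)) =
      1 / (2 * (k : ℝ)) * (pairing D u k α (fun x => (x l - α l) * steinOp D u i g x) +
        pairing D u k α (fun x => invHess D u i l x * g x)) := by
  have hα' := interior_subset hα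
  rw [pairing_coord_sub_mul hu hk hα ((contDiffOn_coord_sub D α l).mul hg),
    ← pairing_add hu k hα' ((contDiffOn_coord_sub D α l).mul (contDiffOn_steinOp hu i hg))
      ((contDiffOn_invHess hu i l).mul hg)]
  congr 1
  exact pairing_congr k α fun x hx => steinOp_coord_sub_mul hu α i l hg hx

/-- `Φ k α = O(k^{-p})`, uniformly for `α` in the interior of the polytope. -/
def UnifO (D : DelzantPolytope n) (p : ℕ) (Φ : ℕ → EuclideanSpace ℝ (Fin n) → ℝ) : Prop :=
  ∃ C, ∀ k, 1 ≤ k → ∀ α ∈ interior D.carrier, |Φ k α| ≤ C / (k : ℝ) ^ p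

namespace UnifO

variable {D : DelzantPolytope n} {p : ℕ} {Φ Ψ : ℕ → EuclideanSpace ℝ (Fin n) → ℝ}

lemma congr (hΦ : UnifO D p Φ)
    (h : ∀ k, 1 ≤ k → ∀ α ∈ interior D.carrier, Ψ k α = Φ k α) : UnifO D p Ψ := by
  obtain ⟨C, hC⟩ := hΦ
  exact ⟨C, fun k hk α hα => by rw [h k hk α hα]; exact hC k hk α hα⟩

lemma mono (hΦ : UnifO D p Φ)
    (h : ∀ k, 1 ≤ k → ∀ α ∈ interior D.carrier, |Ψ k α| ≤ |Φ k α|) : UnifO D p Ψ := by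
  obtain ⟨C, hC⟩ := hΦ
  exact ⟨C, fun k hk α hα => (h k hk α hα).trans (hC k hk α hα)⟩

lemma add (hΦ : UnifO D p Φ) (hΨ : UnifO D p Ψ) : UnifO D p (fun k α => Φ k α + Ψ k α) := by
  obtain ⟨C, hC⟩ := hΦ
  obtain ⟨C', hC'⟩ := hΨ
  refine ⟨C + C', fun k hk α hα => ?_⟩
  rw [add_div]
  exact (abs_add_le _ _).trans (add_le_add (hC k hk α hα) (hC' k hk α hα))

lemma const_mul (c : ℝ) (hΦ : UnifO D p Φ) : UnifO D p (fun k α => c * Φ k α) := by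
  obtain ⟨C, hC⟩ := hΦ
  refine ⟨|c| * C, fun k hk α hα => ?_⟩
  rw [abs_mul, mul_div_assoc]
  exact mul_le_mul_of_nonneg_left (hC k hk α hα) (abs_nonneg c)

lemma abs (hΦ : UnifO D p Φ) : UnifO D p (fun k α => |Φ k α|) :=
  hΦ.mono fun k _ α _ => by rw [abs_abs]

lemma zero : UnifO D p (fun _ _ => 0) := ⟨0, fun k _ α _ => by simp⟩

lemma sum {ι : Type} (s : Finset ι) {F : ι → ℕ → EuclideanSpace ℝ (Fin n) → ℝ}
    (h : ∀ i, UnifO D p (F i)) : UnifO D p (fun k α => ∑ i ∈ s, F i k α) := by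
  classical
  induction s using Finset.induction_on with
  | empty => simpa using zero
  | insert i s hi ih =>
    simp only [Finset.sum_insert hi]
    exact (h i).add ih

lemma gain (hΦ : UnifO D p Φ) : UnifO D (p + 1) (fun k α => 1 / (2 * (k : ℝ)) * Φ k α) := by
  obtain ⟨C, hC⟩ := hΦ
  refine ⟨C / 2, fun k hk α hα => ?_⟩
  have hk0 : (0 : ℝ) < k := by exact_mod_cast hk
  rw [abs_mul, abs_of_pos (by positivity : 0 < 1 / (2 * (k : ℝ)))]
  calc 1 / (2 * (k : ℝ)) * |Φ k α| ≤ 1 / (2 * (k : ℝ)) * (C / (k : ℝ) ^ p) :=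
        mul_le_mul_of_nonneg_left (hC k hk α hα) (by positivity)
    _ = C / 2 / (k : ℝ) ^ (p + 1) := by field_simp; ring

lemma weaken (hΦ : UnifO D (p + 1) Φ) : UnifO D p Φ := by
  obtain ⟨C, hC⟩ := hΦ
  refine ⟨C, fun k hk α hα => (hC k hk α hα).trans ?_⟩
  have hk0 : (0 : ℝ) < k := by exact_mod_cast hk
  have hk1 : (1 : ℝ) ≤ k := by exact_mod_cast hk
  have hC0 : 0 ≤ C := by
    have h := (abs_nonneg _).trans (hC k hk α hα)
    by_contra hneg
    exact absurd h (not_le.2 (div_neg_of_neg_of_pos (not_le.1 hneg) (by positivity)))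
  exact div_le_div_of_nonneg_left hC0 (by positivity)
    (pow_le_pow_right₀ hk1 (Nat.le_succ p))

end UnifO

section moments

variable {D : DelzantPolytope n} {u : EuclideanSpace ℝ (Fin n) → ℝ}
  {g : EuclideanSpace ℝ (Fin n) → ℝ}

lemma unifO_moment_zero (hu : IsSymplecticPotential D u) (hg : ContDiffOn ℝ ∞ g D.carrier) :
    UnifO D 0 (fun k α => pairing D u k α g) := by
  obtain ⟨C, -, hC⟩ := exists_bound_of_contDiffOn D hg
  refine ⟨C, fun k _ α hα => ?_⟩
  rw [pow_zero, div_one, ← pairing_const hu k (interior_subset hα) C]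
  exact abs_pairing_le hu k (interior_subset hα) contDiffOn_const hC

lemma unifO_moment_one (hu : IsSymplecticPotential D u) (hg : ContDiffOn ℝ ∞ g D.carrier)
    (i : Fin n) : UnifO D 1 (fun k α => pairing D u k α (fun x => (x i - α i) * g x)) :=
  (unifO_moment_zero hu (contDiffOn_steinOp hu i hg)).gain.congr fun _ hk _ hα =>
    pairing_coord_sub_mul hu hk hα hg i

lemma unifO_moment_two (hu : IsSymplecticPotential D u) (hg : ContDiffOn ℝ ∞ g D.carrier)
    (i j : Fin n) :
    UnifO D 1 (fun k α => pairing D u k α (fun x => (x i - α i) * ((x j - α j) * g x))) :=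
  ((unifO_moment_one hu (contDiffOn_steinOp hu i hg) j).weaken.add
    (unifO_moment_zero hu ((contDiffOn_invHess hu i j).mul hg))).gain.congr fun _ hk _ hα =>
    pairing_coord_sub_mul_coord_sub_mul hu hk hα hg i j

lemma unifO_moment_three (hu : IsSymplecticPotential D u) (hg : ContDiffOn ℝ ∞ g D.carrier)
    (i j l : Fin n) :
    UnifO D 2 (fun k α => pairing D u k α
      (fun x => (x i - α i) * ((x j - α j) * ((x l - α l) * g x)))) := by
  refine (((unifO_moment_two hu (contDiffOn_steinOp hu i hg) j l).add
    (unifO_moment_one hu ((contDiffOn_invHess hu i l).mul hg) j)).add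
    (unifO_moment_one hu ((contDiffOn_invHess hu i j).mul hg) l)).gain.congr fun k hk α hα => ?_
  have hα' := interior_subset hα
  have hy := contDiffOn_coord_sub D α
  have hS := contDiffOn_steinOp hu i hg
  have hG := fun m => (contDiffOn_invHess hu i m).mul hg
  rw [pairing_coord_sub_mul hu hk hα ((hy j).mul ((hy l).mul hg)),
    ← pairing_add hu k hα' ((hy j).mul ((hy l).mul hS)) ((hy j).mul (hG l)),
    ← pairing_add hu k hα' (((hy j).mul ((hy l).mul hS)).add ((hy j).mul (hG l)))
      ((hy l).mul (hG j))]
  congr 1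
  refine pairing_congr k α fun x hx => ?_
  rw [steinOp_coord_sub_mul hu α i j ((hy l).mul hg) hx, steinOp_coord_sub_mul hu α i l hg hx]
  ring

lemma unifO_moment_four (hu : IsSymplecticPotential D u) (hg : ContDiffOn ℝ ∞ g D.carrier)
    (i j l m : Fin n) :
    UnifO D 2 (fun k α => pairing D u k α
      (fun x => (x i - α i) * ((x j - α j) * ((x l - α l) * ((x m - α m) * g x))))) := by
  refine ((((unifO_moment_three hu (contDiffOn_steinOp hu i hg) j l m).weaken.add
    (unifO_moment_two hu ((contDiffOn_invHess hu i m).mul hg) j l)).add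
    (unifO_moment_two hu ((contDiffOn_invHess hu i l).mul hg) j m)).add
    (unifO_moment_two hu ((contDiffOn_invHess hu i j).mul hg) l m)).gain.congr fun k hk α hα => ?_
  have hα' := interior_subset hα
  have hy := contDiffOn_coord_sub D α
  have hS := contDiffOn_steinOp hu i hg
  have hG := fun m => (contDiffOn_invHess hu i m).mul hg
  have h1 := (hy j).mul ((hy l).mul ((hy m).mul hS))
  have h2 := (hy j).mul ((hy l).mul (hG m))
  have h3 := (hy j).mul ((hy m).mul (hG l))
  have h4 := (hy l).mul ((hy m).mul (hG j))
  rw [pairing_coord_sub_mul hu hk hα ((hy j).mul ((hy l).mul ((hy m).mul hg))),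
    ← pairing_add hu k hα' h1 h2, ← pairing_add hu k hα' (h1.add h2) h3,
    ← pairing_add hu k hα' ((h1.add h2).add h3) h4]
  congr 1
  refine pairing_congr k α fun x hx => ?_
  rw [steinOp_coord_sub_mul hu α i j ((hy l).mul ((hy m).mul hg)) hx,
    steinOp_coord_sub_mul hu α i l ((hy m).mul hg) hx, steinOp_coord_sub_mul hu α i m hg hx]
  ring

end moments

/-! ### Taylor expansion on the polytope -/

lemma abs_sub_le_of_hasDerivWithinAt {h h' : ℝ → ℝ} {M : ℝ}
    (hd : ∀ t ∈ Icc (0 : ℝ) 1, HasDerivWithinAt h (h' t) (Icc 0 1) t)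
    (hM : ∀ t ∈ Icc (0 : ℝ) 1, |h' t| ≤ M) {t : ℝ} (ht : t ∈ Icc (0 : ℝ) 1) :
    |h t - h 0| ≤ M := by
  have hM0 : 0 ≤ M := (abs_nonneg _).trans (hM t ht)
  have := norm_image_sub_le_of_norm_deriv_le_segment' hd
    (fun x hx => hM x (Ico_subset_Icc_self hx)) t ht
  refine this.trans ?_
  rw [sub_zero]
  exact mul_le_of_le_one_right hM0 ht.2

lemma taylor_two {h₀ h₁ h₂ : ℝ → ℝ} {M : ℝ}
    (hd₀ : ∀ t ∈ Icc (0 : ℝ) 1, HasDerivWithinAt h₀ (h₁ t) (Icc 0 1) t)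
    (hd₁ : ∀ t ∈ Icc (0 : ℝ) 1, HasDerivWithinAt h₁ (h₂ t) (Icc 0 1) t)
    (hM : ∀ t ∈ Icc (0 : ℝ) 1, |h₂ t| ≤ M) {t : ℝ} (ht : t ∈ Icc (0 : ℝ) 1) :
    |h₀ t - h₀ 0 - t * h₁ 0| ≤ M := by
  have h := abs_sub_le_of_hasDerivWithinAt (h := fun t => h₀ t - t * h₁ 0)
    (h' := fun t => h₁ t - h₁ 0) (M := M)
    (fun s hs => ((hd₀ s hs).fun_sub
      ((hasDerivWithinAt_id s (Icc 0 1)).mul_const (h₁ 0))).congr_deriv (by rw [one_mul]))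
    (fun s hs => abs_sub_le_of_hasDerivWithinAt hd₁ hM hs) ht
  simp only [zero_mul, sub_zero] at h
  rwa [sub_right_comm]

lemma taylor_four {h₀ h₁ h₂ h₃ h₄ : ℝ → ℝ} {M : ℝ}
    (hd₀ : ∀ t ∈ Icc (0 : ℝ) 1, HasDerivWithinAt h₀ (h₁ t) (Icc 0 1) t)
    (hd₁ : ∀ t ∈ Icc (0 : ℝ) 1, HasDerivWithinAt h₁ (h₂ t) (Icc 0 1) t)
    (hd₂ : ∀ t ∈ Icc (0 : ℝ) 1, HasDerivWithinAt h₂ (h₃ t) (Icc 0 1) t)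
    (hd₃ : ∀ t ∈ Icc (0 : ℝ) 1, HasDerivWithinAt h₃ (h₄ t) (Icc 0 1) t)
    (hM : ∀ t ∈ Icc (0 : ℝ) 1, |h₄ t| ≤ M) :
    |h₀ 1 - h₀ 0 - h₁ 0 - 1 / 2 * h₂ 0 - 1 / 6 * h₃ 0| ≤ M := by
  -- the first two derivatives of the difference with the Taylor polynomial
  have e0 : ∀ s ∈ Icc (0 : ℝ) 1, HasDerivWithinAt
      (fun t => h₀ t - t ^ 2 / 2 * h₂ 0 - t ^ 3 / 6 * h₃ 0)
      (h₁ s - s * h₂ 0 - s ^ 2 / 2 * h₃ 0) (Icc 0 1) s := by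
    intro s hs
    have h2 := (((hasDerivAt_pow 2 s).div_const 2).mul_const (h₂ 0)).hasDerivWithinAt (s := Icc 0 1)
    have h3 := (((hasDerivAt_pow 3 s).div_const 6).mul_const (h₃ 0)).hasDerivWithinAt (s := Icc 0 1)
    refine (((hd₀ s hs).fun_sub h2).fun_sub h3).congr_deriv ?_
    push_cast
    ring
  have e1 : ∀ s ∈ Icc (0 : ℝ) 1, HasDerivWithinAt
      (fun t => h₁ t - t * h₂ 0 - t ^ 2 / 2 * h₃ 0) (h₂ s - h₂ 0 - s * h₃ 0) (Icc 0 1) s := by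
    intro s hs
    have h1 := ((hasDerivAt_id s).mul_const (h₂ 0)).hasDerivWithinAt (s := Icc 0 1)
    have h2 := (((hasDerivAt_pow 2 s).div_const 2).mul_const (h₃ 0)).hasDerivWithinAt (s := Icc 0 1)
    refine (((hd₁ s hs).fun_sub h1).fun_sub h2).congr_deriv ?_
    push_cast
    ring
  have h := taylor_two e0 e1 (fun s hs => taylor_two hd₂ hd₃ hM hs) (right_mem_Icc.2 zero_le_one)
  refine le_of_eq_of_le (congrArg abs ?_) h
  ring

lemma segment_mem_carrier (D : DelzantPolytope n) {α x : EuclideanSpace ℝ (Fin n)}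
    (hα : α ∈ D.carrier) (hx : x ∈ D.carrier) {t : ℝ} (ht : t ∈ Icc (0 : ℝ) 1) :
    α + t • (x - α) ∈ D.carrier :=
  (convex_carrier D).add_smul_sub_mem hα hx ht

/-- The second order Taylor estimate, with the second derivatives bounded by `M`. -/
lemma abs_taylor_two_le (D : DelzantPolytope n) {f : EuclideanSpace ℝ (Fin n) → ℝ}
    (hf : ContDiffOn ℝ ∞ f D.carrier) {M : ℝ}
    (hM : ∀ i j, ∀ x ∈ D.carrier,
      |pdWithin D.carrier j (pdWithin D.carrier i f) x| ≤ M)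
    {α x : EuclideanSpace ℝ (Fin n)} (hα : α ∈ D.carrier) (hx : x ∈ D.carrier) :
    |f x - f α - ∑ i, (x i - α i) * pdWithin D.carrier i f α| ≤
      M * (n * ∑ i, (x i - α i) ^ 2) := by
  have hseg := fun t ht => segment_mem_carrier D hα hx (t := t) ht
  set w := x - α with hw
  have hwi : ∀ i, w i = x i - α i := fun i => rfl
  have hsum : (∑ i, |w i|) ^ 2 ≤ n * ∑ i, (x i - α i) ^ 2 := by
    have := sq_sum_le_card_mul_sum_sq (s := (Finset.univ : Finset (Fin n))) (f := fun i => |w i|)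
    simpa [hwi] using this
  have h := taylor_two (t := 1) (M := M * (n * ∑ i, (x i - α i) ^ 2))
    (fun t ht => hasDerivWithinAt_comp_line D hf hseg ht)
    (fun t ht => HasDerivWithinAt.fun_sum fun i _ => HasDerivWithinAt.const_mul (w i)
      (hasDerivWithinAt_comp_line D (contDiffOn_pdWithin D hf i) hseg ht))
    (fun t ht => ?_) (right_mem_Icc.2 zero_le_one)
  · simpa [hw] using h
  · have hz := hseg t ht
    rcases isEmpty_or_nonempty (Fin n) with hn | ⟨⟨i₀⟩⟩
    · simp
    have hM0 : 0 ≤ M := (abs_nonneg _).trans (hM i₀ i₀ _ hz)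
    calc |∑ i, w i * ∑ j, w j * pdWithin D.carrier j (pdWithin D.carrier i f) (α + t • w)|
        ≤ ∑ i, |w i| * ∑ j, |w j| * M := by
          refine (Finset.abs_sum_le_sum_abs _ _).trans (Finset.sum_le_sum fun i _ => ?_)
          rw [abs_mul]
          refine mul_le_mul_of_nonneg_left ?_ (abs_nonneg _)
          refine (Finset.abs_sum_le_sum_abs _ _).trans (Finset.sum_le_sum fun j _ => ?_)
          rw [abs_mul]
          exact mul_le_mul_of_nonneg_left (hM i j _ hz) (abs_nonneg _)
      _ = M * (∑ i, |w i|) ^ 2 := by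
          rw [← Finset.sum_mul, ← Finset.sum_mul]; ring
      _ ≤ _ := mul_le_mul_of_nonneg_left hsum hM0

/-- The fourth order Taylor estimate, with the fourth derivatives bounded by `M`. -/
lemma abs_taylor_four_le (D : DelzantPolytope n) {f : EuclideanSpace ℝ (Fin n) → ℝ}
    (hf : ContDiffOn ℝ ∞ f D.carrier) {M : ℝ}
    (hM : ∀ i j l m, ∀ x ∈ D.carrier, |pdWithin D.carrier m (pdWithin D.carrier l
      (pdWithin D.carrier j (pdWithin D.carrier i f))) x| ≤ M)
    {α x : EuclideanSpace ℝ (Fin n)} (hα : α ∈ D.carrier) (hx : x ∈ D.carrier) :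
    |f x - f α - ∑ i, (x i - α i) * pdWithin D.carrier i f α -
      1 / 2 * ∑ i, (x i - α i) * ∑ j, (x j - α j) *
        pdWithin D.carrier j (pdWithin D.carrier i f) α -
      1 / 6 * ∑ i, (x i - α i) * ∑ j, (x j - α j) * ∑ l, (x l - α l) *
        pdWithin D.carrier l (pdWithin D.carrier j (pdWithin D.carrier i f)) α| ≤
      M * (n * ∑ i, (x i - α i) ^ 2) ^ 2 := by
  have hseg := fun t ht => segment_mem_carrier D hα hx (t := t) ht
  set w := x - α with hw
  have hwi : ∀ i, w i = x i - α i := fun i => rfl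
  have hsum : (∑ i, |w i|) ^ 2 ≤ n * ∑ i, (x i - α i) ^ 2 := by
    have := sq_sum_le_card_mul_sum_sq (s := (Finset.univ : Finset (Fin n))) (f := fun i => |w i|)
    simpa [hwi] using this
  have hs1 := fun i => contDiffOn_pdWithin D hf i
  have hs2 := fun i j => contDiffOn_pdWithin D (hs1 i) j
  have hs3 := fun i j l => contDiffOn_pdWithin D (hs2 i j) l
  have h := taylor_four (M := M * (n * ∑ i, (x i - α i) ^ 2) ^ 2)
    (fun t ht => hasDerivWithinAt_comp_line D hf hseg ht)
    (fun t ht => HasDerivWithinAt.fun_sum fun i _ => HasDerivWithinAt.const_mul (w i)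
      (hasDerivWithinAt_comp_line D (hs1 i) hseg ht))
    (fun t ht => HasDerivWithinAt.fun_sum fun i _ => HasDerivWithinAt.const_mul (w i)
      (HasDerivWithinAt.fun_sum fun j _ => HasDerivWithinAt.const_mul (w j)
      (hasDerivWithinAt_comp_line D (hs2 i j) hseg ht)))
    (fun t ht => HasDerivWithinAt.fun_sum fun i _ => HasDerivWithinAt.const_mul (w i)
      (HasDerivWithinAt.fun_sum fun j _ => HasDerivWithinAt.const_mul (w j)
      (HasDerivWithinAt.fun_sum fun l _ => HasDerivWithinAt.const_mul (w l)
      (hasDerivWithinAt_comp_line D (hs3 i j l) hseg ht))))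
    (fun t ht => ?_)
  · simpa [hw] using h
  · have hz := hseg t ht
    rcases isEmpty_or_nonempty (Fin n) with hn | ⟨⟨i₀⟩⟩
    · simp
    have hM0 : 0 ≤ M := (abs_nonneg _).trans (hM i₀ i₀ i₀ i₀ _ hz)
    -- the triangle inequality for one of the nested sums
    have htri : ∀ (c : Fin n → ℝ) (B : ℝ), (∀ i, |c i| ≤ B) →
        |∑ i, w i * c i| ≤ (∑ i, |w i|) * B := by
      intro c B hB
      rw [Finset.sum_mul]
      refine (Finset.abs_sum_le_sum_abs _ _).trans (Finset.sum_le_sum fun i _ => ?_)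
      rw [abs_mul]
      exact mul_le_mul_of_nonneg_left (hB i) (abs_nonneg _)
    refine (htri _ _ fun i => htri _ _ fun j => htri _ _ fun l => htri _ _ fun m =>
      hM i j l m _ hz).trans ?_
    calc (∑ i, |w i|) * ((∑ i, |w i|) * ((∑ i, |w i|) * ((∑ i, |w i|) * M)))
        = M * ((∑ i, |w i|) ^ 2) ^ 2 := by ring
      _ ≤ _ := by gcongr

/-! ### Derivatives and the `C^r` norm -/

lemma norm_iteratedFDerivWithin_pdWithin_le (D : DelzantPolytope n)
    {f : EuclideanSpace ℝ (Fin n) → ℝ} (hf : ContDiffOn ℝ ∞ f D.carrier) (i : Fin n) (m : ℕ)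
    {x : EuclideanSpace ℝ (Fin n)} (hx : x ∈ D.carrier) :
    ‖iteratedFDerivWithin ℝ m (pdWithin D.carrier i f) D.carrier x‖ ≤
      ‖iteratedFDerivWithin ℝ (m + 1) f D.carrier x‖ := by
  have hU := uniqueDiffOn_carrier D
  rw [← norm_iteratedFDerivWithin_fderivWithin hU hx]
  have hF : ContDiffOn ℝ ∞ (fderivWithin ℝ f D.carrier) D.carrier :=
    hf.fderivWithin hU (m := ∞) (by simp)
  let L : (EuclideanSpace ℝ (Fin n) →L[ℝ] ℝ) →L[ℝ] ℝ :=
    ContinuousLinearMap.apply ℝ ℝ (EuclideanSpace.single i (1 : ℝ))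
  have hL : ‖L‖ ≤ 1 := by
    refine ContinuousLinearMap.opNorm_le_bound _ zero_le_one fun A => ?_
    have h := A.le_opNorm (EuclideanSpace.single i (1 : ℝ))
    rw [PiLp.norm_single, norm_one, mul_one] at h
    rw [one_mul]
    exact h
  have h := L.norm_iteratedFDerivWithin_comp_left
    (hF x hx) hU hx (n := m) (by exact_mod_cast le_top)
  exact h.trans (mul_le_of_le_one_left (norm_nonneg _) hL)

lemma le_cNorm (D : DelzantPolytope n) {f : EuclideanSpace ℝ (Fin n) → ℝ}
    (hf : ContDiffOn ℝ ∞ f D.carrier) {m r : ℕ} (hm : m ≤ r) {x : EuclideanSpace ℝ (Fin n)}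
    (hx : x ∈ D.carrier) : ‖iteratedFDerivWithin ℝ m f D.carrier x‖ ≤ cNorm D r f := by
  have h1 : ‖iteratedFDerivWithin ℝ m f D.carrier x‖ ≤
      ⨆ y : D.carrier, ‖iteratedFDerivWithin ℝ m f D.carrier y‖ := by
    refine le_ciSup (f := fun y : D.carrier => ‖iteratedFDerivWithin ℝ m f D.carrier y‖) ?_ ⟨x, hx⟩
    obtain ⟨C, hC⟩ := (isCompact_carrier D).exists_bound_of_continuousOn
      (hf.continuousOn_iteratedFDerivWithin (m := m) (by exact_mod_cast le_top)
        (uniqueDiffOn_carrier D))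
    exact ⟨C, by rintro _ ⟨y, rfl⟩; exact hC y y.2⟩
  refine h1.trans ?_
  exact Finset.single_le_sum
    (f := fun m => ⨆ y : D.carrier, ‖iteratedFDerivWithin ℝ m f D.carrier y‖)
    (fun i _ => Real.iSup_nonneg fun y => norm_nonneg _)
    (Finset.mem_range.2 (Nat.lt_succ_of_le hm))

lemma abs_le_norm_iteratedFDerivWithin (P : Set (EuclideanSpace ℝ (Fin n)))
    (f : EuclideanSpace ℝ (Fin n) → ℝ) (x : EuclideanSpace ℝ (Fin n)) :
    |f x| ≤ ‖iteratedFDerivWithin ℝ 0 f P x‖ := by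
  rw [norm_iteratedFDerivWithin_zero]; rfl

section bounds

variable {D : DelzantPolytope n} {f : EuclideanSpace ℝ (Fin n) → ℝ}
  {x : EuclideanSpace ℝ (Fin n)}

lemma abs_pdWithin_le (hf : ContDiffOn ℝ ∞ f D.carrier) (hx : x ∈ D.carrier) (i : Fin n) :
    |pdWithin D.carrier i f x| ≤ cNorm D 4 f :=
  (abs_le_norm_iteratedFDerivWithin _ _ _).trans <|
    (norm_iteratedFDerivWithin_pdWithin_le D hf i 0 hx).trans (le_cNorm D hf (by norm_num) hx)

lemma abs_pdWithin_two_le (hf : ContDiffOn ℝ ∞ f D.carrier) (hx : x ∈ D.carrier) (i j : Fin n) :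
    |pdWithin D.carrier j (pdWithin D.carrier i f) x| ≤ cNorm D 4 f :=
  (abs_le_norm_iteratedFDerivWithin _ _ _).trans <|
    (norm_iteratedFDerivWithin_pdWithin_le D (contDiffOn_pdWithin D hf i) j 0 hx).trans <|
    (norm_iteratedFDerivWithin_pdWithin_le D hf i 1 hx).trans (le_cNorm D hf (by norm_num) hx)

lemma abs_pdWithin_three_le (hf : ContDiffOn ℝ ∞ f D.carrier) (hx : x ∈ D.carrier)
    (i j l : Fin n) :
    |pdWithin D.carrier l (pdWithin D.carrier j (pdWithin D.carrier i f)) x| ≤ cNorm D 4 f :=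
  (abs_le_norm_iteratedFDerivWithin _ _ _).trans <|
    (norm_iteratedFDerivWithin_pdWithin_le D
      (contDiffOn_pdWithin D (contDiffOn_pdWithin D hf i) j) l 0 hx).trans <|
    (norm_iteratedFDerivWithin_pdWithin_le D (contDiffOn_pdWithin D hf i) j 1 hx).trans <|
    (norm_iteratedFDerivWithin_pdWithin_le D hf i 2 hx).trans (le_cNorm D hf (by norm_num) hx)

lemma abs_pdWithin_four_le (hf : ContDiffOn ℝ ∞ f D.carrier) (hx : x ∈ D.carrier)
    (i j l m : Fin n) :
    |pdWithin D.carrier m (pdWithin D.carrier l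
      (pdWithin D.carrier j (pdWithin D.carrier i f))) x| ≤ cNorm D 4 f :=
  (abs_le_norm_iteratedFDerivWithin _ _ _).trans <|
    (norm_iteratedFDerivWithin_pdWithin_le D (contDiffOn_pdWithin D
      (contDiffOn_pdWithin D (contDiffOn_pdWithin D hf i) j) l) m 0 hx).trans <|
    (norm_iteratedFDerivWithin_pdWithin_le D
      (contDiffOn_pdWithin D (contDiffOn_pdWithin D hf i) j) l 1 hx).trans <|
    (norm_iteratedFDerivWithin_pdWithin_le D (contDiffOn_pdWithin D hf i) j 2 hx).trans <|
    (norm_iteratedFDerivWithin_pdWithin_le D hf i 3 hx).trans (le_cNorm D hf (by norm_num) hx)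

end bounds

/-! ### The expansion to second order -/

section expansion

variable {D : DelzantPolytope n} {u : EuclideanSpace ℝ (Fin n) → ℝ}

lemma pairing_sum (hu : IsSymplecticPotential D u) (k : ℕ) {α : EuclideanSpace ℝ (Fin n)}
    (hα : α ∈ D.carrier) {ι : Type} (s : Finset ι) {F : ι → EuclideanSpace ℝ (Fin n) → ℝ}
    (hF : ∀ i, ContDiffOn ℝ ∞ (F i) D.carrier) :
    pairing D u k α (fun x => ∑ i ∈ s, F i x) = ∑ i ∈ s, pairing D u k α (F i) := by
  have h := map_sum (pairingLM hu k hα) (fun i => (⟨F i, hF i⟩ : smoothFunctions D)) s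
  refine Eq.trans ?_ h
  refine pairing_congr k α fun x _ => ?_
  simp

/-- The moments `⟨|e_{α,k}|², x_i - α_i⟩`. -/
noncomputable def momentOne (D : DelzantPolytope n) (u : EuclideanSpace ℝ (Fin n) → ℝ) (i : Fin n)
    (k : ℕ) (α : EuclideanSpace ℝ (Fin n)) : ℝ :=
  pairing D u k α (fun x => (x i - α i) * 1)

/-- The moments `⟨|e_{α,k}|², (x_i - α_i) (x_j - α_j)⟩`. -/
noncomputable def momentTwo (D : DelzantPolytope n) (u : EuclideanSpace ℝ (Fin n) → ℝ)
    (i j : Fin n) (k : ℕ) (α : EuclideanSpace ℝ (Fin n)) : ℝ :=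
  pairing D u k α (fun x => (x i - α i) * ((x j - α j) * 1))

/-- The moments `⟨|e_{α,k}|², (x_i - α_i) (x_j - α_j) (x_l - α_l)⟩`. -/
noncomputable def momentThree (D : DelzantPolytope n) (u : EuclideanSpace ℝ (Fin n) → ℝ)
    (i j l : Fin n) (k : ℕ) (α : EuclideanSpace ℝ (Fin n)) : ℝ :=
  pairing D u k α (fun x => (x i - α i) * ((x j - α j) * ((x l - α l) * 1)))

/-- The moments `⟨|e_{α,k}|², (x_i - α_i)² (x_j - α_j)²⟩`. -/
noncomputable def momentFour (D : DelzantPolytope n) (u : EuclideanSpace ℝ (Fin n) → ℝ)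
    (i j : Fin n) (k : ℕ) (α : EuclideanSpace ℝ (Fin n)) : ℝ :=
  pairing D u k α (fun x =>
    (x i - α i) * ((x i - α i) * ((x j - α j) * ((x j - α j) * 1))))

lemma contDiffOn_one (D : DelzantPolytope n) :
    ContDiffOn ℝ ∞ (fun _ : EuclideanSpace ℝ (Fin n) => (1 : ℝ)) D.carrier := contDiffOn_const

lemma pairing_linear (hu : IsSymplecticPotential D u) (k : ℕ) {α : EuclideanSpace ℝ (Fin n)}
    (hα : α ∈ D.carrier) (c : Fin n → ℝ) :
    pairing D u k α (fun x => ∑ i, (x i - α i) * c i) = ∑ i, c i * momentOne D u i k α := by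
  have hy := contDiffOn_coord_sub D α
  have h1 := contDiffOn_one D
  rw [pairing_sum hu k hα _ (fun i => (hy i).mul contDiffOn_const)]
  refine Finset.sum_congr rfl fun i _ => ?_
  rw [momentOne, ← pairing_const_mul]
  exact pairing_congr k α fun x _ => by ring

lemma pairing_quadratic (hu : IsSymplecticPotential D u) (k : ℕ) {α : EuclideanSpace ℝ (Fin n)}
    (hα : α ∈ D.carrier) (c : Fin n → Fin n → ℝ) :
    pairing D u k α (fun x => ∑ i, (x i - α i) * ∑ j, (x j - α j) * c i j) =
      ∑ i, ∑ j, c i j * momentTwo D u i j k α := by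
  have hy := contDiffOn_coord_sub D α
  have hc : ∀ r : ℝ, ContDiffOn ℝ ∞ (fun _ : EuclideanSpace ℝ (Fin n) => r) D.carrier :=
    fun _ => contDiffOn_const
  simp only [Finset.mul_sum]
  rw [pairing_sum hu k hα _ (fun i => ContDiffOn.sum fun j _ =>
    (hy i).mul ((hy j).mul (hc (c i j))))]
  refine Finset.sum_congr rfl fun i _ => ?_
  rw [pairing_sum hu k hα _ (fun j => (hy i).mul ((hy j).mul (hc (c i j))))]
  refine Finset.sum_congr rfl fun j _ => ?_
  rw [momentTwo, ← pairing_const_mul]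
  exact pairing_congr k α fun x _ => by ring

lemma pairing_cubic (hu : IsSymplecticPotential D u) (k : ℕ) {α : EuclideanSpace ℝ (Fin n)}
    (hα : α ∈ D.carrier) (c : Fin n → Fin n → Fin n → ℝ) :
    pairing D u k α (fun x => ∑ i, (x i - α i) * ∑ j, (x j - α j) * ∑ l, (x l - α l) * c i j l) =
      ∑ i, ∑ j, ∑ l, c i j l * momentThree D u i j l k α := by
  have hy := contDiffOn_coord_sub D α
  have hc : ∀ r : ℝ, ContDiffOn ℝ ∞ (fun _ : EuclideanSpace ℝ (Fin n) => r) D.carrier :=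
    fun _ => contDiffOn_const
  have h3 : ∀ i j l, ContDiffOn ℝ ∞ (fun x : EuclideanSpace ℝ (Fin n) =>
      (x i - α i) * ((x j - α j) * ((x l - α l) * c i j l))) D.carrier :=
    fun i j l => (hy i).mul ((hy j).mul ((hy l).mul (hc _)))
  simp only [Finset.mul_sum]
  rw [pairing_sum hu k hα _ (fun i => ContDiffOn.sum fun j _ => ContDiffOn.sum fun l _ => h3 i j l)]
  refine Finset.sum_congr rfl fun i _ => ?_
  rw [pairing_sum hu k hα _ (fun j => ContDiffOn.sum fun l _ => h3 i j l)]
  refine Finset.sum_congr rfl fun j _ => ?_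
  rw [pairing_sum hu k hα _ (fun l => h3 i j l)]
  refine Finset.sum_congr rfl fun l _ => ?_
  rw [momentThree, ← pairing_const_mul]
  exact pairing_congr k α fun x _ => by ring

lemma pairing_sq_norm (hu : IsSymplecticPotential D u) (k : ℕ) {α : EuclideanSpace ℝ (Fin n)}
    (hα : α ∈ D.carrier) :
    pairing D u k α (fun x => ∑ i, (x i - α i) ^ 2) = ∑ i, momentTwo D u i i k α := by
  have hy := contDiffOn_coord_sub D α
  rw [pairing_sum hu k hα _ (fun i => (hy i).pow 2)]
  refine Finset.sum_congr rfl fun i _ => pairing_congr k α fun x _ => by ring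

lemma pairing_sq_norm_sq (hu : IsSymplecticPotential D u) (k : ℕ) {α : EuclideanSpace ℝ (Fin n)}
    (hα : α ∈ D.carrier) :
    pairing D u k α (fun x => (∑ i, (x i - α i) ^ 2) ^ 2) =
      ∑ i, ∑ j, momentFour D u i j k α := by
  have hy := contDiffOn_coord_sub D α
  have h : ∀ i j, ContDiffOn ℝ ∞ (fun x : EuclideanSpace ℝ (Fin n) =>
      (x i - α i) ^ 2 * (x j - α j) ^ 2) D.carrier := fun i j => ((hy i).pow 2).mul ((hy j).pow 2)
  simp only [pow_two (∑ i, _), Finset.sum_mul_sum]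
  rw [pairing_sum hu k hα _ (fun i => ContDiffOn.sum fun j _ => h i j)]
  refine Finset.sum_congr rfl fun i _ => ?_
  rw [pairing_sum hu k hα _ (fun j => h i j)]
  refine Finset.sum_congr rfl fun j _ => pairing_congr k α fun x _ => by ring

/-- The mass density concentrates at `α`, with an error of order `k⁻¹` for a fixed function. -/
lemma unifO_pairing_sub (hu : IsSymplecticPotential D u) {g : EuclideanSpace ℝ (Fin n) → ℝ}
    (hg : ContDiffOn ℝ ∞ g D.carrier) : UnifO D 1 (fun k α => pairing D u k α g - g α) := by
  have hy := fun α => contDiffOn_coord_sub D α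
  -- common bounds for the first and for the second derivatives of `g`
  choose B hB0 hB using fun i => exists_bound_of_contDiffOn D (contDiffOn_pdWithin D hg i)
  choose M hM0 hM using fun i j =>
    exists_bound_of_contDiffOn D (contDiffOn_pdWithin D (contDiffOn_pdWithin D hg i) j)
  have hM' : ∀ i j, ∀ x ∈ D.carrier,
      |pdWithin D.carrier j (pdWithin D.carrier i g) x| ≤ ∑ i, ∑ j, M i j := fun i j x hx =>
    (hM i j x hx).trans <| (Finset.single_le_sum (f := fun j => M i j)
      (fun j _ => hM0 i j) (Finset.mem_univ j)).trans <|
      Finset.single_le_sum (f := fun i => ∑ j, M i j)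
        (fun i _ => Finset.sum_nonneg fun j _ => hM0 i j) (Finset.mem_univ i)
  have hΨ : UnifO D 1 (fun k α => (∑ i, B i * |momentOne D u i k α|) +
      (∑ i, ∑ j, M i j) * n * ∑ i, momentTwo D u i i k α) :=
    (UnifO.sum _ fun i => (unifO_moment_one hu (contDiffOn_one D) i).abs.const_mul (B i)).add
      ((UnifO.sum _ fun i => unifO_moment_two hu (contDiffOn_one D) i i).const_mul _)
  refine hΨ.mono fun k hk α hα => le_trans ?_ (le_abs_self _)
  have hα' := interior_subset hα
  have h := abs_pairing_le hu k hα' (f := fun x => g x + ((-1) * g α + (-1) *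
      ∑ i, (x i - α i) * pdWithin D.carrier i g α))
    (g := fun x => ((∑ i, ∑ j, M i j) * n) * ∑ i, (x i - α i) ^ 2)
    (contDiffOn_const.mul (ContDiffOn.sum fun i _ => (hy α i).pow 2))
    (fun x hx => by
      have := abs_taylor_two_le D hg hM' hα' hx
      rw [← mul_assoc] at this
      refine le_of_eq_of_le (congrArg abs ?_) this
      ring)
  have hlin : ContDiffOn ℝ ∞ (fun x : EuclideanSpace ℝ (Fin n) =>
      (-1) * ∑ i, (x i - α i) * pdWithin D.carrier i g α) D.carrier :=
    contDiffOn_const.mul (ContDiffOn.sum fun i _ => (hy α i).mul contDiffOn_const)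
  rw [pairing_add hu k hα' hg (contDiffOn_const.add hlin),
    pairing_add hu k hα' contDiffOn_const hlin, pairing_const hu k hα', pairing_const_mul,
    pairing_linear hu k hα', pairing_const_mul, pairing_sq_norm hu k hα'] at h
  have hsum : |∑ i, pdWithin D.carrier i g α * momentOne D u i k α| ≤
      ∑ i, B i * |momentOne D u i k α| := by
    refine (Finset.abs_sum_le_sum_abs _ _).trans (Finset.sum_le_sum fun i _ => ?_)
    rw [abs_mul]
    exact mul_le_mul_of_nonneg_right (hB i α hα') (abs_nonneg _)
  calc |pairing D u k α g - g α|
      = |(∑ i, pdWithin D.carrier i g α * momentOne D u i k α) +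
          (pairing D u k α g + ((-1) * g α +
            (-1) * ∑ i, pdWithin D.carrier i g α * momentOne D u i k α))| := by
        congr 1; ring
    _ ≤ _ := (abs_add_le _ _).trans (add_le_add hsum h)

lemma unifO_momentOne_sub (hu : IsSymplecticPotential D u) (i : Fin n) :
    UnifO D 2 (fun k α => momentOne D u i k α -
      1 / (2 * (k : ℝ)) * steinOp D u i (fun _ => 1) α) := by
  refine (unifO_pairing_sub hu (contDiffOn_steinOp hu i (contDiffOn_one D))).gain.congr
    fun k hk α hα => ?_
  rw [momentOne, pairing_coord_sub_mul hu hk hα (contDiffOn_one D)]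
  ring

lemma unifO_momentTwo_sub (hu : IsSymplecticPotential D u) (i j : Fin n) :
    UnifO D 2 (fun k α => momentTwo D u i j k α - 1 / (2 * (k : ℝ)) * invHess D u i j α) := by
  refine ((unifO_moment_one hu (contDiffOn_steinOp hu i (contDiffOn_one D)) j).add
    (unifO_pairing_sub hu (contDiffOn_invHess hu i j))).gain.congr fun k hk α hα => ?_
  rw [momentTwo, pairing_coord_sub_mul_coord_sub_mul hu hk hα (contDiffOn_one D)]
  simp only [mul_one]
  ring

/-- The coefficient `s f + ½ ∂_i ∂_j (G^{ij} f)` of `1 / (2 k)` in the expansion. -/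
noncomputable def subleading (D : DelzantPolytope n) (u f : EuclideanSpace ℝ (Fin n) → ℝ)
    (α : EuclideanSpace ℝ (Fin n)) : ℝ :=
  scalarCurvature D u α * f α + 1 / 2 * ∑ i, ∑ j, pdWithin D.carrier i
    (pdWithin D.carrier j (fun y => invHess D u i j y * f y)) α

lemma contDiffOn_subleading (hu : IsSymplecticPotential D u) {f : EuclideanSpace ℝ (Fin n) → ℝ}
    (hf : ContDiffOn ℝ ∞ f D.carrier) : ContDiffOn ℝ ∞ (subleading D u f) D.carrier :=
  ((contDiffOn_scalarCurvature hu).mul hf).add <| contDiffOn_const.mul <|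
    ContDiffOn.sum fun i _ => ContDiffOn.sum fun j _ => contDiffOn_pdWithin D
      (contDiffOn_pdWithin D ((contDiffOn_invHess hu i j).mul hf) j) i

lemma pdWithin_pdWithin_add {f g : EuclideanSpace ℝ (Fin n) → ℝ}
    (hf : ContDiffOn ℝ ∞ f D.carrier) (hg : ContDiffOn ℝ ∞ g D.carrier)
    {x : EuclideanSpace ℝ (Fin n)} (hx : x ∈ D.carrier) (i j : Fin n) :
    pdWithin D.carrier i (pdWithin D.carrier j (fun y => f y + g y)) x =
      pdWithin D.carrier i (pdWithin D.carrier j f) x +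
        pdWithin D.carrier i (pdWithin D.carrier j g) x := by
  rw [pdWithin_congr (fun y hy => pdWithin_add D hf hg hy j) hx i,
    pdWithin_add D (contDiffOn_pdWithin D hf j) (contDiffOn_pdWithin D hg j) hx]

lemma pdWithin_pdWithin_const_mul (c : ℝ) {f : EuclideanSpace ℝ (Fin n) → ℝ}
    (hf : ContDiffOn ℝ ∞ f D.carrier) {x : EuclideanSpace ℝ (Fin n)} (hx : x ∈ D.carrier)
    (i j : Fin n) :
    pdWithin D.carrier i (pdWithin D.carrier j (fun y => c * f y)) x =
      c * pdWithin D.carrier i (pdWithin D.carrier j f) x := by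
  rw [pdWithin_congr (fun y hy => pdWithin_const_mul D c hf hy j) hx i,
    pdWithin_const_mul D c (contDiffOn_pdWithin D hf j) hx]

lemma pdWithin_pdWithin_mul {f g : EuclideanSpace ℝ (Fin n) → ℝ}
    (hf : ContDiffOn ℝ ∞ f D.carrier) (hg : ContDiffOn ℝ ∞ g D.carrier)
    {x : EuclideanSpace ℝ (Fin n)} (hx : x ∈ D.carrier) (i j : Fin n) :
    pdWithin D.carrier i (pdWithin D.carrier j (fun y => f y * g y)) x =
      f x * pdWithin D.carrier i (pdWithin D.carrier j g) x +
      pdWithin D.carrier i f x * pdWithin D.carrier j g x +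
      (pdWithin D.carrier j f x * pdWithin D.carrier i g x +
      pdWithin D.carrier i (pdWithin D.carrier j f) x * g x) := by
  have hf' := contDiffOn_pdWithin D hf j
  have hg' := contDiffOn_pdWithin D hg j
  rw [pdWithin_congr (fun y hy => pdWithin_mul D hf hg hy j) hx i,
    pdWithin_add D (hf.mul hg') (hf'.mul hg) hx, pdWithin_mul D hf hg' hx,
    pdWithin_mul D hf' hg hx]

/-- Abreu's formula `s = -½ ∂_i ∂_j G^{ij}` cancels the zeroth order term of `½ ∂_i ∂_j (G^{ij} f)`;
what is left is the prediction of the first two moments for the Taylor polynomial of `f`. -/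
lemma subleading_eq (hu : IsSymplecticPotential D u) {f : EuclideanSpace ℝ (Fin n) → ℝ}
    (hf : ContDiffOn ℝ ∞ f D.carrier) {α : EuclideanSpace ℝ (Fin n)} (hα : α ∈ D.carrier) :
    subleading D u f α =
      (∑ i, pdWithin D.carrier i f α * steinOp D u i (fun _ => 1) α) +
      1 / 2 * ∑ i, ∑ j, pdWithin D.carrier j (pdWithin D.carrier i f) α * invHess D u i j α := by
  have hG := contDiffOn_invHess hu
  have hswap : ∀ i j l, pdWithin D.carrier l (invHess D u i j) α =
      pdWithin D.carrier l (invHess D u j i) α := fun i j l =>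
    pdWithin_congr (fun x hx => invHess_symm hu hx i j) hα l
  have hdiv : ∀ i, steinOp D u i (fun _ => 1) α =
      ∑ j, pdWithin D.carrier j (invHess D u i j) α := by
    intro i; simp only [steinOp, mul_one]
  have e1 : ∑ i, ∑ j, invHess D u i j α * pdWithin D.carrier i (pdWithin D.carrier j f) α =
      ∑ i, ∑ j, pdWithin D.carrier j (pdWithin D.carrier i f) α * invHess D u i j α := by
    rw [Finset.sum_comm]
    refine Finset.sum_congr rfl fun i _ => Finset.sum_congr rfl fun j _ => ?_
    rw [invHess_symm hu hα, mul_comm]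
  have e2 : ∑ i, ∑ j, pdWithin D.carrier i (invHess D u i j) α * pdWithin D.carrier j f α =
      ∑ i, pdWithin D.carrier i f α * steinOp D u i (fun _ => 1) α := by
    rw [Finset.sum_comm]
    refine Finset.sum_congr rfl fun i _ => ?_
    rw [hdiv, Finset.mul_sum]
    refine Finset.sum_congr rfl fun j _ => ?_
    rw [hswap, mul_comm]
  have e3 : ∑ i, ∑ j, pdWithin D.carrier j (invHess D u i j) α * pdWithin D.carrier i f α =
      ∑ i, pdWithin D.carrier i f α * steinOp D u i (fun _ => 1) α := by
    refine Finset.sum_congr rfl fun i _ => ?_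
    rw [hdiv, Finset.mul_sum]
    exact Finset.sum_congr rfl fun j _ => mul_comm _ _
  have e4 : ∑ i, ∑ j, pdWithin D.carrier i (pdWithin D.carrier j
      (fun y => invHess D u i j y * f y)) α =
      (∑ i, ∑ j, pdWithin D.carrier j (pdWithin D.carrier i f) α * invHess D u i j α) +
      2 * (∑ i, pdWithin D.carrier i f α * steinOp D u i (fun _ => 1) α) +
      (∑ i, ∑ j, pdWithin D.carrier i (pdWithin D.carrier j (invHess D u i j)) α) * f α := by
    simp only [fun i j => pdWithin_pdWithin_mul (hG i j) hf hα i j, Finset.sum_add_distrib,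
      e1, e2, e3]
    simp only [← Finset.sum_mul]
    ring
  rw [subleading, scalarCurvature_eq hu hα, e4]
  ring

/-- The error in the expansion, before the normalization by `k²`. -/
noncomputable def expansionError (D : DelzantPolytope n) (u : EuclideanSpace ℝ (Fin n) → ℝ)
    (k : ℕ) (f : EuclideanSpace ℝ (Fin n) → ℝ) (α : EuclideanSpace ℝ (Fin n)) : ℝ :=
  pairing D u k α f - f α - 1 / (2 * (k : ℝ)) * subleading D u f α

lemma contDiffOn_expansionError (hu : IsSymplecticPotential D u) (k : ℕ)
    {f : EuclideanSpace ℝ (Fin n) → ℝ} (hf : ContDiffOn ℝ ∞ f D.carrier) :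
    ContDiffOn ℝ ∞ (expansionError D u k f) D.carrier :=
  ((contDiffOn_pairing hu k hf).sub hf).sub (contDiffOn_const.mul (contDiffOn_subleading hu hf))

/-- The factor by which the moments of order at most four control the error in the expansion. -/
noncomputable def errorFactor (D : DelzantPolytope n) (u : EuclideanSpace ℝ (Fin n) → ℝ)
    (k : ℕ) (α : EuclideanSpace ℝ (Fin n)) : ℝ :=
  ((∑ i, |momentOne D u i k α - 1 / (2 * (k : ℝ)) * steinOp D u i (fun _ => 1) α|) +
    1 / 2 * ∑ i, ∑ j, |momentTwo D u i j k α - 1 / (2 * (k : ℝ)) * invHess D u i j α|) +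
  (1 / 6 * (∑ i, ∑ j, ∑ l, |momentThree D u i j l k α|) +
    (n : ℝ) ^ 2 * ∑ i, ∑ j, momentFour D u i j k α)

lemma unifO_errorFactor (hu : IsSymplecticPotential D u) : UnifO D 2 (errorFactor D u) :=
  ((UnifO.sum _ fun i => (unifO_momentOne_sub hu i).abs).add
    ((UnifO.sum _ fun i => UnifO.sum _ fun j => (unifO_momentTwo_sub hu i j).abs).const_mul _)).add
  (((UnifO.sum _ fun i => UnifO.sum _ fun j => UnifO.sum _ fun l =>
    (unifO_moment_three hu (contDiffOn_one D) i j l).abs).const_mul _).add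
    ((UnifO.sum _ fun i => UnifO.sum _ fun j =>
      unifO_moment_four hu (contDiffOn_one D) i i j j).const_mul _))

lemma abs_sum_mul_le {ι : Type} (s : Finset ι) {c m b : ι → ℝ} {N : ℝ}
    (h : ∀ i ∈ s, |c i| ≤ N) (hm : ∀ i ∈ s, |m i| ≤ b i) (hN : 0 ≤ N) :
    |∑ i ∈ s, c i * m i| ≤ N * ∑ i ∈ s, b i := by
  rw [Finset.mul_sum]
  refine (Finset.abs_sum_le_sum_abs _ _).trans (Finset.sum_le_sum fun i hi => ?_)
  rw [abs_mul]
  exact mul_le_mul (h i hi) (hm i hi) (abs_nonneg _) hN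

lemma cNorm_nonneg (D : DelzantPolytope n) (r : ℕ) (f : EuclideanSpace ℝ (Fin n) → ℝ) :
    0 ≤ cNorm D r f :=
  Finset.sum_nonneg fun _ _ => Real.iSup_nonneg fun _ => norm_nonneg _

lemma abs_expansionError_le (hu : IsSymplecticPotential D u) (k : ℕ)
    {f : EuclideanSpace ℝ (Fin n) → ℝ} (hf : ContDiffOn ℝ ∞ f D.carrier)
    {α : EuclideanSpace ℝ (Fin n)} (hα : α ∈ D.carrier) :
    |expansionError D u k f α| ≤ cNorm D 4 f * errorFactor D u k α := by
  have hy := contDiffOn_coord_sub D α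
  have hN := cNorm_nonneg D 4 f
  set N := cNorm D 4 f
  set f₁ := fun i => pdWithin D.carrier i f α with hf₁
  set f₂ := fun i j => pdWithin D.carrier j (pdWithin D.carrier i f) α with hf₂
  set f₃ := fun i j l => pdWithin D.carrier l (pdWithin D.carrier j (pdWithin D.carrier i f)) α
    with hf₃
  have hc : ∀ r : ℝ, ContDiffOn ℝ ∞ (fun _ : EuclideanSpace ℝ (Fin n) => r) D.carrier :=
    fun _ => contDiffOn_const
  have c1 : ContDiffOn ℝ ∞ (fun x : EuclideanSpace ℝ (Fin n) =>
      (-1) * ∑ i, (x i - α i) * f₁ i) D.carrier :=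
    (hc _).mul (ContDiffOn.sum fun i _ => (hy i).mul (hc _))
  have c2 : ContDiffOn ℝ ∞ (fun x : EuclideanSpace ℝ (Fin n) =>
      (-(1 / 2)) * ∑ i, (x i - α i) * ∑ j, (x j - α j) * f₂ i j) D.carrier :=
    (hc _).mul (ContDiffOn.sum fun i _ => (hy i).mul (ContDiffOn.sum fun j _ => (hy j).mul (hc _)))
  have c3 : ContDiffOn ℝ ∞ (fun x : EuclideanSpace ℝ (Fin n) =>
      (-(1 / 6)) * ∑ i, (x i - α i) * ∑ j, (x j - α j) * ∑ l, (x l - α l) * f₃ i j l)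
      D.carrier :=
    (hc _).mul (ContDiffOn.sum fun i _ => (hy i).mul (ContDiffOn.sum fun j _ => (hy j).mul
      (ContDiffOn.sum fun l _ => (hy l).mul (hc _))))
  have h := abs_pairing_le hu k hα (f := fun x => f x + ((-1) * f α +
      ((-1) * (∑ i, (x i - α i) * f₁ i) +
      ((-(1 / 2)) * (∑ i, (x i - α i) * ∑ j, (x j - α j) * f₂ i j) +
      (-(1 / 6)) * ∑ i, (x i - α i) * ∑ j, (x j - α j) * ∑ l, (x l - α l) * f₃ i j l))))
    (g := fun x => (N * n ^ 2) * (∑ i, (x i - α i) ^ 2) ^ 2)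
    (contDiffOn_const.mul ((ContDiffOn.sum fun i _ => (hy i).pow 2).pow 2))
    (fun x hx => by
      have := abs_taylor_four_le D hf (fun i j l m x hx => abs_pdWithin_four_le hf hx i j l m)
        hα hx
      rw [mul_pow, ← mul_assoc] at this
      refine le_of_eq_of_le (congrArg abs ?_) this
      simp only [hf₁, hf₂, hf₃]
      ring)
  rw [pairing_add hu k hα hf ((hc _).add (c1.add (c2.add c3))),
    pairing_add hu k hα (hc _) (c1.add (c2.add c3)), pairing_add hu k hα c1 (c2.add c3),
    pairing_add hu k hα c2 c3, pairing_const hu k hα, pairing_const_mul, pairing_const_mul,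
    pairing_const_mul, pairing_const_mul, pairing_linear hu k hα, pairing_quadratic hu k hα,
    pairing_cubic hu k hα, pairing_sq_norm_sq hu k hα] at h
  have b1 : |∑ i, f₁ i * (momentOne D u i k α -
      1 / (2 * (k : ℝ)) * steinOp D u i (fun _ => 1) α)| ≤ N * ∑ i, |momentOne D u i k α -
        1 / (2 * (k : ℝ)) * steinOp D u i (fun _ => 1) α| :=
    abs_sum_mul_le _ (fun i _ => abs_pdWithin_le hf hα i) (fun i _ => le_rfl) hN
  have b2 : |∑ i, ∑ j, f₂ i j * (momentTwo D u i j k α -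
      1 / (2 * (k : ℝ)) * invHess D u i j α)| ≤ N * ∑ i, ∑ j, |momentTwo D u i j k α -
        1 / (2 * (k : ℝ)) * invHess D u i j α| := by
    rw [Finset.mul_sum]
    exact (Finset.abs_sum_le_sum_abs _ _).trans (Finset.sum_le_sum fun i _ =>
      abs_sum_mul_le _ (fun j _ => abs_pdWithin_two_le hf hα i j) (fun j _ => le_rfl) hN)
  have b3 : |∑ i, ∑ j, ∑ l, f₃ i j l * momentThree D u i j l k α| ≤
      N * ∑ i, ∑ j, ∑ l, |momentThree D u i j l k α| := by
    rw [Finset.mul_sum]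
    refine (Finset.abs_sum_le_sum_abs _ _).trans (Finset.sum_le_sum fun i _ => ?_)
    rw [Finset.mul_sum]
    exact (Finset.abs_sum_le_sum_abs _ _).trans (Finset.sum_le_sum fun j _ =>
      abs_sum_mul_le _ (fun l _ => abs_pdWithin_three_le hf hα i j l) (fun l _ => le_rfl) hN)
  simp only [mul_sub, Finset.sum_sub_distrib, mul_left_comm _ (1 / (2 * (k : ℝ))),
    ← Finset.mul_sum] at b1 b2
  rw [expansionError, subleading_eq hu hf hα, errorFactor]
  simp only [abs_le] at h b1 b2 b3 ⊢
  constructor <;> linarith [h.1, h.2, b1.1, b1.2, b2.1, b2.2, b3.1, b3.2]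

/-- The estimate in the interior extends to the boundary because both the error and the bound
depend continuously on `α`. -/
lemma exists_bound_expansionError (hu : IsSymplecticPotential D u) :
    ∃ C : ℝ, ∀ k : ℕ, 1 ≤ k → ∀ α ∈ D.carrier, ∀ f : EuclideanSpace ℝ (Fin n) → ℝ,
      ContDiffOn ℝ ∞ f D.carrier → |(k : ℝ) ^ 2 * expansionError D u k f α| ≤ C * cNorm D 4 f := by
  obtain ⟨C, hC⟩ := unifO_errorFactor hu
  refine ⟨C, fun k hk α hα f hf => ?_⟩
  have hk0 : (0 : ℝ) < (k : ℝ) ^ 2 := by positivity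
  have hcont : ContinuousOn (fun α => |(k : ℝ) ^ 2 * expansionError D u k f α|) D.carrier :=
    (continuousOn_const.mul (contDiffOn_expansionError hu k hf).continuousOn).abs
  have hcl : α ∈ closure (interior D.carrier) := by rwa [closure_interior_carrier]
  refine ContinuousWithinAt.closure_le hcl ((hcont α hα).mono interior_subset)
    continuousWithinAt_const fun β hβ => ?_
  rw [abs_mul, abs_of_pos hk0]
  calc (k : ℝ) ^ 2 * |expansionError D u k f β|
      ≤ (k : ℝ) ^ 2 * (cNorm D 4 f * (C / (k : ℝ) ^ 2)) := by
        refine mul_le_mul_of_nonneg_left ((abs_expansionError_le hu k hf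
          (interior_subset hβ)).trans ?_) hk0.le
        exact mul_le_mul_of_nonneg_left ((le_abs_self _).trans (hC k hk β hβ)) (cNorm_nonneg D 4 f)
    _ = C * cNorm D 4 f := by field_simp

lemma subleading_add (hu : IsSymplecticPotential D u) {f g : EuclideanSpace ℝ (Fin n) → ℝ}
    (hf : ContDiffOn ℝ ∞ f D.carrier) (hg : ContDiffOn ℝ ∞ g D.carrier)
    {α : EuclideanSpace ℝ (Fin n)} (hα : α ∈ D.carrier) :
    subleading D u (fun x => f x + g x) α = subleading D u f α + subleading D u g α := by
  have hG := contDiffOn_invHess hu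
  simp only [subleading, mul_add,
    fun i j => pdWithin_pdWithin_add ((hG i j).mul hf) ((hG i j).mul hg) hα i j,
    Finset.sum_add_distrib]
  ring

lemma subleading_const_mul (hu : IsSymplecticPotential D u) (c : ℝ)
    {f : EuclideanSpace ℝ (Fin n) → ℝ} (hf : ContDiffOn ℝ ∞ f D.carrier)
    {α : EuclideanSpace ℝ (Fin n)} (hα : α ∈ D.carrier) :
    subleading D u (fun x => c * f x) α = c * subleading D u f α := by
  have hG := contDiffOn_invHess hu
  simp only [subleading, mul_left_comm _ c,
    fun i j => pdWithin_pdWithin_const_mul c ((hG i j).mul hf) hα i j, ← Finset.mul_sum]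
  ring

open Classical in
/-- The functional `R_k(α)`. It is set to zero for `α` outside the polytope. -/
noncomputable def remainder (hu : IsSymplecticPotential D u) (k : ℕ)
    (α : EuclideanSpace ℝ (Fin n)) : smoothFunctions D →ₗ[ℝ] ℝ :=
  if hα : α ∈ D.carrier then
    { toFun := fun f => (k : ℝ) ^ 2 * expansionError D u k f.1 α
      map_add' := fun f g => by
        change (k : ℝ) ^ 2 * (pairing D u k α (fun x => f.1 x + g.1 x) - (f.1 α + g.1 α) -
          1 / (2 * (k : ℝ)) * subleading D u (fun x => f.1 x + g.1 x) α) = _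
        rw [pairing_add hu k hα f.2 g.2, subleading_add hu f.2 g.2 hα, expansionError,
          expansionError]
        ring
      map_smul' := fun c f => by
        change (k : ℝ) ^ 2 * (pairing D u k α (fun x => c * f.1 x) - c * f.1 α -
          1 / (2 * (k : ℝ)) * subleading D u (fun x => c * f.1 x) α) =
          c * ((k : ℝ) ^ 2 * expansionError D u k f.1 α)
        rw [pairing_const_mul, subleading_const_mul hu c f.2 hα, expansionError]
        ring }
  else 0

lemma remainder_apply (hu : IsSymplecticPotential D u) (k : ℕ) {α : EuclideanSpace ℝ (Fin n)}
    (hα : α ∈ D.carrier) (f : smoothFunctions D) :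
    remainder hu k α f = (k : ℝ) ^ 2 * expansionError D u k f.1 α := by
  rw [remainder, dif_pos hα]
  rfl

end expansion

end Toric

theorem proposition3p3 (n : ℕ) (D : Toric.DelzantPolytope n) (u : EuclideanSpace ℝ (Fin n) → ℝ)
    (hu : Toric.IsSymplecticPotential D u) :
    (∀ i j, ContDiffOn ℝ ∞ (Toric.invHess D u i j) D.carrier) ∧
    ContDiffOn ℝ ∞ (Toric.scalarCurvature D u) D.carrier ∧
    ∃ R : ℕ → EuclideanSpace ℝ (Fin n) → (Toric.smoothFunctions D →ₗ[ℝ] ℝ),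
      (∀ k : ℕ, 1 ≤ k → ∀ α ∈ D.carrier, ∀ f : Toric.smoothFunctions D,
        Toric.pairing D u k α f.1 = f.1 α +
          1 / (2 * (k : ℝ)) * (Toric.scalarCurvature D u α * f.1 α +
            1 / 2 * ∑ i, ∑ j, Toric.pdWithin D.carrier i (Toric.pdWithin D.carrier j
              (fun y => Toric.invHess D u i j y * f.1 y)) α) +
          1 / (k : ℝ) ^ 2 * R k α f) ∧
      (∃ C : ℝ, ∀ k : ℕ, 1 ≤ k → ∀ α ∈ D.carrier, ∀ f : Toric.smoothFunctions D,
        |R k α f| ≤ C * Toric.cNorm D 4 f.1) ∧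
      (∀ k : ℕ, 1 ≤ k → ∀ f : Toric.smoothFunctions D,
        ContDiffOn ℝ ∞ (fun α => R k α f) D.carrier) := by
  refine ⟨Toric.contDiffOn_invHess hu, Toric.contDiffOn_scalarCurvature hu, Toric.remainder hu,
    fun k hk α hα f => ?_, ?_, fun k _ f => ?_⟩
  · have hk0 : (k : ℝ) ^ 2 ≠ 0 := by positivity
    rw [Toric.remainder_apply hu k hα, ← mul_assoc, one_div_mul_cancel hk0, one_mul,
      Toric.expansionError, Toric.subleading]
    ring
  · obtain ⟨C, hC⟩ := Toric.exists_bound_expansionError hu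
    refine ⟨C, fun k hk α hα f => ?_⟩
    rw [Toric.remainder_apply hu k hα]
    exact hC k hk α hα f.1 f.2
  · exact (contDiffOn_const.mul (Toric.contDiffOn_expansionError hu k f.2)).congr
      fun α hα => Toric.remainder_apply hu k hα f
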